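/- Let $F:[0,\infty)\to\mathbb R$, $F(s)=\frac{m^2}{2}s^2+N(s)$, satisfy: (i) $F\ge 0$; (ii) $F\in C^2$, $F(0)=F'(0)=0$, $F''(0)=m^2>0$; (iii) $N(s_0)<0$ for some $s_0>0$; (iv) either $|N'(s)|\le a s^{p-1}+b s^{q-1}$ for all $s>0$, with constants $a,b>0$ and $2<p\le q<6$, or $N'(s_1)\ge 0$ for some $s_1>s_0$. Write $x=(y,z)\in\mathbb R^2\times\mathbb R$, $r=|y|$, and let $\theta(y)$ be the angular variable of $y$. For $(\psi,\psi_t)\in H^1(\mathbb R^3,\mathbb C)\times L^2(\mathbb R^3,\mathbb C)$ define the energy $\mathcal E=\int \big[\frac12|\psi_t|^2+\frac12|\nabla\psi|^2+F(|\psi|)\big]dx\in[0,\infty]$, the charge $\mathcal H=\mathrm{Im}\int\psi_t\overline\psi\,dx$ and, when the integrand is integrable, the angular momentum $\mathbf M=\mathrm{Re}\int x\times\nabla\psi\,\overline{\psi_t}\,dx\in\mathbb R^3$. Let $\tilde H^1_c$ be the set of a.e. nonnegative functions in the closure of the cylindrically symmetric functions ($u=u(r,z)$) of $C_0^\infty((\mathbb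 R^2\setminus\{0\})\times\mathbb R)$ in the norm whose square is $\int[|\nabla u|^2+(1+\frac1{r^2})u^2]dx$. For $u \in \tilde H^1_c$, $\omega<0$ and $\ell\in\mathbb Z$ put $E(u,\omega,\ell)=\int\big[\frac12|\nabla u|^2+\frac12(\omega^2+\frac{\ell^2}{r^2})u^2+F(u)\big]dx$, and let $C_h=\{(u,\omega)\in\tilde H^1_c\times(-\infty,0): -\int\omega u^2dx=h\}$. **Theorem.** Let $\ell\in\mathbb Z\setminus\{0\}$ and $h\ne0$, let $(\bar u,\bar\omega)$ be a minimizer of $E(\cdot,\cdot,\ell)$ on $C_h$, and let $\bar\psi(t,x)=\bar u(x)e^{i(\ell\theta(y)-\bar\omega t)}$ be the corresponding vortex. Then, at every time, $(\bar\psi,\partial_t\bar\psi)\in H^1\times L^2$ has charge $h$, finite energy, and angular momentum $\mathbf m:=\mathbf M(\bar\psi)=(0,0,\ell h)$ (where the integrals of the first two components, if not absolutely convergent, are given the value $0$ that they have by symmetry), and $$\inf_{\mathcal H=h,\ \mathbf M=\mathbf m}\mathcal E=\inf_{\mathcal H=h}\mathcal E=\inf_{(u,\omega)\in C_h}E(u,\omega,0)<\mathcal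 E(\bar\psi),$$ the first two infima being over $H^1\times L^2$ (and, in the first one, over the fields whose angular momentum density is integrable). In particular some field of charge $h$ and angular momentum $\mathbf m$ has energy strictly smaller than $\mathcal E(\bar\psi)$. -/

import Mathlib

open MeasureTheory

noncomputable section

namespace KleinGordon

/-- Three-dimensional space, with points `x = (y, z)`, `y = (x 0, x 1)`, `z = x 2`. -/
abbrev Space := EuclideanSpace ℝ (Fin 3)

/-- The squared distance `r² = y₁² + y₂²` from the axis `y = 0`. -/
def rsq (x : Space) : ℝ := x 0 ^ 2 + x 1 ^ 2

/-- The angular variable `θ(y) = Im log (y₁ + i y₂)`. -/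
def theta (x : Space) : ℝ := (Complex.log ((x 0 : ℂ) + Complex.I * (x 1 : ℂ))).im

/-! ### Weak gradients and `H¹` -/

/-- `g` is a weak (distributional) gradient of `f` on the whole space. -/
structure HasWeakGradient {𝕜 : Type*} [RCLike 𝕜]
    (f : Space → 𝕜) (g : Space → EuclideanSpace 𝕜 (Fin 3)) : Prop where
  locallyIntegrable : LocallyIntegrable f volume
  locallyIntegrable_grad : LocallyIntegrable g volume
  integral_eq : ∀ φ : Space → ℝ, ContDiff ℝ ((⊤ : ℕ∞) : WithTop ℕ∞) φ → HasCompactSupport φ → ∀ i : Fin 3,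
    ∫ x, (fderiv ℝ φ x (EuclideanSpace.single i 1)) • f x = - ∫ x, φ x • g x i

open Classical in
/-- The weak gradient (unique almost everywhere when it exists; `0` when it does not exist,
a case that does not occur for functions in `H¹`). -/
def weakGrad {𝕜 : Type*} [RCLike 𝕜] (f : Space → 𝕜) : Space → EuclideanSpace 𝕜 (Fin 3) :=
  if hf : ∃ g, HasWeakGradient f g then hf.choose else 0

/-- The Sobolev space `H¹(ℝ³, 𝕜)`, as a predicate on functions. -/
def IsH1 {𝕜 : Type*} [RCLike 𝕜] (f : Space → 𝕜) : Prop :=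
  MemLp f 2 volume ∧ ∃ g, HasWeakGradient f g ∧ MemLp g 2 volume

/-! ### The nonlinearity -/

/-- The assumptions on the nonlinearity `W(ψ) = F(|ψ|)`, `F(s) = m² s² / 2 + N(s)` for `s ≥ 0`,
in dimension three: positivity, nondegeneracy, hylomorphy, and the growth condition.
Only the values of `F` on `[0, ∞)` matter. -/
structure Admissible (F : ℝ → ℝ) (m : ℝ) : Prop where
  nonneg : ∀ s, 0 ≤ s → 0 ≤ F s
  contDiffOn : ContDiffOn ℝ 2 F (Set.Ici 0)
  zero : F 0 = 0
  deriv_zero : derivWithin F (Set.Ici 0) 0 = 0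
  deriv2_zero : iteratedDerivWithin 2 F (Set.Ici 0) 0 = m ^ 2
  mass_pos : 0 < m ^ 2
  hylomorphy_growth : ∃ s₀ > 0, F s₀ - m ^ 2 / 2 * s₀ ^ 2 < 0 ∧
    ((∃ a b p q : ℝ, 0 < a ∧ 0 < b ∧ 2 < p ∧ p ≤ q ∧ q < 6 ∧
        ∀ s > 0, |deriv (fun σ => F σ - m ^ 2 / 2 * σ ^ 2) s| ≤ a * s ^ (p - 1) + b * s ^ (q - 1)) ∨
      ∃ s₁ > s₀, 0 ≤ deriv (fun σ => F σ - m ^ 2 / 2 * σ ^ 2) s₁)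

/-! ### General fields `(ψ, ∂ₜψ)` -/

/-- The state of a field at a given time: the pair `(ψ, ∂ₜψ)`. -/
abbrev State := (Space → ℂ) × (Space → ℂ)

/-- The phase space `H¹(ℝ³, ℂ) × L²(ℝ³, ℂ)`. -/
def phaseSpace : Set State := {Ψ | IsH1 Ψ.1 ∧ MemLp Ψ.2 2 volume}

/-- The energy `∫ ½ |∂ₜψ|² + ½ |∇ψ|² + W(ψ)`. It takes values in `[0, ∞]`, because the potential
part need not be integrable; the integrand is nonnegative for `F ≥ 0`. -/
def energy (F : ℝ → ℝ) (Ψ : State) : ENNReal :=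
  ∫⁻ x, ENNReal.ofReal
    (1 / 2 * ‖Ψ.2 x‖ ^ 2 + 1 / 2 * ‖weakGrad Ψ.1 x‖ ^ 2 + F ‖Ψ.1 x‖)

/-- The charge `Im ∫ ∂ₜψ ψ̄`. -/
def charge (Ψ : State) : ℝ := (∫ x, Ψ.2 x * starRingEnd ℂ (Ψ.1 x)).im

/-- The density `Re ((x × ∇ψ) conj (∂ₜψ))` of angular momentum. -/
def angularDensity (Ψ : State) (x : Space) (i : Fin 3) : ℝ :=
  (crossProduct (fun j => (x j : ℂ)) (fun j => weakGrad Ψ.1 x j) i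
    * starRingEnd ℂ (Ψ.2 x)).re

/-- The angular momentum `Re ∫ (x × ∇ψ) conj (∂ₜψ)`, component by component. -/
def angularMomentum (Ψ : State) (i : Fin 3) : ℝ := ∫ x, angularDensity Ψ x i

/-- The fields with charge `h`. -/
def chargeSet (h : ℝ) : Set State := {Ψ | Ψ ∈ phaseSpace ∧ charge Ψ = h}

/-- The fields with charge `h` and (well-defined) angular momentum `μ`. -/
def chargeMomentumSet (h : ℝ) (μ : Fin 3 → ℝ) : Set State :=
  {Ψ | Ψ ∈ phaseSpace ∧ charge Ψ = h ∧
    (∀ i, Integrable (fun x => angularDensity Ψ x i) volume) ∧ angularMomentum Ψ = μ}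

/-! ### The vortex ansatz -/

/-- Cylindrical symmetry `u = u(r, z)`. -/
def CylSymm (u : Space → ℝ) : Prop := ∀ x x', rsq x = rsq x' → x 2 = x' 2 → u x = u x'

/-- Cylindrically symmetric functions in `C₀^∞((ℝ² ∖ {0}) × ℝ)`. -/
def IsCylTest (φ : Space → ℝ) : Prop :=
  ContDiff ℝ ((⊤ : ℕ∞) : WithTop ℕ∞) φ ∧ HasCompactSupport φ ∧ tsupport φ ⊆ {x | rsq x ≠ 0} ∧ CylSymm φ

/-- The (squared) norm `∫ |∇u|² + (1 + 1/r²) u²`. -/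
def cylNormSq (u : Space → ℝ) : ENNReal :=
  ∫⁻ x, ENNReal.ofReal (‖weakGrad u x‖ ^ 2 + (1 + 1 / rsq x) * u x ^ 2)

/-- The cone of (almost everywhere) nonnegative functions in the closure of the cylindrically
symmetric test functions with respect to the norm above. -/
def cylCone : Set (Space → ℝ) :=
  {u | IsH1 u ∧ (∀ ε : ENNReal, 0 < ε → ∃ φ, IsCylTest φ ∧ cylNormSq (u - φ) < ε) ∧ ∀ᵐ x, 0 ≤ u x}

/-- The energy `E(u, ω, ℓ)` of the ansatz. -/
def staticEnergy (F : ℝ → ℝ) (u : Space → ℝ) (ω : ℝ) (ℓ : ℤ) : ENNReal :=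
  ∫⁻ x, ENNReal.ofReal
    (1 / 2 * ‖weakGrad u x‖ ^ 2 + 1 / 2 * (ω ^ 2 + (ℓ : ℝ) ^ 2 / rsq x) * u x ^ 2 + F (u x))

/-- The charge `H(u, ω) = - ∫ ω u²` of the ansatz. -/
def staticCharge (u : Space → ℝ) (ω : ℝ) : ℝ := - ∫ x, ω * u x ^ 2

/-- The manifold `C_h` of pairs `(u, ω)`, `ω < 0`, of charge `h`. -/
def C (h : ℝ) : Set ((Space → ℝ) × ℝ) :=
  {p | p.1 ∈ cylCone ∧ p.2 < 0 ∧ staticCharge p.1 p.2 = h}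

/-- The vortex `ψ(t, x) = u(x) exp(i (ℓ θ(y) - ω t))`. -/
def vortex (u : Space → ℝ) (ω : ℝ) (ℓ : ℤ) (t : ℝ) (x : Space) : ℂ :=
  (u x : ℂ) * Complex.exp (Complex.I * (((ℓ : ℝ) * theta x - ω * t : ℝ) : ℂ))

/-- The state `(ψ, ∂ₜψ)` at time `t` of a space-time field `ψ`. -/
def stateAt (ψ : ℝ → Space → ℂ) (t : ℝ) : State :=
  (ψ t, fun x => deriv (fun s => ψ s x) t)

end KleinGordon

end

noncomputable section

namespace KleinGordon

open Filter Topology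
open scoped ENNReal

/-! ### Elementary facts on the `L²` norm -/

section LTwo

variable {α : Type*} [MeasurableSpace α] {ν : Measure α} {E : Type*} [NormedAddCommGroup E]

/-! Angular momentum can be supplied at arbitrarily small cost. A ring of radius of order `n` around
the axis, winding `n` times and rotating with frequency `±1`, carries an angular momentum equal to
`n` times its charge, while its centrifugal term stays comparable to its mass because `n² / r² ≤ 1`
on its support. If its mass is `|M| / n`, its angular momentum is `M` up to the sign of the
frequency, and its charge and energy are `O(1/n)` (`exists_ring`). Placed outside the support of a
compactly supported standing wave, it adds without interaction, and the charge `M / n` is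
compensated by a small change of the frequency of the wave (`exists_mem_chargeMomentumSet`). Hence
prescribing the angular momentum does not raise the infimum at fixed charge.

It remains to approach the energy of any field of charge `h` by standing waves with `ℓ = 0` and an
admissible profile (`exists_isCylTest_staticEnergy_le`). By Cauchy–Schwarz the kinetic term is at
least `h² / (2 ∫ |ψ|²)`, which is the kinetic energy of the standing wave of charge `h` with profile
`|ψ|`; so only the profile matters. The profile is made bounded, smooth, compactly supported and
radial without increasing its Dirichlet integral, with arbitrarily small changes of potential and
mass (`exists_smooth_radial`). Finally it is cut off near the axis, a line in `ℝ³`, which has zero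
capacity for the Dirichlet integral (`exists_isCylTest`). Conversely, each element of `C h` is the
profile of a field of charge `h` with the same energy, so the infima agree.

Weak gradients are handled through mean square increments. The bound `DirichletLE` on all scales
follows from the weak gradient (`IsH1.dirichletLE`), gives back the classical gradient of a `C¹`
function (`DirichletLE.lintegral_grad_le`), and is visibly stable under contractions, averages,
pointwise limits and polarization. Radial symmetry is reached by minimizing the moment of inertia
among equimeasurable Lipschitz competitors: a minimizer is fixed by every polarization that brings
mass towards the origin (`Competitor.exists_radial`).

The strict inequality comes from the centrifugal term: deleting `ℓ² / r²` from the energy of the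
minimizing vortex lowers it, since a profile with nonzero charge is not null and the energy is
finite (`staticEnergy_zero_lt`). -/

theorem lintegral_enorm_sq_eq (f : α → E) :
    ∫⁻ x, ‖f x‖ₑ ^ 2 ∂ν = eLpNorm f 2 ν ^ 2 := by
  have := eLpNorm_nnreal_pow_eq_lintegral (f := f) (μ := ν) (p := 2) two_ne_zero
  simp only [NNReal.coe_ofNat, ENNReal.coe_ofNat, ENNReal.rpow_ofNat] at this
  exact this.symm

theorem ofReal_norm_sq (a : E) : ENNReal.ofReal (‖a‖ ^ 2) = ‖a‖ₑ ^ 2 := by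
  rw [ENNReal.ofReal_pow (norm_nonneg _), ofReal_norm]

theorem ofReal_sq (a : ℝ) : ENNReal.ofReal (a ^ 2) = ‖a‖ₑ ^ 2 := by
  rw [← ofReal_norm_sq, Real.norm_eq_abs, sq_abs]

/-- Jensen's inequality for the square of the norm. -/
theorem enorm_integral_sq_le [NormedSpace ℝ E] [IsProbabilityMeasure ν] {f : α → E}
    (hf : AEStronglyMeasurable f ν) : ‖∫ x, f x ∂ν‖ₑ ^ 2 ≤ ∫⁻ x, ‖f x‖ₑ ^ 2 ∂ν := by
  rw [lintegral_enorm_sq_eq]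
  gcongr
  calc ‖∫ x, f x ∂ν‖ₑ ≤ ∫⁻ x, ‖f x‖ₑ ∂ν := enorm_integral_le_lintegral_enorm _
    _ = eLpNorm f 1 ν := eLpNorm_one_eq_lintegral_enorm.symm
    _ ≤ eLpNorm f 2 ν := eLpNorm_le_eLpNorm_of_exponent_le one_le_two hf

theorem memLp_two_of_lintegral_lt_top {f : α → E} (hf : AEStronglyMeasurable f ν)
    (h : ∫⁻ x, ‖f x‖ₑ ^ 2 ∂ν < ⊤) : MemLp f 2 ν := by
  refine ⟨hf, ?_⟩
  rw [lintegral_enorm_sq_eq] at h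
  by_contra hc
  simp only [not_lt, top_le_iff] at hc
  simp [hc] at h

theorem lintegral_enorm_sq_lt_top {f : α → E} (hf : MemLp f 2 ν) :
    ∫⁻ x, ‖f x‖ₑ ^ 2 ∂ν < ⊤ := by
  rw [lintegral_enorm_sq_eq]
  exact ENNReal.pow_lt_top hf.2

theorem tendsto_eLpNorm_two_iff {ι : Type*} {l : Filter ι} {f : ι → α → E} :
    Tendsto (fun n => eLpNorm (f n) 2 ν) l (𝓝 0) ↔
      Tendsto (fun n => ∫⁻ x, ‖f n x‖ₑ ^ 2 ∂ν) l (𝓝 0) := by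
  simp_rw [lintegral_enorm_sq_eq]
  constructor
  · intro h
    have := ((ENNReal.continuous_pow 2).tendsto 0).comp h
    simpa [Function.comp_def] using this
  · intro h
    have := ((ENNReal.continuous_rpow_const (y := (1 / 2 : ℝ))).tendsto 0).comp h
    have h2 : ∀ a : ℝ≥0∞, (a ^ 2) ^ (1 / 2 : ℝ) = a := by
      intro a
      rw [← ENNReal.rpow_natCast, ← ENNReal.rpow_mul]
      norm_num
    simp only [Function.comp_def, h2] at this
    simpa using this

end LTwo

/-- `L²` convergence implies convergence of the integrals against an `L²` function. -/
theorem tendsto_integral_smul_of_eLpNorm {α : Type*} [MeasurableSpace α] {ν : Measure α}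
    {E : Type*} [NormedAddCommGroup E] [NormedSpace ℝ E] {ψ : α → ℝ} (hψ : MemLp ψ 2 ν)
    {f : ℕ → α → E} {g : α → E} (hf : ∀ n, MemLp (f n) 2 ν) (hg : MemLp g 2 ν)
    (h : Tendsto (fun n => eLpNorm (f n - g) 2 ν) atTop (𝓝 0)) :
    Tendsto (fun n => ∫ x, ψ x • f n x ∂ν) atTop (𝓝 (∫ x, ψ x • g x ∂ν)) := by
  refine tendsto_integral_of_L1' _ (memLp_one_iff_integrable.1 (hg.smul hψ)).aestronglyMeasurable
    (Eventually.of_forall fun n => memLp_one_iff_integrable.1 ((hf n).smul hψ)) ?_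
  have hb : ∀ n, eLpNorm ((fun x => ψ x • f n x) - fun x => ψ x • g x) 1 ν
      ≤ eLpNorm ψ 2 ν * eLpNorm (f n - g) 2 ν := by
    intro n
    have : ((fun x => ψ x • f n x) - fun x => ψ x • g x) = ψ • (f n - g) := by
      ext x; simp [smul_sub]
    rw [this]
    exact eLpNorm_smul_le_mul_eLpNorm ((hf n).sub hg).1 hψ.1
  refine tendsto_of_tendsto_of_tendsto_of_le_of_le tendsto_const_nhds ?_ (fun _ => zero_le) hb
  have := ENNReal.Tendsto.const_mul (a := eLpNorm ψ 2 ν) h (Or.inr hψ.2.ne)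
  simpa using this

/-! ### Weak gradients -/

section WeakGradient

variable {𝕜 : Type*} [RCLike 𝕜]

/-- The standard basis vectors of space. -/
abbrev e (i : Fin 3) : Space := EuclideanSpace.single i (1 : ℝ)

theorem locallyIntegrable_apply {g : Space → EuclideanSpace 𝕜 (Fin 3)}
    (hg : LocallyIntegrable g volume) (i : Fin 3) : LocallyIntegrable (fun x => g x i) volume := by
  intro x
  obtain ⟨U, hU, hi⟩ := hg x
  exact ⟨U, hU, (EuclideanSpace.proj (𝕜 := 𝕜) i).integrable_comp hi⟩

theorem memLp_apply {g : Space → EuclideanSpace 𝕜 (Fin 3)}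
    (hg : MemLp g 2 volume) (i : Fin 3) : MemLp (fun x => g x i) 2 volume :=
  ((EuclideanSpace.proj (𝕜 := 𝕜) i : EuclideanSpace 𝕜 (Fin 3) →L[𝕜] 𝕜)).comp_memLp' hg

/-- Each component is determined by its integrals against test functions. This makes the arbitrary
choice in `weakGrad` harmless. -/
theorem HasWeakGradient.ae_eq {f : Space → 𝕜} {g g' : Space → EuclideanSpace 𝕜 (Fin 3)}
    (h : HasWeakGradient f g) (h' : HasWeakGradient f g') : g =ᵐ[volume] g' := by
  have key : ∀ i : Fin 3, ∀ᵐ x, g x i = g' x i := by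
    intro i
    refine ae_eq_of_integral_contDiff_smul_eq (locallyIntegrable_apply h.2 i)
      (locallyIntegrable_apply h'.2 i) ?_
    intro φ hφ hc
    have h1 := h.3 φ hφ hc i
    have h2 := h'.3 φ hφ hc i
    rw [h1] at h2
    simpa using h2
  filter_upwards [ae_all_iff.2 key] with x hx
  ext i
  exact hx i

theorem HasWeakGradient.weakGrad_ae_eq {f : Space → 𝕜} {g : Space → EuclideanSpace 𝕜 (Fin 3)}
    (h : HasWeakGradient f g) : weakGrad f =ᵐ[volume] g := by
  have hex : ∃ g, HasWeakGradient f g := ⟨g, h⟩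
  rw [weakGrad, dif_pos hex]
  exact hex.choose_spec.ae_eq h

theorem HasWeakGradient.congr {f f' : Space → 𝕜} {g g' : Space → EuclideanSpace 𝕜 (Fin 3)}
    (h : HasWeakGradient f g) (hf : f =ᵐ[volume] f') (hg : g =ᵐ[volume] g') :
    HasWeakGradient f' g' := by
  refine ⟨h.1.congr hf, h.2.congr hg, ?_⟩
  intro φ hφ hc i
  have h1 : ∫ x, (fderiv ℝ φ x (e i)) • f x = ∫ x, (fderiv ℝ φ x (e i)) • f' x := by
    refine integral_congr_ae ?_
    filter_upwards [hf] with x hx; rw [hx]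
  have h2 : ∫ x, φ x • g x i = ∫ x, φ x • g' x i := by
    refine integral_congr_ae ?_
    filter_upwards [hg] with x hx; rw [hx]
  rw [← h1, ← h2]
  exact h.3 φ hφ hc i

theorem HasWeakGradient.weakGrad {f : Space → 𝕜} {g : Space → EuclideanSpace 𝕜 (Fin 3)}
    (h : HasWeakGradient f g) : HasWeakGradient f (weakGrad f) :=
  h.congr (ae_eq_refl _) h.weakGrad_ae_eq.symm

theorem IsH1.hasWeakGradient {f : Space → 𝕜} (h : IsH1 f) : HasWeakGradient f (weakGrad f) := by
  obtain ⟨-, g, hg, -⟩ := h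
  exact hg.weakGrad

theorem IsH1.memLp_weakGrad {f : Space → 𝕜} (h : IsH1 f) : MemLp (weakGrad f) 2 volume := by
  obtain ⟨-, g, hg, hl⟩ := h
  exact hl.ae_eq hg.weakGrad_ae_eq.symm

theorem memLp_fderiv {φ : Space → ℝ} (hφ : ContDiff ℝ ((⊤ : ℕ∞) : WithTop ℕ∞) φ)
    (hc : HasCompactSupport φ) (v : Space) : MemLp (fun x => fderiv ℝ φ x v) 2 volume :=
  ((hφ.continuous_fderiv (by simp)).clm_apply continuous_const).memLp_of_hasCompactSupport
    (hc.fderiv_apply ℝ v)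

theorem integrable_smul_of_locallyIntegrable {E : Type*} [NormedAddCommGroup E] [NormedSpace ℝ E]
    {φ : Space → ℝ} (hφ : Continuous φ) (hc : HasCompactSupport φ) {f : Space → E}
    (hf : LocallyIntegrable f volume) : Integrable (fun x => φ x • f x) volume :=
  hf.integrable_smul_left_of_hasCompactSupport hφ hc

theorem HasWeakGradient.add {f f' : Space → 𝕜} {g g' : Space → EuclideanSpace 𝕜 (Fin 3)}
    (h : HasWeakGradient f g) (h' : HasWeakGradient f' g') :
    HasWeakGradient (f + f') (g + g') := by
  refine ⟨h.1.add h'.1, h.2.add h'.2, ?_⟩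
  intro φ hφ hc i
  have hd : Continuous fun x => fderiv ℝ φ x (e i) :=
    (hφ.continuous_fderiv (by simp)).clm_apply continuous_const
  have hdc : HasCompactSupport fun x => fderiv ℝ φ x (e i) := hc.fderiv_apply ℝ _
  simp only [Pi.add_apply, smul_add, PiLp.add_apply]
  rw [integral_add (integrable_smul_of_locallyIntegrable hd hdc h.1)
    (integrable_smul_of_locallyIntegrable hd hdc h'.1),
    integral_add (integrable_smul_of_locallyIntegrable hφ.continuous hc
      (locallyIntegrable_apply h.2 i))
    (integrable_smul_of_locallyIntegrable hφ.continuous hc (locallyIntegrable_apply h'.2 i)),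
    h.3 φ hφ hc i, h'.3 φ hφ hc i]
  ring

theorem HasWeakGradient.const_mul {f : Space → 𝕜} {g : Space → EuclideanSpace 𝕜 (Fin 3)}
    (h : HasWeakGradient f g) (c : 𝕜) :
    HasWeakGradient (fun x => c * f x) (fun x => c • g x) := by
  refine ⟨h.1.smul c, h.2.smul c, ?_⟩
  intro φ hφ hc i
  have := h.3 φ hφ hc i
  have hs : ∀ (a : ℝ) (b : 𝕜), a • (c * b) = c * (a • b) := fun a b => (mul_smul_comm a c b).symm
  simp only [PiLp.smul_apply, smul_eq_mul, hs]
  rw [integral_const_mul, integral_const_mul, this, mul_neg]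

/-- Weak gradients pass to the limit in `L²`. -/
theorem HasWeakGradient.of_tendsto {f : Space → 𝕜} {g : Space → EuclideanSpace 𝕜 (Fin 3)}
    {fs : ℕ → Space → 𝕜} {gs : ℕ → Space → EuclideanSpace 𝕜 (Fin 3)}
    (h : ∀ n, HasWeakGradient (fs n) (gs n)) (hfs : ∀ n, MemLp (fs n) 2 volume)
    (hgs : ∀ n, MemLp (gs n) 2 volume) (hf : MemLp f 2 volume) (hg : MemLp g 2 volume)
    (hfl : Tendsto (fun n => eLpNorm (fs n - f) 2 volume) atTop (𝓝 0))
    (hgl : Tendsto (fun n => eLpNorm (gs n - g) 2 volume) atTop (𝓝 0)) :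
    HasWeakGradient f g := by
  refine ⟨hf.locallyIntegrable one_le_two, hg.locallyIntegrable one_le_two, ?_⟩
  intro φ hφ hc i
  have h1 := tendsto_integral_smul_of_eLpNorm (memLp_fderiv hφ hc (e i)) hfs hf hfl
  have hgi : Tendsto (fun n => eLpNorm ((fun x => gs n x i) - fun x => g x i) 2 volume)
      atTop (𝓝 0) := by
    refine tendsto_of_tendsto_of_tendsto_of_le_of_le tendsto_const_nhds hgl (fun _ => zero_le) ?_
    intro n
    refine eLpNorm_mono fun x => ?_
    exact PiLp.norm_apply_le (gs n x - g x) i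
  have h2 := tendsto_integral_smul_of_eLpNorm
    (hφ.continuous.memLp_of_hasCompactSupport (μ := volume) hc)
    (fun n => memLp_apply (hgs n) i) (memLp_apply hg i) hgi
  have h3 : (fun n => ∫ x, (fderiv ℝ φ x (e i)) • fs n x)
      = fun n => - ∫ x, φ x • gs n x i := funext fun n => (h n).3 φ hφ hc i
  rw [h3] at h1
  exact tendsto_nhds_unique h1 h2.neg

/-- The classical gradient. -/
def grad (f : Space → 𝕜) (x : Space) : EuclideanSpace 𝕜 (Fin 3) :=
  WithLp.toLp 2 fun i => fderiv ℝ f x (e i)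

theorem continuous_grad {f : Space → 𝕜} (hf : ContDiff ℝ 1 f) : Continuous (grad f) := by
  refine (PiLp.continuous_toLp 2 _).comp (continuous_pi fun i => ?_)
  exact (hf.continuous_fderiv one_ne_zero).clm_apply continuous_const

theorem grad_eq_zero {f : Space → 𝕜} {x : Space} (hx : x ∉ tsupport f) : grad f x = 0 := by
  ext i
  simp [grad, fderiv_of_notMem_tsupport (𝕜 := ℝ) hx]

theorem hasCompactSupport_grad {f : Space → 𝕜} (hc : HasCompactSupport f) :
    HasCompactSupport (grad f) :=
  HasCompactSupport.intro hc fun _ hx => grad_eq_zero hx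

theorem hasWeakGradient_grad {f : Space → 𝕜} (hf : ContDiff ℝ 1 f) :
    HasWeakGradient f (grad f) := by
  refine ⟨hf.continuous.locallyIntegrable, (continuous_grad hf).locallyIntegrable, ?_⟩
  intro φ hφ hφc i
  have hd : Continuous fun x => fderiv ℝ φ x (e i) :=
    (hφ.continuous_fderiv (by simp)).clm_apply continuous_const
  have hdc : HasCompactSupport fun x => fderiv ℝ φ x (e i) := hφc.fderiv_apply ℝ _
  have hd' : Continuous fun x => fderiv ℝ f x (e i) :=
    (hf.continuous_fderiv one_ne_zero).clm_apply continuous_const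
  have := integral_smul_fderiv_eq_neg_fderiv_smul_of_integrable (μ := (volume : Measure Space))
    (f := φ) (g := f) (v := e i)
    (integrable_smul_of_locallyIntegrable hd hdc hf.continuous.locallyIntegrable)
    (integrable_smul_of_locallyIntegrable hφ.continuous hφc hd'.locallyIntegrable)
    (integrable_smul_of_locallyIntegrable hφ.continuous hφc hf.continuous.locallyIntegrable)
    (fun x _ => (hφ.differentiable (by simp)).differentiableAt)
    (fun x _ => (hf.differentiable one_ne_zero).differentiableAt)
  simp only [grad]
  rw [this, neg_neg]

theorem isH1_of_contDiff {f : Space → 𝕜} (hf : ContDiff ℝ 1 f) (hc : HasCompactSupport f) :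
    IsH1 f :=
  ⟨hf.continuous.memLp_of_hasCompactSupport hc, grad f, hasWeakGradient_grad hf,
    (continuous_grad hf).memLp_of_hasCompactSupport (hasCompactSupport_grad hc)⟩

end WeakGradient

/-! ### A radial probability measure -/

/-- A radial, radially nonincreasing bump supported in the unit ball. -/
def bump (z : Space) : ℝ := Real.smoothTransition (1 - ‖z‖ ^ 2)

theorem contDiff_bump : ContDiff ℝ ((⊤ : ℕ∞) : WithTop ℕ∞) bump :=
  Real.smoothTransition.contDiff.comp (contDiff_const.sub (contDiff_norm_sq ℝ))

theorem bump_nonneg (z : Space) : 0 ≤ bump z := Real.smoothTransition.nonneg _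

theorem bump_anti {z w : Space} (h : ‖z‖ ≤ ‖w‖) : bump w ≤ bump z :=
  Real.smoothTransition.monotone (by gcongr)

theorem bump_eq_zero {z : Space} (hz : 1 ≤ ‖z‖) : bump z = 0 :=
  Real.smoothTransition.zero_of_nonpos (by nlinarith)

theorem hasCompactSupport_bump : HasCompactSupport bump := by
  refine HasCompactSupport.intro (isCompact_closedBall (0 : Space) 1) fun z hz => bump_eq_zero ?_
  simp only [Metric.mem_closedBall, dist_zero_right, not_le] at hz
  exact hz.le

theorem integral_bump_pos : 0 < ∫ z, bump z := by
  refine contDiff_bump.continuous.integral_pos_of_hasCompactSupport_nonneg_nonzero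
    hasCompactSupport_bump bump_nonneg (x := 0) ?_
  simp [bump]

/-- The normalised bump. -/
def mol (z : Space) : ℝ := (∫ w, bump w)⁻¹ * bump z

theorem contDiff_mol : ContDiff ℝ ((⊤ : ℕ∞) : WithTop ℕ∞) mol := contDiff_const.mul contDiff_bump

theorem mol_nonneg (z : Space) : 0 ≤ mol z :=
  mul_nonneg (inv_nonneg.2 integral_bump_pos.le) (bump_nonneg z)

theorem mol_anti {z w : Space} (h : ‖z‖ ≤ ‖w‖) : mol w ≤ mol z :=
  mul_le_mul_of_nonneg_left (bump_anti h) (inv_nonneg.2 integral_bump_pos.le)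

theorem mol_congr {z w : Space} (h : ‖z‖ = ‖w‖) : mol z = mol w :=
  le_antisymm (mol_anti h.ge) (mol_anti h.le)

theorem mol_eq_zero {z : Space} (hz : 1 ≤ ‖z‖) : mol z = 0 := by simp [mol, bump_eq_zero hz]

theorem hasCompactSupport_mol : HasCompactSupport mol := hasCompactSupport_bump.mul_left

theorem measurable_mol : Measurable mol := contDiff_mol.continuous.measurable

theorem integral_mol : ∫ z, mol z = 1 := by
  simp only [mol]
  rw [integral_const_mul, inv_mul_cancel₀ integral_bump_pos.ne']

/-- The probability measure with density `mol`. -/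
def molMeasure : Measure Space := volume.withDensity fun z => ENNReal.ofReal (mol z)

instance : IsProbabilityMeasure molMeasure := by
  refine ⟨?_⟩
  rw [molMeasure, withDensity_apply _ MeasurableSet.univ, Measure.restrict_univ, ← ofReal_integral_eq_lintegral_ofReal
    (contDiff_mol.continuous.integrable_of_hasCompactSupport hasCompactSupport_mol)
    (Eventually.of_forall mol_nonneg), integral_mol, ENNReal.ofReal_one]

theorem lintegral_molMeasure (f : Space → ℝ≥0∞) :
    ∫⁻ z, f z ∂molMeasure = ∫⁻ z, ENNReal.ofReal (mol z) * f z :=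
  lintegral_withDensity_eq_lintegral_mul_non_measurable _ measurable_mol.ennreal_ofReal
    (Eventually.of_forall fun _ => ENNReal.ofReal_lt_top) f

theorem integral_molMeasure (f : Space → ℝ) :
    ∫ z, f z ∂molMeasure = ∫ z, mol z * f z := by
  rw [molMeasure, integral_withDensity_eq_integral_toReal_smul measurable_mol.ennreal_ofReal
    (Eventually.of_forall fun _ => ENNReal.ofReal_lt_top)]
  simp only [ENNReal.toReal_ofReal (mol_nonneg _), smul_eq_mul]

/-- The density depends on the norm alone and Lebesgue measure is invariant under linear isometries.
-/
theorem measurePreserving_molMeasure (O : Space ≃ₗᵢ[ℝ] Space) :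
    MeasurePreserving O molMeasure molMeasure := by
  refine ⟨O.continuous.measurable, ?_⟩
  ext s hs
  rw [Measure.map_apply O.continuous.measurable hs, molMeasure,
    withDensity_apply _ (O.continuous.measurable hs), withDensity_apply _ hs,
    ← O.measurePreserving.setLIntegral_comp_preimage hs measurable_mol.ennreal_ofReal]
  refine lintegral_congr fun z => ?_
  rw [mol_congr (z := O z) (w := z) (O.norm_map z)]

theorem exists_isometry_apply_eq {a b : Space} (h : ‖a‖ = ‖b‖) :
    ∃ O : Space ≃ₗᵢ[ℝ] Space, O a = b :=
  ⟨_, Submodule.reflection_sub h⟩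

/-- The second moment of `molMeasure` in a coordinate direction. -/
def molVar : ℝ≥0∞ := ∫⁻ z, ‖z 0‖ₑ ^ 2 ∂molMeasure

theorem molVar_ne_top : molVar ≠ ⊤ := by
  rw [molVar, lintegral_molMeasure]
  refine ne_of_lt (lt_of_le_of_lt (lintegral_mono (g := fun z => ENNReal.ofReal (mol z)) ?_) ?_)
  · intro z
    by_cases hz : 1 ≤ ‖z‖
    · simp [mol_eq_zero hz]
    · have : ‖z 0‖ₑ ≤ 1 := by
        rw [← ofReal_norm]
        refine ENNReal.ofReal_le_one.2 ((PiLp.norm_apply_le z 0).trans (not_le.1 hz).le)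
      calc ENNReal.ofReal (mol z) * ‖z 0‖ₑ ^ 2 ≤ ENNReal.ofReal (mol z) * 1 := by
            gcongr; exact pow_le_one' this 2
        _ = _ := mul_one _
  · have := measure_lt_top molMeasure Set.univ
    rwa [molMeasure, withDensity_apply _ MeasurableSet.univ, Measure.restrict_univ] at this

/-- Needed, together with finiteness, to cancel `molVar` when passing from increments back to
gradients. If the second moment vanished, its continuous integrand would be zero everywhere, which
fails at half a unit vector. -/
theorem molVar_ne_zero : molVar ≠ 0 := by
  intro h0
  rw [molVar, lintegral_molMeasure, lintegral_eq_zero_iff (by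
    have := measurable_mol; fun_prop)] at h0
  have hc : (fun z : Space => mol z * (z 0) ^ 2) =ᵐ[volume] 0 := by
    filter_upwards [h0] with z hz
    simp only [Pi.zero_apply, mul_eq_zero, ENNReal.ofReal_eq_zero, pow_eq_zero_iff two_ne_zero,
      enorm_eq_zero] at hz
    rcases hz with hz | hz
    · simp [le_antisymm hz (mol_nonneg z)]
    · simp [hz]
  have hcont : Continuous fun z : Space => mol z * (z 0) ^ 2 := by
    have := contDiff_mol.continuous; fun_prop
  have := (hcont.ae_eq_iff_eq volume continuous_const (g := fun _ => (0 : ℝ))).1 hc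
  have h1 := congrFun this ((1 / 2 : ℝ) • e 0)
  have h2 : 0 < mol ((1 / 2 : ℝ) • e 0) := by
    refine mul_pos (inv_pos.2 integral_bump_pos) (Real.smoothTransition.pos_of_pos ?_)
    rw [norm_smul, PiLp.norm_single]
    norm_num
  rcases mul_eq_zero.1 h1 with h1 | h1
  · exact h2.ne' h1
  · norm_num at h1

/-- An isometry carries `‖g‖ • e 0` to `g` and preserves the measure, so only the length of `g`
matters. Averaging squared directional derivatives over directions thus recovers the squared
gradient. -/
theorem lintegral_inner_sq (g : Space) :
    ∫⁻ z, ‖inner ℝ g z‖ₑ ^ 2 ∂molMeasure = molVar * ‖g‖ₑ ^ 2 := by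
  obtain ⟨O, hO⟩ := exists_isometry_apply_eq (a := ‖g‖ • e 0) (b := g)
    (by rw [norm_smul, PiLp.norm_single]; simp)
  have h1 : ∀ z, ‖inner ℝ g (O z)‖ₑ ^ 2 = ‖z 0‖ₑ ^ 2 * ‖g‖ₑ ^ 2 := by
    intro z
    have : inner ℝ g (O z) = ‖g‖ * z 0 := by
      conv_lhs => rw [← hO]
      rw [O.inner_map_map, inner_smul_left, EuclideanSpace.inner_single_left]
      simp
    rw [this, enorm_mul, mul_pow, enorm_norm, mul_comm]
  rw [← (measurePreserving_molMeasure O).lintegral_comp (by fun_prop)]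
  simp_rw [h1]
  rw [lintegral_mul_const _ (by fun_prop), molVar]

/-! ### The nonlocal Dirichlet form -/

section Nonlocal

variable {E : Type*} [NormedAddCommGroup E]

/-- The mean square of the increments of `f` at scale `δ`. -/
def incr (f : Space → E) (δ : ℝ) : ℝ≥0∞ :=
  ∫⁻ z, (∫⁻ x, ‖f (x + δ • z) - f x‖ₑ ^ 2) ∂molMeasure

/-- The nonlocal form of the inequality `∫ |∇f|² ≤ D`. -/
def DirichletLE (f : Space → E) (D : ℝ≥0∞) : Prop :=
  ∀ δ : ℝ, 0 < δ → incr f δ ≤ ENNReal.ofReal (δ ^ 2) * (molVar * D)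

/-- Contractions shrink every increment. For modulus, truncation and threshold this takes the place
of a chain rule for weak derivatives. -/
theorem DirichletLE.comp {E' : Type*} [NormedAddCommGroup E'] {f : Space → E} {D : ℝ≥0∞}
    (h : DirichletLE f D) {T : E → E'} (hT : ∀ a b, ‖T a - T b‖ ≤ ‖a - b‖) :
    DirichletLE (fun x => T (f x)) D := by
  intro δ hδ
  refine le_trans (lintegral_mono fun z => lintegral_mono fun x => ?_) (h δ hδ)
  dsimp only
  gcongr 1
  exact enorm_le_iff_norm_le.2 (hT _ _)

theorem incr_congr_ae {f f' : Space → E} (h : f =ᵐ[volume] f') (δ : ℝ) :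
    incr f δ = incr f' δ := by
  refine lintegral_congr fun z => lintegral_congr_ae ?_
  have := (measurePreserving_add_right (volume : Measure Space) (δ • z)).quasiMeasurePreserving.ae_eq
    h
  filter_upwards [h, this] with x h1 h2
  simp only [Function.comp_apply] at h2
  rw [h1, h2]

theorem DirichletLE.congr_ae {f f' : Space → E} {D : ℝ≥0∞} (hf : DirichletLE f D)
    (h : f =ᵐ[volume] f') : DirichletLE f' D := fun δ hδ => incr_congr_ae h δ ▸ hf δ hδ

end Nonlocal

/-- Fatou's lemma for double integrals. -/
theorem lintegral_lintegral_le_of_tendsto {G : ℕ → Space → Space → ℝ≥0∞}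
    (hm : ∀ n, Measurable (Function.uncurry (G n))) {g : Space → Space → ℝ≥0∞}
    (h : ∀ z x, Tendsto (fun n => G n z x) atTop (𝓝 (g z x))) {C : ℝ≥0∞}
    (hC : ∀ n, ∫⁻ z, (∫⁻ x, G n z x) ∂molMeasure ≤ C) :
    ∫⁻ z, (∫⁻ x, g z x) ∂molMeasure ≤ C := by
  calc ∫⁻ z, (∫⁻ x, g z x) ∂molMeasure
      ≤ ∫⁻ z, liminf (fun n => ∫⁻ x, G n z x) atTop ∂molMeasure := by
        refine lintegral_mono fun z => ?_
        have : ∀ x, g z x = liminf (fun n => G n z x) atTop := fun x => (h z x).liminf_eq.symm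
        dsimp only
        rw [lintegral_congr this]
        exact lintegral_liminf_le fun n => (hm n).comp measurable_prodMk_left
    _ ≤ liminf (fun n => ∫⁻ z, (∫⁻ x, G n z x) ∂molMeasure) atTop :=
        lintegral_liminf_le fun n => (hm n).lintegral_prod_right'
    _ ≤ C := by
        refine liminf_le_of_le (by isBoundedDefault) fun b hb => ?_
        obtain ⟨n, hn⟩ := hb.exists
        exact hn.trans (hC n)

section Nonlocal

variable {E : Type*} [NormedAddCommGroup E]

/-- Fatou at each fixed scale: lower semicontinuity with no convergence of gradients required. -/
theorem DirichletLE.of_tendsto {f : ℕ → Space → E} {g : Space → E} {D : ℝ≥0∞}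
    (hf : ∀ n, DirichletLE (f n) D) (hm : ∀ n, StronglyMeasurable (f n))
    (h : ∀ x, Tendsto (fun n => f n x) atTop (𝓝 (g x))) : DirichletLE g D := by
  intro δ hδ
  refine lintegral_lintegral_le_of_tendsto (G := fun n z x => ‖f n (x + δ • z) - f n x‖ₑ ^ 2)
    (fun n => ?_) (fun z x => ?_) fun n => hf n δ hδ
  · have h1 : StronglyMeasurable fun p : Space × Space => f n (p.2 + δ • p.1) :=
      (hm n).comp_measurable (by fun_prop)
    have h2 : StronglyMeasurable fun p : Space × Space => f n p.2 :=
      (hm n).comp_measurable (by fun_prop)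
    exact (h1.sub h2).enorm.pow_const 2
  · exact ((ENNReal.continuous_pow 2).tendsto _).comp ((h _).sub (h _)).enorm

end Nonlocal

/-- The average of `f` at scale `δ`. -/
def mollify (δ : ℝ) (f : Space → ℝ) (x : Space) : ℝ := ∫ z, f (x + δ • z) ∂molMeasure

/-! ### Averaging over small balls -/

section Mollify

variable {f : Space → ℝ}

theorem integrable_mollify_integrand (hf : Measurable f) {k : ℝ} (hk : ∀ x, ‖f x‖ ≤ k) (δ : ℝ)
    (x : Space) : Integrable (fun z => f (x + δ • z)) molMeasure :=
  Integrable.of_bound (hf.comp (by fun_prop)).aestronglyMeasurable k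
    (Eventually.of_forall fun _ => hk _)

theorem mollify_mem_Icc (hf : Measurable f) {k : ℝ} (hk : ∀ x, f x ∈ Set.Icc 0 k) (δ : ℝ)
    (x : Space) : mollify δ f x ∈ Set.Icc 0 k := by
  refine ⟨integral_nonneg fun z => (hk _).1, ?_⟩
  have := integral_mono (integrable_mollify_integrand hf (k := k)
    (fun x => by rw [Real.norm_of_nonneg (hk x).1]; exact (hk x).2) δ x)
    (integrable_const k) (fun z => (hk _).2)
  simpa [mollify] using this

/-- The error at `x` is the average of the increments from `x`, so Jensen and Tonelli apply. Under
`DirichletLE` with a finite bound the error is `O(δ²)`. -/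
theorem lintegral_mollify_sub_le (hf : Measurable f) {k : ℝ} (hk : ∀ x, ‖f x‖ ≤ k) (δ : ℝ) :
    ∫⁻ x, ‖mollify δ f x - f x‖ₑ ^ 2 ≤ incr f δ := by
  have h1 : ∀ x, ‖mollify δ f x - f x‖ₑ ^ 2 ≤ ∫⁻ z, ‖f (x + δ • z) - f x‖ₑ ^ 2 ∂molMeasure := by
    intro x
    have : mollify δ f x - f x = ∫ z, (f (x + δ • z) - f x) ∂molMeasure := by
      rw [integral_sub (integrable_mollify_integrand hf hk δ x) (integrable_const _)]
      simp [mollify]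
    rw [this]
    refine enorm_integral_sq_le ?_
    exact ((hf.comp (by fun_prop)).sub_const _).aestronglyMeasurable
  refine (lintegral_mono h1).trans ?_
  rw [incr, lintegral_lintegral_swap]
  refine Measurable.aemeasurable ?_
  have := hf
  unfold Function.uncurry
  fun_prop

/-- An increment of the average is an average of translated increments; Jensen bounds its square,
and translations do not change the integral over space. -/
theorem DirichletLE.mollify {D : ℝ≥0∞} (h : DirichletLE f D) (hf : Measurable f) {k : ℝ}
    (hk : ∀ x, ‖f x‖ ≤ k) (ε : ℝ) : DirichletLE (mollify ε f) D := by
  intro δ hδ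
  refine le_trans (lintegral_mono fun z => ?_) (h δ hδ)
  dsimp only
  have h1 : ∀ x, ‖KleinGordon.mollify ε f (x + δ • z) - KleinGordon.mollify ε f x‖ₑ ^ 2 ≤
      ∫⁻ w, ‖f (x + δ • z + ε • w) - f (x + ε • w)‖ₑ ^ 2 ∂molMeasure := by
    intro x
    rw [KleinGordon.mollify, KleinGordon.mollify,
      ← integral_sub (integrable_mollify_integrand hf hk _ _)
      (integrable_mollify_integrand hf hk _ _)]
    refine enorm_integral_sq_le (Measurable.aestronglyMeasurable ?_)
    fun_prop
  refine (lintegral_mono h1).trans ?_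
  rw [lintegral_lintegral_swap (by
    refine Measurable.aemeasurable ?_
    unfold Function.uncurry
    fun_prop)]
  have h2 : ∀ w, ∫⁻ x, ‖f (x + δ • z + ε • w) - f (x + ε • w)‖ₑ ^ 2
      = ∫⁻ x, ‖f (x + δ • z) - f x‖ₑ ^ 2 := by
    intro w
    rw [← lintegral_add_right_eq_self (fun x => ‖f (x + δ • z) - f x‖ₑ ^ 2) (ε • w)]
    refine lintegral_congr fun x => ?_
    rw [add_right_comm]
  simp_rw [h2]
  simp

theorem mollify_comp_isometry (O : Space ≃ₗᵢ[ℝ] Space) (h : ∀ x, f (O x) = f x) (δ : ℝ)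
    (x : Space) : mollify δ f (O x) = mollify δ f x := by
  rw [mollify, mollify, ← (measurePreserving_molMeasure O).integral_comp
    O.toHomeomorph.measurableEmbedding]
  refine integral_congr_ae (Eventually.of_forall fun z => ?_)
  dsimp only
  rw [← h (x + δ • z), map_add, map_smul]

theorem mollify_eq_zero {R δ : ℝ} (hδ : 0 ≤ δ) (h : ∀ x, R ≤ ‖x‖ → f x = 0) {x : Space}
    (hx : R + δ ≤ ‖x‖) : mollify δ f x = 0 := by
  rw [mollify, integral_molMeasure]
  refine integral_eq_zero_of_ae (Eventually.of_forall fun z => ?_)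
  by_cases hz : 1 ≤ ‖z‖
  · simp [mol_eq_zero hz]
  · dsimp only
    rw [h, mul_zero, Pi.zero_apply]
    have h1 : ‖x‖ ≤ ‖x + δ • z‖ + ‖δ • z‖ := by
      simpa using norm_sub_le (x + δ • z) (δ • z)
    have h2 : ‖δ • z‖ ≤ δ := by
      rw [norm_smul, Real.norm_of_nonneg hδ]
      exact mul_le_of_le_one_right hδ (not_le.1 hz).le
    linarith

/-- The kernel of `mollify`. -/
def molKernel (δ : ℝ) (w : Space) : ℝ := (δ ^ 3)⁻¹ * mol (δ⁻¹ • w)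

theorem contDiff_molKernel (δ : ℝ) : ContDiff ℝ ((⊤ : ℕ∞) : WithTop ℕ∞) (molKernel δ) :=
  contDiff_const.mul (contDiff_mol.comp (contDiff_const_smul _))

theorem hasCompactSupport_molKernel {δ : ℝ} (hδ : 0 < δ) : HasCompactSupport (molKernel δ) :=
  HasCompactSupport.mul_left (hasCompactSupport_mol.comp_smul (inv_ne_zero hδ.ne'))

theorem mollify_eq_convolution {δ : ℝ} (hδ : 0 < δ) (f : Space → ℝ) :
    mollify δ f = convolution f (molKernel δ) (ContinuousLinearMap.lsmul ℝ ℝ) volume := by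
  ext x
  rw [mollify, integral_molMeasure, convolution]
  have h1 := Measure.integral_comp_smul (volume : Measure Space)
    (fun w => mol (δ⁻¹ • w) * f (x + w)) δ
  simp only [smul_smul, inv_mul_cancel₀ hδ.ne', one_smul] at h1
  rw [h1, ← integral_add_left_eq_self (μ := (volume : Measure Space))
    (fun t => (ContinuousLinearMap.lsmul ℝ ℝ) (f t) (molKernel δ (x - t))) x, smul_eq_mul,
    ← integral_const_mul]
  refine integral_congr_ae (Eventually.of_forall fun w => ?_)
  -- The average samples `f` at `x + δ z`, a convolution at `x - t`; the two agree because the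
  -- kernel is even.
  have hm : mol (δ⁻¹ • -w) = mol (δ⁻¹ • w) := mol_congr (by rw [smul_neg, norm_neg])
  simp only [ContinuousLinearMap.lsmul_apply, molKernel, sub_add_cancel_left, smul_eq_mul, hm,
    finrank_euclideanSpace, Fintype.card_fin]
  rw [abs_of_pos (by positivity)]
  ring

theorem contDiff_mollify {δ : ℝ} (hδ : 0 < δ) (hf : LocallyIntegrable f volume) :
    ContDiff ℝ ((⊤ : ℕ∞) : WithTop ℕ∞) (mollify δ f) := by
  rw [mollify_eq_convolution hδ]
  exact (hasCompactSupport_molKernel hδ).contDiff_convolution_right _ hf (contDiff_molKernel δ)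

/-- The derivative falls on the kernel, which gives the constant `k ∫ ‖∇ molKernel‖`. A uniform
Lipschitz constant supplies the equicontinuity behind the compactness of competitors. -/
theorem exists_lipschitzWith_mollify {δ : ℝ} (hδ : 0 < δ) (hf : LocallyIntegrable f volume)
    {k : ℝ} (hk : ∀ x, ‖f x‖ ≤ k) : ∃ L, LipschitzWith L (mollify δ f) := by
  have hd : Continuous (fderiv ℝ (molKernel δ)) := (contDiff_molKernel δ).continuous_fderiv (by simp)
  have hdc := (hasCompactSupport_molKernel hδ).fderiv (𝕜 := ℝ)
  have hdi : Integrable (fderiv ℝ (molKernel δ)) volume := hd.integrable_of_hasCompactSupport hdc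
  have hbound : ∀ x, ‖fderiv ℝ (mollify δ f) x‖ ≤ k * ∫ y, ‖fderiv ℝ (molKernel δ) y‖ := by
    intro x
    have h1 := ((hasCompactSupport_molKernel hδ).hasFDerivAt_convolution_right
      (ContinuousLinearMap.lsmul ℝ ℝ) hf ((contDiff_molKernel δ).of_le (by simp)) x).fderiv
    rw [mollify_eq_convolution hδ, h1, convolution]
    rw [← integral_const_mul, ← integral_sub_left_eq_self
      (fun y => k * ‖fderiv ℝ (molKernel δ) y‖) volume x]
    refine norm_integral_le_of_norm_le ((hdi.norm.comp_sub_left x).const_mul k)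
      (Eventually.of_forall fun t => ?_)
    refine ContinuousLinearMap.opNorm_le_bound _
      (mul_nonneg ((norm_nonneg _).trans (hk 0)) (norm_nonneg _)) fun v => ?_
    change ‖f t • fderiv ℝ (molKernel δ) (x - t) v‖ ≤ _
    rw [norm_smul, mul_assoc]
    exact mul_le_mul (hk t) (ContinuousLinearMap.le_opNorm _ _) (norm_nonneg _)
      ((norm_nonneg _).trans (hk 0))
  have hk0 : 0 ≤ k := (norm_nonneg _).trans (hk 0)
  refine ⟨⟨k * ∫ y, ‖fderiv ℝ (molKernel δ) y‖,
    mul_nonneg hk0 (integral_nonneg fun _ => norm_nonneg _)⟩, ?_⟩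
  exact lipschitzWith_of_nnnorm_fderiv_le
    ((contDiff_mollify hδ hf).differentiable (by simp)) fun x => hbound x

/-- The density is largest at the origin, and rescaling the variable costs `δ⁻³`. -/
theorem lintegral_molMeasure_comp_le {G : Space → ℝ≥0∞} (hG : Measurable G) {δ : ℝ} (hδ : 0 < δ)
    (x : Space) : ∫⁻ z, G (x + δ • z) ∂molMeasure ≤
      ENNReal.ofReal (mol 0) * (ENNReal.ofReal (δ ^ 3)⁻¹ * ∫⁻ y, G y) := by
  rw [lintegral_molMeasure]
  calc ∫⁻ z, ENNReal.ofReal (mol z) * G (x + δ • z)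
      ≤ ∫⁻ z, ENNReal.ofReal (mol 0) * G (x + δ • z) := by
        refine lintegral_mono fun z => ?_
        dsimp only
        gcongr
        exact mol_anti (by simp)
    _ = ENNReal.ofReal (mol 0) * ∫⁻ w, G (x + w) ∂(Measure.map (δ • ·) volume) := by
        rw [lintegral_const_mul' _ _ ENNReal.ofReal_ne_top, lintegral_map (by fun_prop) (by fun_prop)]
    _ = _ := by
        rw [Measure.map_addHaar_smul _ hδ.ne', lintegral_smul_measure, lintegral_add_left_eq_self,
          finrank_euclideanSpace, Fintype.card_fin, abs_of_pos (by positivity), smul_eq_mul]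

/-- Averages of `L²` functions vanish at infinity. -/
theorem exists_mollify_lt {δ : ℝ} (hδ : 0 < δ) (hf : Measurable f) (hL : MemLp f 2 volume)
    {τ : ℝ} (hτ : 0 < τ) : ∃ R, ∀ x, R ≤ ‖x‖ → |mollify δ f x| < τ := by
  set C : ℝ≥0∞ := ENNReal.ofReal (mol 0) * ENNReal.ofReal (δ ^ 3)⁻¹ with hC
  have hCt : C ≠ ⊤ := ENNReal.mul_ne_top ENNReal.ofReal_ne_top ENNReal.ofReal_ne_top
  obtain ⟨ε, hε, hε2⟩ : ∃ ε : ℝ≥0∞, ε ≠ 0 ∧ C * ε ^ 2 < ENNReal.ofReal (τ ^ 2) := by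
    have h1 : Tendsto (fun ε : ℝ≥0∞ => C * ε ^ 2) (𝓝[>] 0) (𝓝 (C * 0 ^ 2)) :=
      (ENNReal.Tendsto.const_mul ((ENNReal.continuous_pow 2).tendsto 0) (Or.inr hCt)).mono_left
        nhdsWithin_le_nhds
    have h2 : C * 0 ^ 2 < ENNReal.ofReal (τ ^ 2) := by
      simpa using pow_pos hτ 2
    obtain ⟨ε, h3, h4⟩ := ((h1.eventually_lt_const h2).and self_mem_nhdsWithin).exists
    exact ⟨ε, (ne_of_gt h4), h3⟩
  -- Far from the support of `g` the average of `f` is that of `f - g`, and its square is at most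
  -- `C` times the squared `L²` norm of `f - g`.
  obtain ⟨g, hgc, hgε, hg, -⟩ := hL.exists_hasCompactSupport_eLpNorm_sub_le ENNReal.ofNat_ne_top hε
  obtain ⟨R, hR⟩ := hgc.isCompact.isBounded.subset_closedBall (0 : Space)
  refine ⟨R + δ + 1, fun x hx => ?_⟩
  have hz : ∀ z, ‖z‖ < 1 → g (x + δ • z) = 0 := by
    intro z hz1
    refine image_eq_zero_of_notMem_tsupport fun hmem => ?_
    have h1 := hR hmem
    rw [mem_closedBall_zero_iff] at h1
    have h2 : ‖x‖ ≤ ‖x + δ • z‖ + ‖δ • z‖ := by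
      simpa using norm_sub_le (x + δ • z) (δ • z)
    have h3 : ‖δ • z‖ ≤ δ := by
      rw [norm_smul, Real.norm_of_nonneg hδ.le]
      exact mul_le_of_le_one_right hδ.le hz1.le
    linarith
  have h1 : ‖mollify δ f x‖ₑ ^ 2 ≤ C * ε ^ 2 := by
    calc ‖mollify δ f x‖ₑ ^ 2 ≤ ∫⁻ z, ‖f (x + δ • z)‖ₑ ^ 2 ∂molMeasure :=
          enorm_integral_sq_le (hf.comp (by fun_prop)).aestronglyMeasurable
      _ = ∫⁻ z, ‖(f - g) (x + δ • z)‖ₑ ^ 2 ∂molMeasure := by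
          rw [lintegral_molMeasure, lintegral_molMeasure]
          refine lintegral_congr fun z => ?_
          by_cases hz1 : ‖z‖ < 1
          · simp [hz z hz1]
          · simp [mol_eq_zero (not_lt.1 hz1)]
      _ ≤ C * ∫⁻ y, ‖(f - g) y‖ₑ ^ 2 := by
          rw [hC, mul_assoc]
          have := hg.measurable
          exact lintegral_molMeasure_comp_le (G := fun y => ‖(f - g) y‖ₑ ^ 2)
            ((hf.sub this).enorm.pow_const 2) hδ x
      _ ≤ C * ε ^ 2 := by
          rw [lintegral_enorm_sq_eq]
          gcongr
  have h2 := h1.trans_lt hε2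
  rw [← ofReal_sq, ENNReal.ofReal_lt_ofReal_iff (by positivity)] at h2
  exact abs_lt_of_sq_lt_sq h2 hτ.le

end Mollify

/-- For `C¹` functions the nonlocal form of the inequality implies the local one. -/
theorem DirichletLE.lintegral_grad_le {f : Space → ℝ} {D : ℝ≥0∞} (h : DirichletLE f D)
    (hf : ContDiff ℝ 1 f) : ∫⁻ x, ‖grad f x‖ₑ ^ 2 ≤ D := by
  -- Difference quotients at scale `1 / (n + 1)` converge to directional derivatives. Fatou carries
  -- the bound to the limit, and averaging over directions turns it into a bound for the gradient
  -- times `molVar`.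
  have hlim : ∀ z x : Space, Tendsto
      (fun n : ℕ => ENNReal.ofReal (((n : ℝ) + 1) ^ 2) * ‖f (x + ((n : ℝ) + 1)⁻¹ • z) - f x‖ₑ ^ 2)
      atTop (𝓝 (‖inner ℝ (grad f x) z‖ₑ ^ 2)) := by
    intro z x
    have h1 : HasLineDerivAt ℝ f (fderiv ℝ f x z) x z :=
      ((hf.differentiable one_ne_zero) x).hasFDerivAt.hasLineDerivAt z
    have h2 := h1.tendsto_slope_zero_right
    have h3 : Tendsto (fun n : ℕ => ((n : ℝ) + 1)⁻¹) atTop (𝓝[>] 0) := by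
      refine tendsto_nhdsWithin_iff.2 ⟨?_, Eventually.of_forall fun n => ?_⟩
      · simpa using tendsto_one_div_add_atTop_nhds_zero_nat (𝕜 := ℝ)
      · simp only [Set.mem_Ioi]; positivity
    have h4 := (((ENNReal.continuous_pow 2).tendsto _).comp ((h2.comp h3).enorm))
    have h5 : fderiv ℝ f x z = inner ℝ (grad f x) z := by
      have hz : z = ∑ i, z i • e i := by
        ext j
        simp [Finset.sum_apply, Pi.single_apply]
      conv_lhs => rw [hz]
      simp [map_sum, PiLp.inner_apply, grad]
    rw [h5] at h4
    refine h4.congr fun n => ?_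
    simp only [Function.comp_apply, inv_inv, smul_eq_mul, enorm_mul, mul_pow]
    rw [ofReal_sq]
  have key : ∫⁻ z, (∫⁻ x, ‖inner ℝ (grad f x) z‖ₑ ^ 2) ∂molMeasure ≤ molVar * D := by
    refine lintegral_lintegral_le_of_tendsto (fun n => ?_) hlim fun n => ?_
    · have := hf.continuous.measurable
      unfold Function.uncurry
      fun_prop
    · have hn0 : (0 : ℝ) < ((n : ℝ) + 1)⁻¹ := by positivity
      simp_rw [lintegral_const_mul' _ _ ENNReal.ofReal_ne_top]
      refine (mul_le_mul_right (h _ hn0) _).trans_eq ?_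
      rw [← mul_assoc, ← ENNReal.ofReal_mul (by positivity), ← mul_pow,
        mul_inv_cancel₀ (by positivity)]
      simp
  rw [lintegral_lintegral_swap (by
    have := (continuous_grad hf).measurable
    refine Measurable.aemeasurable ?_
    unfold Function.uncurry
    fun_prop)] at key
  simp_rw [lintegral_inner_sq] at key
  rw [lintegral_const_mul' _ _ molVar_ne_top] at key
  exact (ENNReal.mul_le_mul_iff_right molVar_ne_zero molVar_ne_top).1 key

/-! ### Increments of weakly differentiable functions -/

section Increments

variable {𝕜 : Type*} [RCLike 𝕜]

/-- The component of a vector field in the direction `z`. -/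
def dirComp (g : Space → EuclideanSpace 𝕜 (Fin 3)) (z x : Space) : 𝕜 := ∑ i, z i • g x i

theorem sum_smul_e (z : Space) : ∑ i, z i • e i = z := by
  ext j
  simp [Finset.sum_apply, Pi.single_apply]

theorem integral_fderiv_smul_eq {f : Space → 𝕜} {g : Space → EuclideanSpace 𝕜 (Fin 3)}
    (h : HasWeakGradient f g) {φ : Space → ℝ} (hφ : ContDiff ℝ ((⊤ : ℕ∞) : WithTop ℕ∞) φ)
    (hc : HasCompactSupport φ) (z : Space) :
    ∫ x, (fderiv ℝ φ x z) • f x = - ∫ x, φ x • dirComp g z x := by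
  have h1 : ∀ x, (fderiv ℝ φ x z) • f x = ∑ i, z i • ((fderiv ℝ φ x (e i)) • f x) := by
    intro x
    conv_lhs => rw [← sum_smul_e z]
    simp [map_sum, Finset.sum_smul, mul_smul]
  have h2 : ∀ x, φ x • dirComp g z x = ∑ i, z i • (φ x • g x i) := by
    intro x
    rw [dirComp, Finset.smul_sum]
    exact Finset.sum_congr rfl fun i _ => smul_comm _ _ _
  simp_rw [h1, h2]
  rw [integral_finsetSum, integral_finsetSum, ← Finset.sum_neg_distrib]
  · refine Finset.sum_congr rfl fun i _ => ?_
    rw [integral_smul, integral_smul, h.3 φ hφ hc i, smul_neg]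
  · intro i _
    exact (integrable_smul_of_locallyIntegrable hφ.continuous hc
      (locallyIntegrable_apply h.2 i)).smul (z i)
  · intro i _
    exact (integrable_smul_of_locallyIntegrable
      ((hφ.continuous_fderiv (by simp)).clm_apply continuous_const) (hc.fderiv_apply ℝ _) h.1).smul (z i)

/-- The unit interval with Lebesgue measure. -/
abbrev unitMeasure : Measure ℝ := volume.restrict (Set.Ioc 0 1)

instance : IsProbabilityMeasure unitMeasure := ⟨by simp⟩

theorem lintegral_lintegral_segment {G : Space → 𝕜} (hG : StronglyMeasurable G) (z : Space) :
    ∫⁻ x, (∫⁻ s, ‖G (x + s • z)‖ₑ ^ 2 ∂unitMeasure) = ∫⁻ x, ‖G x‖ₑ ^ 2 := by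
  rw [lintegral_lintegral_swap]
  · have : ∀ s : ℝ, ∫⁻ x, ‖G (x + s • z)‖ₑ ^ 2 = ∫⁻ x, ‖G x‖ₑ ^ 2 := fun s =>
      lintegral_add_right_eq_self (fun x => ‖G x‖ₑ ^ 2) (s • z)
    simp [this]
  · have h2 : StronglyMeasurable fun p : Space × ℝ => G (p.1 + p.2 • z) :=
      hG.comp_measurable (by fun_prop)
    exact (h2.enorm.pow_const 2).aemeasurable

theorem memLp_average {G : Space → 𝕜} (hG : StronglyMeasurable G) (hG2 : MemLp G 2 volume)
    (z : Space) : MemLp (fun x => ∫ s, G (x + s • z) ∂unitMeasure) 2 volume := by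
  have hm : StronglyMeasurable fun p : Space × ℝ => G (p.1 + p.2 • z) :=
    hG.comp_measurable (by fun_prop)
  refine memLp_two_of_lintegral_lt_top hm.integral_prod_right'.aestronglyMeasurable ?_
  refine lt_of_le_of_lt (lintegral_mono fun x => enorm_integral_sq_le ?_)
    ((lintegral_lintegral_segment hG z).trans_lt (lintegral_enorm_sq_lt_top hG2))
  exact (hG.comp_measurable (by fun_prop)).aestronglyMeasurable

/-- The fundamental theorem of calculus along segments, for weakly differentiable functions. -/
theorem ae_sub_eq_integral {f : Space → 𝕜} {g : Space → EuclideanSpace 𝕜 (Fin 3)}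
    (h : HasWeakGradient f g) (hf : StronglyMeasurable f) (hf2 : MemLp f 2 volume)
    (z : Space) (hG : StronglyMeasurable (dirComp g z)) (hG2 : MemLp (dirComp g z) 2 volume) :
    ∀ᵐ x, f (x + z) - f x = ∫ s, dirComp g z (x + s • z) ∂unitMeasure := by
  set G := dirComp g z with hGdef
  have hfz : MemLp (fun x => f (x + z)) 2 volume :=
    hf2.comp_measurePreserving (measurePreserving_add_right volume z)
  refine ae_eq_of_integral_contDiff_smul_eq ((hfz.sub hf2).locallyIntegrable one_le_two)
    ((memLp_average hG hG2 z).locallyIntegrable one_le_two) fun φ hφ hc => ?_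
  have hφ2 : MemLp φ 2 volume := hφ.continuous.memLp_of_hasCompactSupport hc
  have hd : Continuous fun x => fderiv ℝ φ x z :=
    (hφ.continuous_fderiv (by simp)).clm_apply continuous_const
  -- the right-hand side
  have hint1 : Integrable (fun p : Space × ℝ => φ p.1 • G (p.1 + p.2 • z))
      (volume.prod unitMeasure) := by
    have hm : StronglyMeasurable fun p : Space × ℝ => φ p.1 • G (p.1 + p.2 • z) :=
      (hφ.continuous.comp continuous_fst).stronglyMeasurable.smul
        (hG.comp_measurable (by fun_prop))
    rw [integrable_prod_iff' hm.aestronglyMeasurable]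
    have hGs : ∀ s : ℝ, MemLp (fun x => G (x + s • z)) 2 volume := fun s =>
      hG2.comp_measurePreserving (measurePreserving_add_right volume (s • z))
    refine ⟨Eventually.of_forall fun s => memLp_one_iff_integrable.1 ((hGs s).smul hφ2), ?_⟩
    refine Integrable.of_bound hm.norm.integral_prod_left'.aestronglyMeasurable
      ((eLpNorm φ 2 volume * eLpNorm G 2 volume).toReal) (Eventually.of_forall fun s => ?_)
    rw [Real.norm_of_nonneg (integral_nonneg fun _ => norm_nonneg _)]
    change ∫ x, ‖(φ • fun x => G (x + s • z)) x‖ ≤ _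
    rw [integral_norm_eq_lintegral_enorm ((memLp_one_iff_integrable.1
        ((hGs s).smul hφ2)).aestronglyMeasurable), ← eLpNorm_one_eq_lintegral_enorm]
    refine ENNReal.toReal_mono (ENNReal.mul_ne_top hφ2.2.ne hG2.2.ne) ?_
    have h1 := eLpNorm_smul_le_mul_eLpNorm (p := 2) (q := 2) (r := 1) (hGs s).1 hφ2.1
    have h2 : eLpNorm (fun x => G (x + s • z)) 2 volume = eLpNorm G 2 volume :=
      eLpNorm_comp_measurePreserving hG2.1 (measurePreserving_add_right volume (s • z))
    rw [h2] at h1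
    exact h1
  -- The shift along the segment is moved onto the test function, where the weak gradient can be
  -- used at each `s`.
  have hR : ∫ x, φ x • ∫ s, G (x + s • z) ∂unitMeasure
      = ∫ s, (∫ x, φ (x - s • z) • G x) ∂unitMeasure := by
    simp_rw [← integral_smul]
    rw [integral_integral_swap hint1]
    refine integral_congr_ae (Eventually.of_forall fun s => ?_)
    dsimp only
    rw [← integral_add_right_eq_self (μ := (volume : Measure Space))
      (fun x => φ (x - s • z) • G x) (s • z)]
    simp
  have hs : ∀ s : ℝ, ∫ x, φ (x - s • z) • G x = - ∫ x, (fderiv ℝ φ (x - s • z) z) • f x := by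
    intro s
    have h1 := integral_fderiv_smul_eq h (φ := fun x => φ (x - s • z))
      (hφ.comp (contDiff_id.sub contDiff_const))
      (hc.comp_homeomorph (Homeomorph.subRight (s • z))) z
    have h2 : ∀ x, fderiv ℝ (fun x => φ (x - s • z)) x = fderiv ℝ φ (x - s • z) := by
      intro x
      exact fderiv_comp_sub (𝕜 := ℝ) (f := φ) (s • z)
    simp only [h2] at h1
    rw [h1, neg_neg]
  -- the left-hand side
  obtain ⟨C, hC⟩ := hd.bounded_above_of_compact_support (hc.fderiv_apply ℝ z)
  obtain ⟨R, hR0⟩ := hc.isCompact.isBounded.subset_closedBall (0 : Space)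
  -- This ball contains the supports of all translates of `φ` by `s z` with `0 < s ≤ 1`, so `f`
  -- restricted to it dominates the integrand uniformly in `s`.
  set K : Set Space := Metric.closedBall 0 (R + ‖z‖) with hK
  have hint2 : Integrable (fun p : Space × ℝ => (fderiv ℝ φ (p.1 - p.2 • z) z) • f p.1)
      (volume.prod unitMeasure) := by
    have hb : Integrable (fun p : Space × ℝ => (C * ‖K.indicator f p.1‖) * (1 : ℝ))
        (volume.prod unitMeasure) := by
      refine Integrable.mul_prod (f := fun x => C * ‖K.indicator f x‖) (g := fun _ : ℝ => (1 : ℝ))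
        ?_ (integrable_const _)
      have : Integrable (K.indicator f) volume :=
        (integrable_indicator_iff Metric.isClosed_closedBall.measurableSet).2
          (h.1.integrableOn_isCompact (isCompact_closedBall _ _))
      exact this.norm.const_mul C
    refine hb.mono' ?_ ?_
    · have h1 : StronglyMeasurable fun p : Space × ℝ => fderiv ℝ φ (p.1 - p.2 • z) z :=
        (hd.comp (by fun_prop : Continuous fun p : Space × ℝ => p.1 - p.2 • z)).stronglyMeasurable
      exact (h1.smul (hf.comp_measurable measurable_fst)).aestronglyMeasurable
    · have hs01 : ∀ᵐ p : Space × ℝ ∂(volume.prod unitMeasure), p.2 ∈ Set.Ioc (0 : ℝ) 1 := by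
        have : ∀ᵐ s ∂unitMeasure, s ∈ Set.Ioc (0 : ℝ) 1 := ae_restrict_mem measurableSet_Ioc
        exact Measure.quasiMeasurePreserving_snd.ae this
      filter_upwards [hs01] with p hp
      rw [norm_smul, mul_one]
      by_cases hpK : p.1 ∈ K
      · rw [Set.indicator_of_mem hpK]
        gcongr
        exact hC _
      · have : fderiv ℝ φ (p.1 - p.2 • z) z = 0 := by
          have hnm : p.1 - p.2 • z ∉ tsupport φ := by
            intro hmem
            apply hpK
            have h1 := hR0 hmem
            rw [mem_closedBall_zero_iff] at h1 ⊢
            have h2 : ‖p.1‖ ≤ ‖p.1 - p.2 • z‖ + ‖p.2 • z‖ := by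
              simpa using norm_add_le (p.1 - p.2 • z) (p.2 • z)
            have h3 : ‖p.2 • z‖ ≤ ‖z‖ := by
              rw [norm_smul, Real.norm_of_nonneg hp.1.le]
              exact mul_le_of_le_one_left (norm_nonneg _) hp.2
            linarith
          rw [fderiv_of_notMem_tsupport (𝕜 := ℝ) hnm]
          simp
        rw [this, Set.indicator_of_notMem hpK]
        simp
  -- After Fubini, this is the classical fundamental theorem of calculus for `s ↦ -φ (x - s z)`.
  have hL : ∫ s, (∫ x, (fderiv ℝ φ (x - s • z) z) • f x) ∂unitMeasure
      = ∫ x, (φ x - φ (x - z)) • f x := by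
    rw [← integral_integral_swap hint2]
    refine integral_congr_ae (Eventually.of_forall fun x => ?_)
    dsimp only
    rw [integral_smul_const]
    congr 1
    have hder : ∀ s ∈ Set.uIcc (0 : ℝ) 1, HasDerivAt (fun s : ℝ => - φ (x - s • z))
        (fderiv ℝ φ (x - s • z) z) s := by
      intro s _
      have h1 : HasDerivAt (fun s : ℝ => x - s • z) (-z) s := by
        simpa using ((hasDerivAt_id s).smul_const z).const_sub x
      have h2 := ((hφ.differentiable (by simp)) (x - s • z)).hasFDerivAt.comp_hasDerivAt s h1
      have h3 := h2.neg
      rw [map_neg, neg_neg] at h3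
      exact h3
    have h3 := intervalIntegral.integral_eq_sub_of_hasDerivAt hder
      (hd.comp (by fun_prop : Continuous fun s : ℝ => x - s • z)).continuousOn.intervalIntegrable
    rw [intervalIntegral.integral_of_le zero_le_one] at h3
    rw [h3]
    simp
    ring
  rw [hR]
  simp_rw [hs]
  rw [integral_neg, hL]
  have hi1 : Integrable (fun x => φ x • f (x + z)) volume :=
    memLp_one_iff_integrable.1 (hfz.smul hφ2)
  have hi2 : Integrable (fun x => φ x • f x) volume :=
    memLp_one_iff_integrable.1 (hf2.smul hφ2)
  have hi3 : Integrable (fun x => φ (x - z) • f x) volume := by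
    simpa using hi1.comp_sub_right z
  simp only [smul_sub, sub_smul]
  rw [integral_sub hi1 hi2, integral_sub hi2 hi3, neg_sub]
  congr 1
  rw [← integral_sub_right_eq_self (μ := (volume : Measure Space)) (fun x => φ x • f (x + z)) z]
  simp

/-- The direction `z` is real, so real and imaginary parts separate and `lintegral_inner_sq` applies
to each. -/
theorem lintegral_dirComp_sq (g : EuclideanSpace 𝕜 (Fin 3)) :
    ∫⁻ z : Space, ‖∑ i, z i • g i‖ₑ ^ 2 ∂molMeasure = molVar * ‖g‖ₑ ^ 2 := by
  set a : Space := WithLp.toLp 2 fun i => RCLike.re (g i) with ha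
  set b : Space := WithLp.toLp 2 fun i => RCLike.im (g i) with hb
  have h1 : ∀ z : Space, ‖∑ i, z i • g i‖ₑ ^ 2 = ‖inner ℝ a z‖ₑ ^ 2 + ‖inner ℝ b z‖ₑ ^ 2 := by
    intro z
    rw [← ofReal_norm_sq, ← ofReal_norm_sq, ← ofReal_norm_sq, ← ENNReal.ofReal_add (by positivity)
      (by positivity), ← RCLike.normSq_eq_def', RCLike.normSq_apply]
    congr 1
    simp only [map_sum, RCLike.smul_re, RCLike.smul_im, PiLp.inner_apply, ha, hb,
      RCLike.inner_apply, conj_trivial, Real.norm_eq_abs, sq_abs]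
    ring
  have h2 : ‖g‖ₑ ^ 2 = ‖a‖ₑ ^ 2 + ‖b‖ₑ ^ 2 := by
    rw [← ofReal_norm_sq, ← ofReal_norm_sq, ← ofReal_norm_sq, ← ENNReal.ofReal_add (by positivity)
      (by positivity)]
    congr 1
    rw [EuclideanSpace.norm_sq_eq, EuclideanSpace.norm_sq_eq, EuclideanSpace.norm_sq_eq,
      ← Finset.sum_add_distrib]
    refine Finset.sum_congr rfl fun i _ => ?_
    rw [← RCLike.normSq_eq_def', RCLike.normSq_apply]
    simp [ha, hb, sq]
  simp_rw [h1]
  rw [lintegral_add_left (by fun_prop), lintegral_inner_sq, lintegral_inner_sq, h2, mul_add]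

/-- `H¹` functions satisfy the nonlocal inequality with their Dirichlet integral. -/
theorem IsH1.dirichletLE {f : Space → 𝕜} (h : IsH1 f) :
    DirichletLE f (∫⁻ x, ‖weakGrad f x‖ₑ ^ 2) := by
  -- Strongly measurable representatives make the double integrals over points and directions or
  -- segments jointly measurable.
  obtain ⟨f', hf'm, hff'⟩ := h.1.1
  have hgl := h.memLp_weakGrad
  obtain ⟨g', hg'm, hgg'⟩ := hgl.1
  have hw : HasWeakGradient f' g' := h.hasWeakGradient.congr hff' hgg'
  have hf'2 : MemLp f' 2 volume := h.1.ae_eq hff'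
  have hg'2 : MemLp g' 2 volume := hgl.ae_eq hgg'
  have hD : ∫⁻ x, ‖weakGrad f x‖ₑ ^ 2 = ∫⁻ x, ‖g' x‖ₑ ^ 2 := by
    refine lintegral_congr_ae ?_
    filter_upwards [hgg'] with x hx
    rw [hx]
  rw [hD]
  refine DirichletLE.congr_ae ?_ hff'.symm
  have hcomp : ∀ i, StronglyMeasurable fun x => g' x i := fun i =>
    (PiLp.continuous_apply 2 (fun _ : Fin 3 => 𝕜) i).comp_stronglyMeasurable hg'm
  intro δ hδ
  have h1 : ∀ z : Space, ∫⁻ x, ‖f' (x + δ • z) - f' x‖ₑ ^ 2 ≤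
      ∫⁻ x, ENNReal.ofReal (δ ^ 2) * ‖∑ i, z i • g' x i‖ₑ ^ 2 := by
    intro z
    have hGm : StronglyMeasurable (dirComp g' (δ • z)) := by
      unfold dirComp
      exact Finset.stronglyMeasurable_fun_sum _ fun i _ => (hcomp i).const_smul _
    have hG2 : MemLp (dirComp g' (δ • z)) 2 volume := by
      unfold dirComp
      exact memLp_finsetSum _ fun i _ => (memLp_apply hg'2 i).const_smul ((δ • z) i)
    have h2 := ae_sub_eq_integral hw hf'm hf'2 (δ • z) hGm hG2
    calc ∫⁻ x, ‖f' (x + δ • z) - f' x‖ₑ ^ 2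
        = ∫⁻ x, ‖∫ s, dirComp g' (δ • z) (x + s • δ • z) ∂unitMeasure‖ₑ ^ 2 := by
          refine lintegral_congr_ae ?_
          filter_upwards [h2] with x hx
          rw [hx]
      _ ≤ ∫⁻ x, (∫⁻ s, ‖dirComp g' (δ • z) (x + s • δ • z)‖ₑ ^ 2 ∂unitMeasure) :=
          lintegral_mono fun x => enorm_integral_sq_le
            (hGm.comp_measurable (by fun_prop)).aestronglyMeasurable
      _ = ∫⁻ x, ‖dirComp g' (δ • z) x‖ₑ ^ 2 := lintegral_lintegral_segment hGm _
      _ = ∫⁻ x, ENNReal.ofReal (δ ^ 2) * ‖∑ i, z i • g' x i‖ₑ ^ 2 := by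
          refine lintegral_congr fun x => ?_
          have : dirComp g' (δ • z) x = δ • ∑ i, z i • g' x i := by
            simp [dirComp, Finset.smul_sum, mul_smul]
          rw [this, enorm_smul, mul_pow, ofReal_sq]
  refine (lintegral_mono h1).trans ?_
  simp_rw [lintegral_const_mul' _ _ ENNReal.ofReal_ne_top]
  rw [lintegral_lintegral_swap]
  · simp_rw [lintegral_dirComp_sq]
    rw [lintegral_const_mul' _ _ molVar_ne_top]
  · refine Measurable.aemeasurable ?_
    refine Measurable.pow_const (Measurable.enorm ?_) 2
    refine Finset.measurable_fun_sum _ fun i _ => ?_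
    have h3 : StronglyMeasurable fun p : Space × Space => g' p.2 i :=
      (hcomp i).comp_measurable measurable_snd
    exact ((by fun_prop : Measurable fun p : Space × Space => p.1 i).stronglyMeasurable.smul
      h3).measurable

end Increments

/-! ### Polarization -/

/-- An affine reflection in a plane that does not contain the origin, described by the properties
that are used in the theory of polarization. -/
structure Folding (σ : Space → Space) : Prop where
  invol : ∀ y, σ (σ y) = y
  norm_sub : ∀ y z, ‖σ y - σ z‖ = ‖y - z‖
  measurePreserving : MeasurePreserving σ volume volume
  strict : ∀ y, ‖σ y‖ = ‖y‖ → σ y = y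
  same_side : ∀ y z, ‖y‖ ≤ ‖σ y‖ → ‖z‖ ≤ ‖σ z‖ → ‖y - z‖ ≤ ‖y - σ z‖

/-- The reflection in the perpendicular bisector of the segment from `a` to `b`. As `a` is strictly
closer to the origin, the plane misses the origin, which lies on the side of `a`. -/
theorem exists_folding {a b : Space} (hab : ‖a‖ < ‖b‖) : ∃ σ, Folding σ ∧ σ a = b := by
  set n : Space := b - a with hn
  set p : Space := (2⁻¹ : ℝ) • (a + b) with hp
  have hn0 : n ≠ 0 := fun h => by
    rw [hn, sub_eq_zero] at h
    rw [h] at hab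
    exact lt_irrefl _ hab
  have hnn : 0 < ‖n‖ ^ 2 := by positivity
  have hpn : 0 < inner ℝ p n := by
    have h1 : inner ℝ p n = 2⁻¹ * (‖b‖ ^ 2 - ‖a‖ ^ 2) := by
      simp only [hp, hn, inner_smul_left, inner_add_left, inner_sub_right,
        real_inner_self_eq_norm_sq, real_inner_comm a b]
      simp
      ring
    rw [h1]
    have : ‖a‖ ^ 2 < ‖b‖ ^ 2 := by gcongr
    linarith
  -- The signed distance to the plane in units of `‖n‖`. Since `‖σ y‖² - ‖y‖² = -4 c(y) ⟨p, n⟩` with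
  -- `⟨p, n⟩ > 0`, its sign decides which of `y` and `σ y` is nearer the origin.
  set c : Space → ℝ := fun y => inner ℝ (y - p) n / ‖n‖ ^ 2 with hc
  have hcn : ∀ y, inner ℝ (y - p) n = c y * ‖n‖ ^ 2 := fun y => by
    simp only [hc]; field_simp
  have hcn' : ∀ y, inner ℝ y n = c y * ‖n‖ ^ 2 + inner ℝ p n := fun y => by
    rw [← hcn, inner_sub_left]; ring
  set R := (Submodule.reflection (ℝ ∙ n)ᗮ) with hR
  set σ : Space → Space := fun y => R (y - p) + p with hσ
  have hσy : ∀ y, σ y = y - (2 * c y) • n := by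
    intro y
    have h1 : R (y - p) = (y - p) - (2 * c y) • n := by
      rw [hR, Submodule.reflection_orthogonal_apply, Submodule.reflection_singleton_apply]
      simp only [hc, real_inner_comm n, neg_sub, two_smul ℕ, mul_smul, two_smul ℝ]
      rfl
    simp only [hσ, h1]
    abel
  have hcσ : ∀ y, c (σ y) = - c y := by
    intro y
    have h1 : inner ℝ (σ y - p) n = -(c y * ‖n‖ ^ 2) := by
      rw [hσy, sub_right_comm, inner_sub_left, hcn, inner_smul_left, real_inner_self_eq_norm_sq]
      simp; ring
    simp only [hc] at h1 ⊢
    rw [h1]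
    field_simp
  have hnorm : ∀ y, ‖σ y‖ ^ 2 - ‖y‖ ^ 2 = - 4 * c y * inner ℝ p n := by
    intro y
    rw [hσy, norm_sub_sq_real, inner_smul_right, hcn', norm_smul, mul_pow, Real.norm_eq_abs, sq_abs]
    ring
  have hside : ∀ y, ‖y‖ ≤ ‖σ y‖ ↔ c y ≤ 0 := by
    intro y
    rw [← sq_le_sq₀ (norm_nonneg _) (norm_nonneg _), ← sub_nonneg, hnorm]
    constructor
    · intro h; by_contra hcon
      have := mul_pos (not_le.1 hcon) hpn
      linarith
    · intro h
      have := mul_nonneg (neg_nonneg.2 h) hpn.le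
      linarith
  refine ⟨σ, ⟨?_, ?_, ?_, ?_, ?_⟩, ?_⟩
  · intro y; simp [hσ, hR]
  · intro y z
    have : σ y - σ z = R (y - z) := by
      simp only [hσ, add_sub_add_right_eq_sub, ← map_sub, sub_sub_sub_cancel_right]
    rw [this, LinearIsometryEquiv.norm_map]
  · exact (measurePreserving_add_right volume p).comp
      (R.measurePreserving.comp (measurePreserving_sub_right volume p))
  · intro y hy
    have h1 := hnorm y
    rw [hy, sub_self] at h1
    have h2 : c y = 0 := by
      rcases mul_eq_zero.1 h1.symm with h | h
      · linarith
      · exact absurd h hpn.ne'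
    rw [hσy, h2]; simp
  · intro y z hy hz
    rw [hside] at hy hz
    rw [← sq_le_sq₀ (norm_nonneg _) (norm_nonneg _), hσy z]
    have h1 : y - (z - (2 * c z) • n) = (y - z) + (2 * c z) • n := by abel
    rw [h1, norm_add_sq_real, inner_smul_right, norm_smul, mul_pow, Real.norm_eq_abs, sq_abs,
      inner_sub_left, hcn', hcn' z]
    have := mul_nonneg (mul_nonneg_of_nonpos_of_nonpos hy hz) hnn.le
    nlinarith
  · rw [hσy]
    have h1 : c a = -2⁻¹ := by
      have h2 : a - p = (-2⁻¹ : ℝ) • n := by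
        simp only [hp, hn, smul_sub, smul_add]
        module
      simp only [hc]
      rw [h2, inner_smul_left, real_inner_self_eq_norm_sq]
      field_simp
      simp
    rw [h1, hn]
    module

/-- The polarization of `v` with respect to `σ`. -/
def pol (σ : Space → Space) (v : Space → ℝ) (y : Space) : ℝ :=
  if ‖y‖ ≤ ‖σ y‖ then max (v y) (v (σ y)) else min (v y) (v (σ y))

/-- The right side exceeds the left by `2 (k₁ - k₂) (a - b) (c - d)`. -/
theorem sq_sub_swap_le {a b c d k₁ k₂ : ℝ} (hk : k₂ ≤ k₁) (hk' : 0 ≤ (a - b) * (c - d)) :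
    k₁ * ((a - c) ^ 2 + (b - d) ^ 2) + k₂ * ((a - d) ^ 2 + (b - c) ^ 2) ≤
      k₁ * ((a - d) ^ 2 + (b - c) ^ 2) + k₂ * ((a - c) ^ 2 + (b - d) ^ 2) := by
  nlinarith [mul_nonneg (sub_nonneg.2 hk) hk']

/-- If the two pairs have the same order, sorting them changes nothing but the order of the
summands; otherwise it makes exactly the exchange in `sq_sub_swap_le`. -/
theorem sq_sub_max_min_le {a b c d k₁ k₂ : ℝ} (hk : k₂ ≤ k₁) :
    k₁ * ((max a b - max c d) ^ 2 + (min a b - min c d) ^ 2) +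
        k₂ * ((max a b - min c d) ^ 2 + (min a b - max c d) ^ 2) ≤
      k₁ * ((a - c) ^ 2 + (b - d) ^ 2) + k₂ * ((a - d) ^ 2 + (b - c) ^ 2) := by
  rcases le_total a b with h | h <;> rcases le_total c d with h' | h' <;>
    simp only [h, h', max_eq_left, max_eq_right, min_eq_left, min_eq_right]
  · linarith
  · have := sq_sub_swap_le (a := b) (b := a) (c := c) (d := d) hk
      (mul_nonneg (sub_nonneg.2 h) (sub_nonneg.2 h'))
    linarith
  · have := sq_sub_swap_le (a := a) (b := b) (c := d) (d := c) hk
      (mul_nonneg (sub_nonneg.2 h) (sub_nonneg.2 h'))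
    linarith
  · linarith

theorem abs_max_sub_min_le {a b c d M : ℝ} (h1 : |a - c| ≤ M) (h2 : |b - d| ≤ M)
    (h3 : |a - d| ≤ M) (h4 : |b - c| ≤ M) : |max a b - min c d| ≤ M := by
  rcases max_choice a b with h | h <;> rcases min_choice c d with h' | h' <;> rw [h, h'] <;>
    assumption

namespace Folding

variable {σ : Space → Space} {v : Space → ℝ}

theorem continuous (hσ : Folding σ) : Continuous σ :=
  (LipschitzWith.of_dist_le_mul (K := 1) fun y z => by
    rw [dist_eq_norm, dist_eq_norm, hσ.norm_sub]; simp).continuous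

theorem measurableEmbedding (hσ : Folding σ) : MeasurableEmbedding σ :=
  (Homeomorph.mk ⟨σ, σ, hσ.invol, hσ.invol⟩ hσ.continuous hσ.continuous).measurableEmbedding

theorem norm_sub' (hσ : Folding σ) (y z : Space) : ‖σ y - z‖ = ‖y - σ z‖ := by
  rw [← hσ.norm_sub y, hσ.invol]

theorem other_side (hσ : Folding σ) {y z : Space} (hy : ‖σ y‖ ≤ ‖y‖) (hz : ‖σ z‖ ≤ ‖z‖) :
    ‖y - z‖ ≤ ‖y - σ z‖ := by
  have := hσ.same_side (σ y) (σ z) (by rwa [hσ.invol]) (by rwa [hσ.invol])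
  rwa [hσ.norm_sub, hσ.invol, hσ.norm_sub'] at this

theorem opposite_sides (hσ : Folding σ) {y z : Space} (hy : ‖y‖ ≤ ‖σ y‖) (hz : ‖σ z‖ ≤ ‖z‖) :
    ‖y - σ z‖ ≤ ‖y - z‖ := by
  have := hσ.same_side y (σ z) hy (by rwa [hσ.invol])
  rwa [hσ.invol] at this

theorem opposite_sides' (hσ : Folding σ) {y z : Space} (hy : ‖σ y‖ ≤ ‖y‖) (hz : ‖z‖ ≤ ‖σ z‖) :
    ‖y - σ z‖ ≤ ‖y - z‖ := by
  have := hσ.opposite_sides hz hy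
  rwa [norm_sub_rev, hσ.norm_sub', norm_sub_rev z y] at this

theorem pol_pos (v : Space → ℝ) {y : Space} (hy : ‖y‖ ≤ ‖σ y‖) :
    pol σ v y = max (v y) (v (σ y)) := if_pos hy

theorem pol_apply_pos (hσ : Folding σ) (v : Space → ℝ) {y : Space} (hy : ‖y‖ ≤ ‖σ y‖) :
    pol σ v (σ y) = min (v y) (v (σ y)) := by
  rw [pol, hσ.invol]
  split_ifs with h
  · rw [hσ.strict y (le_antisymm h hy)]; simp
  · exact min_comm _ _

theorem pol_neg (hσ : Folding σ) (v : Space → ℝ) {y : Space} (hy : ‖σ y‖ ≤ ‖y‖) :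
    pol σ v y = min (v y) (v (σ y)) := by
  have := hσ.pol_apply_pos v (y := σ y) (by rwa [hσ.invol])
  rwa [hσ.invol, min_comm] at this

theorem pol_apply_neg (hσ : Folding σ) (v : Space → ℝ) {y : Space} (hy : ‖σ y‖ ≤ ‖y‖) :
    pol σ v (σ y) = max (v y) (v (σ y)) := by
  rw [pol_pos v (y := σ y) (by rwa [hσ.invol]), hσ.invol, max_comm]

theorem pol_mem (v : Space → ℝ) (y : Space) : pol σ v y = v y ∨ pol σ v y = v (σ y) := by
  rw [pol]
  split_ifs
  · exact max_choice _ _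
  · exact min_choice _ _

/-- On each orbit of `σ` polarization only permutes the two values. This is the source of
equimeasurability. -/
theorem comp_pol_add (hσ : Folding σ) (v : Space → ℝ) (G : ℝ → ℝ) (y : Space) :
    G (pol σ v y) + G (pol σ v (σ y)) = G (v y) + G (v (σ y)) := by
  rcases le_total ‖y‖ ‖σ y‖ with h | h
  · rw [pol_pos v h, hσ.pol_apply_pos v h]
    rcases le_total (v y) (v (σ y)) with h' | h' <;> simp [h', add_comm]
  · rw [hσ.pol_neg v h, hσ.pol_apply_neg v h]
    rcases le_total (v y) (v (σ y)) with h' | h' <;> simp [h', add_comm]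

/-- On one side, max and min are contractions for the sup norm. Across the plane all four
differences of values may occur, but `y` is at least as close to `σ z` as to `z`, so each of them is
bounded by `L ‖y - z‖`. -/
theorem lipschitzWith_pol (hσ : Folding σ) {L : NNReal} (hv : LipschitzWith L v) :
    LipschitzWith L (pol σ v) := by
  have hL : ∀ y z, |v y - v z| ≤ L * ‖y - z‖ := fun y z => by
    simpa [Real.dist_eq, dist_eq_norm] using hv.dist_le_mul y z
  have h2 : ∀ y z, |v (σ y) - v (σ z)| ≤ L * ‖y - z‖ := fun y z => by
    simpa [hσ.norm_sub] using hL (σ y) (σ z)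
  have h3 : ∀ y z, |v y - v (σ z)| ≤ L * ‖y - σ z‖ := fun y z => hL _ _
  have h4 : ∀ y z, |v (σ y) - v z| ≤ L * ‖y - σ z‖ := fun y z => by
    simpa [hσ.norm_sub'] using hL (σ y) z
  refine LipschitzWith.of_dist_le_mul fun y z => ?_
  rw [Real.dist_eq, dist_eq_norm]
  rcases le_total ‖y‖ ‖σ y‖ with hy | hy <;> rcases le_total ‖z‖ ‖σ z‖ with hz | hz
  · rw [pol_pos v hy, pol_pos v hz]
    exact (abs_max_sub_max_le_max _ _ _ _).trans (max_le (hL y z) (h2 y z))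
  · rw [pol_pos v hy, hσ.pol_neg v hz]
    have h5 : L * ‖y - σ z‖ ≤ L * ‖y - z‖ :=
      mul_le_mul_of_nonneg_left (hσ.opposite_sides hy hz) L.2
    exact abs_max_sub_min_le (hL y z) (h2 y z) ((h3 y z).trans h5) ((h4 y z).trans h5)
  · rw [hσ.pol_neg v hy, pol_pos v hz, abs_sub_comm]
    have h5 : L * ‖y - σ z‖ ≤ L * ‖y - z‖ :=
      mul_le_mul_of_nonneg_left (hσ.opposite_sides' hy hz) L.2
    refine abs_max_sub_min_le ?_ ?_ ?_ ?_ <;> rw [abs_sub_comm]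
    exacts [hL y z, h2 y z, (h4 y z).trans h5, (h3 y z).trans h5]
  · rw [hσ.pol_neg v hy, hσ.pol_neg v hz]
    exact (abs_min_sub_min_le_max _ _ _ _).trans (max_le (hL y z) (h2 y z))

/-- The two-point inequality behind polarization. -/
theorem two_point (hσ : Folding σ) (v : Space → ℝ) {k : Space → ℝ}
    (hk : ∀ a b : Space, ‖a‖ ≤ ‖b‖ → k b ≤ k a) (y z : Space) :
    k (y - z) * ((pol σ v y - pol σ v z) ^ 2 + (pol σ v (σ y) - pol σ v (σ z)) ^ 2) +
        k (y - σ z) * ((pol σ v y - pol σ v (σ z)) ^ 2 + (pol σ v (σ y) - pol σ v z) ^ 2) ≤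
      k (y - z) * ((v y - v z) ^ 2 + (v (σ y) - v (σ z)) ^ 2) +
        k (y - σ z) * ((v y - v (σ z)) ^ 2 + (v (σ y) - v z) ^ 2) := by
  rcases le_total ‖y‖ ‖σ y‖ with hy | hy <;> rcases le_total ‖z‖ ‖σ z‖ with hz | hz
  · rw [pol_pos v hy, pol_pos v hz, hσ.pol_apply_pos v hy, hσ.pol_apply_pos v hz]
    exact sq_sub_max_min_le (hk _ _ (hσ.same_side y z hy hz))
  · rw [pol_pos v hy, hσ.pol_neg v hz, hσ.pol_apply_pos v hy, hσ.pol_apply_neg v hz]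
    have := sq_sub_max_min_le (a := v y) (b := v (σ y)) (c := v (σ z)) (d := v z)
      (hk _ _ (hσ.opposite_sides hy hz))
    rw [max_comm (v (σ z)), min_comm (v (σ z))] at this
    linarith
  · rw [hσ.pol_neg v hy, pol_pos v hz, hσ.pol_apply_neg v hy, hσ.pol_apply_pos v hz]
    have := sq_sub_max_min_le (a := v y) (b := v (σ y)) (c := v (σ z)) (d := v z)
      (hk _ _ (hσ.opposite_sides' hy hz))
    rw [max_comm (v (σ z)), min_comm (v (σ z))] at this
    linarith
  · rw [hσ.pol_neg v hy, hσ.pol_neg v hz, hσ.pol_apply_neg v hy, hσ.pol_apply_neg v hz]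
    have := sq_sub_max_min_le (a := v y) (b := v (σ y)) (c := v z) (d := v (σ z))
      (hk _ _ (hσ.other_side hy hz))
    linarith

end Folding

/-! ### Polarization decreases pair interactions -/

/-- The interaction energy of `v` with the kernel `k`. -/
def pairEnergy (k : Space → ℝ) (v : Space → ℝ) : ℝ≥0∞ :=
  ∫⁻ y, ∫⁻ z, ENNReal.ofReal (k (y - z) * (v y - v z) ^ 2)

/-- Reflecting neither, one or both of the variables leaves the integral unchanged. The sum of the
four versions groups all pairs formed from the two orbits, which is what `two_point` compares
pointwise. -/
theorem Folding.four_mul_pairEnergy {σ : Space → Space} (hσ : Folding σ) {k v : Space → ℝ}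
    (hk : Measurable k) (hk0 : ∀ a, 0 ≤ k a) (hk' : ∀ a b : Space, ‖a‖ ≤ ‖b‖ → k b ≤ k a)
    (hv : Measurable v) :
    4 * pairEnergy k v = ∫⁻ y, ∫⁻ z, ENNReal.ofReal
      (k (y - z) * ((v y - v z) ^ 2 + (v (σ y) - v (σ z)) ^ 2) +
        k (y - σ z) * ((v y - v (σ z)) ^ 2 + (v (σ y) - v z) ^ 2)) := by
  have hkc : ∀ a b : Space, ‖a‖ = ‖b‖ → k a = k b := fun a b h =>
    le_antisymm (hk' _ _ h.ge) (hk' _ _ h.le)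
  have hσm : Measurable σ := hσ.continuous.measurable
  set H : Space → Space → ℝ≥0∞ := fun y z => ENNReal.ofReal (k (y - z) * (v y - v z) ^ 2) with hH
  have hHm : Measurable fun p : Space × Space => H p.1 p.2 := by simp only [hH]; fun_prop
  have h1 : pairEnergy k v = ∫⁻ y, ∫⁻ z, H y z := rfl
  have h2 : pairEnergy k v = ∫⁻ y, ∫⁻ z, H y (σ z) := by
    rw [h1]
    exact lintegral_congr fun y =>
      (hσ.measurePreserving.lintegral_comp_emb hσ.measurableEmbedding (H y)).symm
  have h3 : pairEnergy k v = ∫⁻ y, ∫⁻ z, H (σ y) z := by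
    rw [h1]
    exact (hσ.measurePreserving.lintegral_comp_emb hσ.measurableEmbedding
      (fun y => ∫⁻ z, H y z)).symm
  have h4 : pairEnergy k v = ∫⁻ y, ∫⁻ z, H (σ y) (σ z) := by
    rw [h2]
    exact (hσ.measurePreserving.lintegral_comp_emb hσ.measurableEmbedding
      (fun y => ∫⁻ z, H y (σ z))).symm
  have m1 : Measurable fun p : Space × Space => H p.1 (σ p.2) := by simp only [hH]; fun_prop
  have m3 : Measurable fun p : Space × Space => H (σ p.1) (σ p.2) := by simp only [hH]; fun_prop
  have h5 : ∀ y z, ENNReal.ofReal (k (y - z) * ((v y - v z) ^ 2 + (v (σ y) - v (σ z)) ^ 2) +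
        k (y - σ z) * ((v y - v (σ z)) ^ 2 + (v (σ y) - v z) ^ 2)) =
      H y z + (H (σ y) (σ z) + (H y (σ z) + H (σ y) z)) := by
    intro y z
    simp only [hH]
    rw [hkc (σ y - σ z) (y - z) (hσ.norm_sub y z), hkc (σ y - z) (y - σ z) (hσ.norm_sub' y z),
      ← ENNReal.ofReal_add (mul_nonneg (hk0 _) (sq_nonneg _)) (mul_nonneg (hk0 _) (sq_nonneg _)),
      ← ENNReal.ofReal_add (mul_nonneg (hk0 _) (sq_nonneg _)) (by
        have := hk0 (y - σ z); positivity),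
      ← ENNReal.ofReal_add (mul_nonneg (hk0 _) (sq_nonneg _)) (by
        have := hk0 (y - σ z); have := hk0 (y - z); positivity)]
    congr 1
    ring
  simp_rw [h5]
  have e1 : ∀ y, ∫⁻ z, (H y z + (H (σ y) (σ z) + (H y (σ z) + H (σ y) z))) =
      (∫⁻ z, H y z) + ((∫⁻ z, H (σ y) (σ z)) + ((∫⁻ z, H y (σ z)) + ∫⁻ z, H (σ y) z)) := by
    intro y
    have n0 : Measurable fun z => H y z := hHm.comp measurable_prodMk_left
    have n1 : Measurable fun z => H y (σ z) := m1.comp measurable_prodMk_left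
    have n3 : Measurable fun z => H (σ y) (σ z) := m3.comp measurable_prodMk_left
    rw [lintegral_add_left n0, lintegral_add_left n3, lintegral_add_left n1]
  simp_rw [e1]
  have n0 : Measurable fun y => ∫⁻ z, H y z := hHm.lintegral_prod_right'
  have n1 : Measurable fun y => ∫⁻ z, H y (σ z) := m1.lintegral_prod_right'
  have n3 : Measurable fun y => ∫⁻ z, H (σ y) (σ z) := m3.lintegral_prod_right'
  rw [lintegral_add_left n0, lintegral_add_left n3, lintegral_add_left n1, ← h1, ← h2, ← h3, ← h4]
  ring

theorem Folding.pairEnergy_pol_le {σ : Space → Space} (hσ : Folding σ) {k v : Space → ℝ}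
    (hk : Measurable k) (hk0 : ∀ a, 0 ≤ k a) (hk' : ∀ a b : Space, ‖a‖ ≤ ‖b‖ → k b ≤ k a)
    (hv : Measurable v) (hp : Measurable (pol σ v)) :
    pairEnergy k (pol σ v) ≤ pairEnergy k v := by
  have h : 4 * pairEnergy k (pol σ v) ≤ 4 * pairEnergy k v := by
    rw [hσ.four_mul_pairEnergy hk hk0 hk' hv, hσ.four_mul_pairEnergy hk hk0 hk' hp]
    exact lintegral_mono fun y => lintegral_mono fun z =>
      ENNReal.ofReal_le_ofReal (hσ.two_point v hk' y z)
  exact (ENNReal.mul_le_mul_iff_right (by norm_num) (by norm_num)).1 h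

theorem lintegral_comp_smul_eq {H : Space → ℝ≥0∞} (hH : Measurable H) {δ : ℝ} (hδ : 0 < δ) :
    ∫⁻ w, H (δ • w) = ENNReal.ofReal (δ ^ 3)⁻¹ * ∫⁻ w, H w := by
  have : ∫⁻ w, H (δ • w) = ∫⁻ w, H w ∂(Measure.map (δ • ·) volume) := by
    rw [lintegral_map hH (by fun_prop)]
  rw [this, Measure.map_addHaar_smul _ hδ.ne', lintegral_smul_measure,
    finrank_euclideanSpace, Fintype.card_fin, abs_of_pos (by positivity), smul_eq_mul]

/-- Substituting `δ z` for the displacement exhibits the increments as a pair interaction with a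
kernel that decreases with distance, the setting of the polarization inequality. -/
theorem incr_eq_pairEnergy {v : Space → ℝ} (hv : Measurable v) {δ : ℝ} (hδ : 0 < δ) :
    incr v δ = ENNReal.ofReal (δ ^ 3)⁻¹ * pairEnergy (fun w => mol (δ⁻¹ • w)) v := by
  have hm := measurable_mol
  rw [incr, lintegral_molMeasure]
  have h1 : ∀ z : Space, ENNReal.ofReal (mol z) * ∫⁻ x, ‖v (x + δ • z) - v x‖ₑ ^ 2
      = ∫⁻ x, ENNReal.ofReal (mol z * (v (x + δ • z) - v x) ^ 2) := by
    intro z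
    rw [← lintegral_const_mul' _ _ ENNReal.ofReal_ne_top]
    refine lintegral_congr fun x => ?_
    rw [ENNReal.ofReal_mul (mol_nonneg z), ofReal_sq]
  simp_rw [h1]
  rw [lintegral_lintegral_swap (by
    refine Measurable.aemeasurable ?_
    unfold Function.uncurry
    fun_prop), pairEnergy, ← lintegral_const_mul' _ _ ENNReal.ofReal_ne_top]
  refine lintegral_congr fun x => ?_
  have h2 := lintegral_comp_smul_eq (H := fun w =>
    ENNReal.ofReal (mol (δ⁻¹ • w) * (v (x + w) - v x) ^ 2)) (by fun_prop) hδ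
  simp only [smul_smul, inv_mul_cancel₀ hδ.ne', one_smul] at h2
  rw [h2]
  congr 1
  rw [← lintegral_add_left_eq_self (fun z => ENNReal.ofReal (mol (δ⁻¹ • (x - z)) * (v x - v z) ^ 2))
    x]
  refine lintegral_congr fun w => ?_
  rw [mol_congr (z := δ⁻¹ • (x - (x + w))) (w := δ⁻¹ • w) (by
    rw [sub_add_cancel_left, smul_neg, norm_neg])]
  congr 2
  ring

theorem Folding.dirichletLE_pol {σ : Space → Space} (hσ : Folding σ) {v : Space → ℝ} {D : ℝ≥0∞}
    (h : DirichletLE v D) (hv : Measurable v) (hp : Measurable (pol σ v)) :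
    DirichletLE (pol σ v) D := by
  intro δ hδ
  refine le_trans ?_ (h δ hδ)
  rw [incr_eq_pairEnergy hv hδ, incr_eq_pairEnergy hp hδ]
  have hm := measurable_mol
  refine mul_le_mul_right (hσ.pairEnergy_pol_le (by fun_prop) (fun _ => mol_nonneg _) ?_ hv hp) _
  intro a b hab
  refine mol_anti ?_
  rw [norm_smul, norm_smul]
  gcongr

/-! ### Radial competitors -/

/-- `v` is a Lipschitz function supported in a ball, equimeasurable with `w`, with Dirichlet
integral at most `D`. -/
structure Competitor (L : NNReal) (R k : ℝ) (D : ℝ≥0∞) (w v : Space → ℝ) : Prop where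
  lipschitz : LipschitzWith L v
  mem_Icc : ∀ x, v x ∈ Set.Icc 0 k
  eq_zero : ∀ x, R ≤ ‖x‖ → v x = 0
  dirichletLE : DirichletLE v D
  integral_comp : ∀ G : ℝ → ℝ, Continuous G → G 0 = 0 → ∫ x, G (v x) = ∫ x, G (w x)

theorem hasCompactSupport_of_eq_zero {E : Type*} [Zero E] {v : Space → E} {R : ℝ}
    (h : ∀ x, R ≤ ‖x‖ → v x = 0) : HasCompactSupport v := by
  refine HasCompactSupport.intro (isCompact_closedBall (0 : Space) R) fun x hx => h x ?_
  rw [mem_closedBall_zero_iff, not_le] at hx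
  exact hx.le

variable {L : NNReal} {R k : ℝ} {D : ℝ≥0∞} {w : Space → ℝ}

theorem Competitor.integrable_comp {v : Space → ℝ} (hv : Competitor L R k D w v) {G : ℝ → ℝ}
    (hG : Continuous G) (hG0 : G 0 = 0) : Integrable (fun x => G (v x)) volume :=
  (hG.comp hv.1.continuous).integrable_of_hasCompactSupport
    (hasCompactSupport_of_eq_zero (R := R) fun x hx => by
      simp only [hv.eq_zero x hx, hG0, Function.comp_apply])

theorem Competitor.pol {v : Space → ℝ} (hv : Competitor L R k D w v) {σ : Space → Space}
    (hσ : Folding σ) : Competitor L R k D w (pol σ v) := by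
  have hL := hσ.lipschitzWith_pol hv.lipschitz
  have hR : ∀ x, R ≤ ‖x‖ → KleinGordon.pol σ v x = 0 := by
    intro x hx
    rcases le_total ‖x‖ ‖σ x‖ with h | h
    · rw [Folding.pol_pos v h, hv.eq_zero x hx, hv.eq_zero _ (hx.trans h), max_self]
    · rw [hσ.pol_neg v h, hv.eq_zero x hx, min_eq_left (hv.mem_Icc _).1]
  refine ⟨hL, fun x => ?_, hR, hσ.dirichletLE_pol hv.4 hv.1.continuous.measurable
    hL.continuous.measurable, fun G hG hG0 => ?_⟩
  · rcases Folding.pol_mem (σ := σ) v x with h | h <;> rw [h] <;> exact hv.mem_Icc _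
  · rw [← hv.integral_comp G hG hG0]
    have i1 := hv.integrable_comp hG hG0
    have i2 : Integrable (fun x => G (KleinGordon.pol σ v x)) volume :=
      (hG.comp hL.continuous).integrable_of_hasCompactSupport
        (hasCompactSupport_of_eq_zero (R := R) fun x hx => by
          simp only [hR x hx, hG0, Function.comp_apply])
    -- Each integral is added to its own reflection; the two sums agree pointwise by `comp_pol_add`.
    have e1 := hσ.measurePreserving.integral_comp hσ.measurableEmbedding fun x => G (v x)
    have e2 := hσ.measurePreserving.integral_comp hσ.measurableEmbedding
      fun x => G (KleinGordon.pol σ v x)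
    have j1 := hσ.measurePreserving.integrable_comp_emb hσ.measurableEmbedding |>.2 i1
    have j2 := hσ.measurePreserving.integrable_comp_emb hσ.measurableEmbedding |>.2 i2
    have h1 := integral_add i1 j1
    have h2 := integral_add i2 j2
    simp only [Function.comp_apply] at h1 h2
    rw [e1] at h1
    rw [e2, integral_congr_ae (Eventually.of_forall fun x => hσ.comp_pol_add v G x), h1] at h2
    linarith

/-- The moment of inertia, which is decreased by polarization. -/
def inertia (v : Space → ℝ) : ℝ := ∫ x, ‖x‖ ^ 2 * v x

/-- Polarization gives the larger value of each reflected pair to the point nearer the origin, so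
the loss of inertia per pair is nonnegative. If there is no total loss, this continuous function
vanishes everywhere, and no pair was exchanged. -/
theorem Competitor.le_of_inertia_le {v : Space → ℝ} (hv : Competitor L R k D w v)
    {σ : Space → Space} (hσ : Folding σ) (h : inertia v ≤ inertia (KleinGordon.pol σ v)) {x : Space}
    (hx : ‖x‖ < ‖σ x‖) : v (σ x) ≤ v x := by
  have hp := hv.pol hσ
  have hint : ∀ {u : Space → ℝ}, Competitor L R k D w u →
      Integrable (fun x => ‖x‖ ^ 2 * u x) volume := by
    intro u hu
    refine Continuous.integrable_of_hasCompactSupport ?_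
      (hasCompactSupport_of_eq_zero (R := R) fun x hx => by simp [hu.eq_zero x hx])
    have := hu.1.continuous
    fun_prop
  set T : Space → ℝ := fun y => ‖y‖ ^ 2 * v y - ‖y‖ ^ 2 * KleinGordon.pol σ v y with hT
  have hTi : Integrable T volume := (hint hv).sub (hint hp)
  have hTint : ∫ y, T y ≤ 0 := by
    simp only [hT]
    rw [integral_sub (hint hv) (hint hp)]
    simp only [inertia] at h
    linarith
  have hT2i : Integrable (fun y => T (σ y)) volume :=
    (hσ.measurePreserving.integrable_comp_emb hσ.measurableEmbedding).2 hTi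
  have hsum : ∫ y, (T y + T (σ y)) ≤ 0 := by
    rw [integral_add hTi hT2i,
      hσ.measurePreserving.integral_comp hσ.measurableEmbedding T]
    linarith
  have hnonneg : ∀ y, 0 ≤ T y + T (σ y) := by
    intro y
    simp only [hT]
    rcases le_total ‖y‖ ‖σ y‖ with h1 | h1
    · have h2 : ‖y‖ ^ 2 ≤ ‖σ y‖ ^ 2 := by gcongr
      rw [Folding.pol_pos v h1, hσ.pol_apply_pos v h1]
      rcases le_total (v y) (v (σ y)) with h3 | h3 <;> simp only [h3, max_eq_left, max_eq_right,
        min_eq_left, min_eq_right] <;> nlinarith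
    · have h2 : ‖σ y‖ ^ 2 ≤ ‖y‖ ^ 2 := by gcongr
      rw [hσ.pol_neg v h1, hσ.pol_apply_neg v h1]
      rcases le_total (v y) (v (σ y)) with h3 | h3 <;> simp only [h3, max_eq_left, max_eq_right,
        min_eq_left, min_eq_right] <;> nlinarith
  have hcont : Continuous fun y => T y + T (σ y) := by
    have h1 := hv.1.continuous
    have h2 := hp.1.continuous
    have h3 := hσ.continuous
    simp only [hT]
    fun_prop
  have hzero := (integral_eq_zero_iff_of_nonneg hnonneg (hTi.add hT2i)).1
    (le_antisymm hsum (integral_nonneg hnonneg))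
  have h0 := congrFun ((hcont.ae_eq_iff_eq volume continuous_zero).1 hzero) x
  by_contra hcon
  rw [not_le] at hcon
  simp only [hT, Pi.zero_apply] at h0
  rw [Folding.pol_pos v hx.le, hσ.pol_apply_pos v hx.le, max_eq_right hcon.le,
    min_eq_left hcon.le] at h0
  have h2 : ‖x‖ ^ 2 < ‖σ x‖ ^ 2 := by gcongr
  nlinarith [mul_pos (sub_pos.2 h2) (sub_pos.2 hcon)]

open Classical in
-- Arzelà–Ascoli on the closed ball; outside it all the functions are zero.
theorem exists_tendsto_subseq_of_lipschitzWith {v : ℕ → Space → ℝ}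
    (hL : ∀ n, LipschitzWith L (v n)) (hk : ∀ n x, v n x ∈ Set.Icc 0 k)
    (hR : ∀ n x, R ≤ ‖x‖ → v n x = 0) :
    ∃ φ : ℕ → ℕ, StrictMono φ ∧ ∃ g : Space → ℝ,
      ∀ x, Tendsto (fun n => v (φ n) x) atTop (𝓝 (g x)) := by
  set B : Set Space := Metric.closedBall 0 R with hB
  have : CompactSpace B := isCompact_iff_compactSpace.1 (isCompact_closedBall _ _)
  set f : ℕ → BoundedContinuousFunction B ℝ := fun n =>
    BoundedContinuousFunction.mkOfCompact ⟨fun x => v n x, (hL n).continuous.comp continuous_subtype_val⟩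
    with hf
  have heq : Equicontinuous ((↑) : Set.range f → B → ℝ) := by
    refine UniformEquicontinuous.equicontinuous (LipschitzWith.uniformEquicontinuous _ L ?_)
    rintro ⟨-, n, rfl⟩
    exact (hL n).comp (LipschitzWith.subtype_val B) |>.weaken (by simp)
  have hcpt := BoundedContinuousFunction.arzela_ascoli (Set.Icc 0 k) isCompact_Icc (Set.range f)
    (by rintro g x ⟨n, rfl⟩; exact hk n x) heq
  obtain ⟨g, -, φ, hφ, hg⟩ := hcpt.tendsto_subseq (x := f)
    fun n => subset_closure (Set.mem_range_self n)
  refine ⟨φ, hφ, fun x => if h : x ∈ B then g ⟨x, h⟩ else 0, fun x => ?_⟩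
  by_cases h : x ∈ B
  · simp only [h, dif_pos]
    have := ((BoundedContinuousFunction.lipschitz_eval_const (⟨x, h⟩ : B)).continuous.tendsto g).comp hg
    exact this
  · simp only [h, dif_neg, not_false_iff]
    have : ∀ n, v n x = 0 := fun n => hR n x (by
      rw [hB, mem_closedBall_zero_iff, not_le] at h; exact h.le)
    simp only [this]
    exact tendsto_const_nhds

/-- The common support and bound allow dominated convergence for every integral, and the Dirichlet
bound passes by Fatou. Continuity of the inertia then makes its infimum attained. -/
theorem Competitor.of_tendsto {v : ℕ → Space → ℝ} {g : Space → ℝ}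
    (hv : ∀ n, Competitor L R k D w (v n)) (h : ∀ x, Tendsto (fun n => v n x) atTop (𝓝 (g x))) :
    Competitor L R k D w g ∧ Tendsto (fun n => inertia (v n)) atTop (𝓝 (inertia g)) := by
  have hdom : ∀ H : Space → ℝ → ℝ, Continuous (Function.uncurry H) → (∀ x, H x 0 = 0) →
      Tendsto (fun n => ∫ x, H x (v n x)) atTop (𝓝 (∫ x, H x (g x))) := by
    intro H hH hH0
    obtain ⟨M, hM⟩ := ((isCompact_closedBall (0 : Space) R).prod
      (isCompact_Icc (a := (0 : ℝ)) (b := k))).exists_bound_of_continuousOn hH.continuousOn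
    refine tendsto_integral_of_dominated_convergence
      ((Metric.closedBall (0 : Space) R).indicator fun _ => M) (fun n => ?_) ?_ (fun n => ?_) ?_
    · have := (hv n).1.continuous
      have h2 : Continuous fun x => H x (v n x) := hH.comp (by fun_prop : Continuous fun x => (x, v n x))
      exact h2.aestronglyMeasurable
    · exact (integrable_indicator_iff Metric.isClosed_closedBall.measurableSet).2
        (integrableOn_const (measure_closedBall_lt_top.ne))
    · refine Eventually.of_forall fun x => ?_
      by_cases hx : x ∈ Metric.closedBall (0 : Space) R
      · rw [Set.indicator_of_mem hx]
        exact hM (x, v n x) ⟨hx, (hv n).mem_Icc x⟩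
      · rw [Set.indicator_of_notMem hx, (hv n).eq_zero x, hH0, norm_zero]
        rw [mem_closedBall_zero_iff, not_le] at hx
        exact hx.le
    · refine Eventually.of_forall fun x => ?_
      exact ((hH.comp (Continuous.prodMk_right x)).tendsto (g x)).comp (h x)
  refine ⟨⟨?_, fun x => ?_, fun x hx => ?_, ?_, fun G hG hG0 => ?_⟩, ?_⟩
  · refine LipschitzWith.of_dist_le_mul fun x y => ?_
    exact le_of_tendsto ((h x).dist (h y))
      (Eventually.of_forall fun n => (hv n).1.dist_le_mul x y)
  · exact isClosed_Icc.mem_of_tendsto (h x) (Eventually.of_forall fun n => (hv n).mem_Icc x)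
  · refine tendsto_nhds_unique (h x) ?_
    simp only [(hv _).eq_zero x hx]
    exact tendsto_const_nhds
  · exact DirichletLE.of_tendsto (fun n => (hv n).4)
      (fun n => (hv n).1.continuous.stronglyMeasurable) h
  · have h1 := hdom (fun _ s => G s) (hG.comp continuous_snd) (fun _ => hG0)
    simp only [(hv _).integral_comp G hG hG0] at h1
    exact tendsto_nhds_unique h1 tendsto_const_nhds
  · exact hdom (fun x s => ‖x‖ ^ 2 * s) (by unfold Function.uncurry; fun_prop) (by simp)

/-- Every competitor can be replaced by a radial one. -/
theorem Competitor.exists_radial (hw : Competitor L R k D w w) :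
    ∃ v, Competitor L R k D w v ∧ ∀ x y, ‖x‖ = ‖y‖ → v x = v y := by
  set S : Set ℝ := {s | ∃ v, Competitor L R k D w v ∧ inertia v = s} with hS
  have hne : S.Nonempty := ⟨_, w, hw, rfl⟩
  have hbdd : BddBelow S := by
    refine ⟨0, ?_⟩
    rintro s ⟨v, hv, rfl⟩
    exact integral_nonneg fun x => mul_nonneg (sq_nonneg _) (hv.mem_Icc x).1
  obtain ⟨s, -, hs, hsS⟩ := exists_seq_tendsto_sInf hne hbdd
  choose v hv hvs using hsS
  obtain ⟨φ, hφ, g, hg⟩ := exists_tendsto_subseq_of_lipschitzWith (fun n => (hv n).1)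
    (fun n => (hv n).mem_Icc) (fun n => (hv n).eq_zero)
  obtain ⟨hgc, hgi⟩ := Competitor.of_tendsto (fun n => hv (φ n)) hg
  have hmin : inertia g = sInf S := by
    refine tendsto_nhds_unique hgi ?_
    simp only [hvs]
    exact hs.comp hφ.tendsto_atTop
  -- Some folding takes `x` to `y`; polarizing by it yields another competitor, whose inertia cannot
  -- be below the minimum.
  have hlt : ∀ x y : Space, ‖x‖ < ‖y‖ → g y ≤ g x := by
    intro x y hxy
    obtain ⟨σ, hσ, rfl⟩ := exists_folding hxy
    refine hgc.le_of_inertia_le hσ ?_ hxy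
    rw [hmin]
    exact csInf_le hbdd ⟨_, hgc.pol hσ, rfl⟩
  -- No folding joins distinct points of equal norm, so `y` is approached from outside along its ray
  -- and continuity is used.
  have hle : ∀ x y : Space, ‖x‖ = ‖y‖ → g y ≤ g x := by
    intro x y hxy
    by_cases hy : y = 0
    · have : x = 0 := by rw [← norm_eq_zero, hxy, hy, norm_zero]
      rw [this, hy]
    have h1 : Tendsto (fun t : ℝ => g (t • y)) (𝓝[>] 1) (𝓝 (g y)) := by
      have h2 : Continuous fun t : ℝ => g (t • y) := by
        have := hgc.1.continuous
        fun_prop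
      have h3 := (h2.tendsto 1).mono_left (nhdsWithin_le_nhds (s := Set.Ioi 1))
      rwa [one_smul] at h3
    refine le_of_tendsto h1 ?_
    filter_upwards [self_mem_nhdsWithin] with t ht
    refine hlt _ _ ?_
    rw [norm_smul, hxy, Real.norm_of_nonneg (zero_le_one.trans (le_of_lt ht))]
    exact lt_mul_of_one_lt_left (norm_pos_iff.2 hy) ht
  exact ⟨g, hgc, fun x y hxy => le_antisymm (hle y x hxy.symm) (hle x y hxy)⟩

/-! ### The nonlinearity -/

/-- A nonnegative continuous function on `[0, ∞)` which is locally quadratic at the origin. -/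
structure Tame (F : ℝ → ℝ) : Prop where
  nonneg : ∀ s, 0 ≤ s → 0 ≤ F s
  continuousOn : ContinuousOn F (Set.Ici 0)
  zero : F 0 = 0
  abs_sub_le : ∀ k : ℝ, ∃ C, 0 ≤ C ∧ ∀ s ∈ Set.Icc 0 k, ∀ t ∈ Set.Icc 0 k,
    |F s - F t| ≤ C * ((s + t) * |s - t|)

theorem tame_sq : Tame fun s => s ^ 2 := by
  refine ⟨fun s _ => sq_nonneg s, by fun_prop, by simp, fun k => ⟨1, zero_le_one, ?_⟩⟩
  intro s hs t ht
  rw [one_mul, ← abs_of_nonneg (add_nonneg hs.1 ht.1), ← abs_mul]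
  apply le_of_eq
  congr 1
  ring

/-- On `[0, k]` the second derivative is bounded and `F'(0) = 0`, so `|F'(x)| ≤ C x`. A second mean
value estimate on `[0, max s t]` gives the claim, with `max s t ≤ s + t`. -/
theorem Admissible.tame {F : ℝ → ℝ} {m : ℝ} (hF : Admissible F m) : Tame F := by
  refine ⟨hF.nonneg, hF.contDiffOn.continuousOn, hF.zero, fun k => ?_⟩
  set f := derivWithin F (Set.Ici 0) with hf
  have hu : UniqueDiffOn ℝ (Set.Ici (0 : ℝ)) := uniqueDiffOn_Ici 0
  have hf1 : ContDiffOn ℝ 1 f (Set.Ici 0) := hF.contDiffOn.derivWithin hu (by norm_num)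
  have hf2 : ContinuousOn (derivWithin f (Set.Ici 0)) (Set.Ici 0) :=
    hf1.continuousOn_derivWithin hu le_rfl
  obtain ⟨C, hC⟩ := (isCompact_Icc (a := (0 : ℝ)) (b := k)).exists_bound_of_continuousOn
    (hf2.mono Set.Icc_subset_Ici_self)
  have hF' : ∀ x, 0 ≤ x → HasDerivWithinAt F (f x) (Set.Ici 0) x := fun x hx =>
    ((hF.contDiffOn.differentiableOn (by norm_num)) x hx).hasDerivWithinAt
  have hf' : ∀ x, 0 ≤ x → HasDerivWithinAt f (derivWithin f (Set.Ici 0) x) (Set.Ici 0) x :=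
    fun x hx => ((hf1.differentiableOn one_ne_zero) x hx).hasDerivWithinAt
  have hb : ∀ s ∈ Set.Icc 0 k, ‖f s‖ ≤ |C| * s := by
    intro s hs
    have h1 := (convex_Icc 0 k).norm_image_sub_le_of_norm_hasDerivWithin_le
      (f := f) (f' := derivWithin f (Set.Ici 0)) (C := |C|)
      (fun x hx => (hf' x hx.1).mono Set.Icc_subset_Ici_self)
      (fun x hx => (hC x hx).trans (le_abs_self C)) ⟨le_rfl, hs.1.trans hs.2⟩ hs
    rwa [show f 0 = 0 from hF.deriv_zero, sub_zero, sub_zero, Real.norm_of_nonneg hs.1] at h1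
  refine ⟨|C|, abs_nonneg C, fun s hs t ht => ?_⟩
  have h1 := (convex_Icc 0 (max s t)).norm_image_sub_le_of_norm_hasDerivWithin_le
    (f := F) (f' := f) (C := |C| * (max s t))
    (fun x hx => (hF' x hx.1).mono Set.Icc_subset_Ici_self)
    (fun x hx => (hb x ⟨hx.1, hx.2.trans (max_le hs.2 ht.2)⟩).trans
      (mul_le_mul_of_nonneg_left hx.2 (abs_nonneg C)))
    (x := t) (y := s) ⟨ht.1, le_max_right _ _⟩ ⟨hs.1, le_max_left _ _⟩
  rw [← mul_assoc]
  refine h1.trans ?_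
  rw [Real.norm_eq_abs]
  gcongr
  exact max_le (by linarith [ht.1]) (by linarith [hs.1])

namespace Tame

variable {F : ℝ → ℝ}

/-- Only the values of `F` on `[0, ∞)` are controlled; composing with the absolute value gives a
globally continuous function that agrees with `F` on nonnegative profiles. -/
theorem continuous_abs (hF : Tame F) : Continuous fun s => F |s| := by
  have := hF.continuousOn.comp_continuous _root_.continuous_abs fun s => abs_nonneg s
  exact this

theorem le_sq (hF : Tame F) (k : ℝ) : ∃ C, 0 ≤ C ∧ ∀ s ∈ Set.Icc 0 k, F s ≤ C * s ^ 2 := by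
  obtain ⟨C, hC0, hC⟩ := hF.abs_sub_le k
  refine ⟨C, hC0, fun s hs => ?_⟩
  have := hC s hs 0 ⟨le_rfl, hs.1.trans hs.2⟩
  rw [hF.zero, sub_zero, add_zero, sub_zero, abs_of_nonneg hs.1,
    abs_of_nonneg (hF.nonneg s hs.1), ← sq] at this
  exact this

theorem comp_eq (F : ℝ → ℝ) {v : Space → ℝ} (hv : ∀ x, 0 ≤ v x) :
    (fun x => F (v x)) = fun x => F |v x| := by
  ext x; rw [abs_of_nonneg (hv x)]

theorem aestronglyMeasurable (hF : Tame F) {v : Space → ℝ} (hv : ∀ x, 0 ≤ v x)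
    (hm : AEStronglyMeasurable v volume) : AEStronglyMeasurable (fun x => F (v x)) volume := by
  rw [comp_eq F hv]
  exact hF.continuous_abs.comp_aestronglyMeasurable hm

theorem integrable (hF : Tame F) {v : Space → ℝ} {k : ℝ} (hv : ∀ x, v x ∈ Set.Icc 0 k)
    (h2 : MemLp v 2 volume) : Integrable (fun x => F (v x)) volume := by
  obtain ⟨C, hC0, hC⟩ := hF.le_sq k
  refine Integrable.mono' (h2.integrable_sq.const_mul C)
    (hF.aestronglyMeasurable (fun x => (hv x).1) h2.1) (Eventually.of_forall fun x => ?_)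
  rw [Real.norm_of_nonneg (hF.nonneg _ (hv x).1)]
  exact hC _ (hv x)

/-- The difference of the potentials is at most `C (u + v) |u - v|`, and Cauchy–Schwarz bounds its
`L¹` norm. -/
theorem tendsto_integral (hF : Tame F) {k : ℝ} {v : Space → ℝ} {u : ℕ → Space → ℝ}
    (hv : ∀ x, v x ∈ Set.Icc 0 k) (hv2 : MemLp v 2 volume) (hu : ∀ n x, u n x ∈ Set.Icc 0 k)
    (hu2 : ∀ n, MemLp (u n) 2 volume)
    (h : Tendsto (fun n => eLpNorm (u n - v) 2 volume) atTop (𝓝 0)) :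
    Tendsto (fun n => ∫ x, F (u n x)) atTop (𝓝 (∫ x, F (v x))) := by
  obtain ⟨C, hC0, hC⟩ := hF.abs_sub_le k
  refine tendsto_integral_of_L1' _ (hF.integrable hv hv2).1
    (Eventually.of_forall fun n => hF.integrable (hu n) (hu2 n)) ?_
  have hb : ∀ n, eLpNorm ((fun x => F (u n x)) - fun x => F (v x)) 1 volume ≤
      ENNReal.ofReal C * ((eLpNorm (u n - v) 2 volume + eLpNorm ((2 : ℝ) • v) 2 volume) *
        eLpNorm (u n - v) 2 volume) := by
    intro n
    calc eLpNorm ((fun x => F (u n x)) - fun x => F (v x)) 1 volume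
        ≤ eLpNorm (C • ((u n + v) • (u n - v))) 1 volume := by
          refine eLpNorm_mono fun x => ?_
          simp only [Pi.sub_apply, Pi.smul_apply, Pi.mul_apply, Pi.add_apply, smul_eq_mul,
            Real.norm_eq_abs, abs_mul, abs_of_nonneg hC0,
            abs_of_nonneg (add_nonneg (hu n x).1 (hv x).1)]
          exact hC _ (hu n x) _ (hv x)
      _ ≤ ENNReal.ofReal C * (eLpNorm (u n + v) 2 volume * eLpNorm (u n - v) 2 volume) := by
          rw [eLpNorm_const_smul, Real.enorm_eq_ofReal hC0]
          gcongr
          exact eLpNorm_smul_le_mul_eLpNorm ((hu2 n).sub hv2).1 ((hu2 n).add hv2).1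
      _ ≤ _ := by
          gcongr
          -- In this form no separate bound on the norms of `u n` is needed.
          have : u n + v = (u n - v) + (2 : ℝ) • v := by rw [two_smul]; abel
          rw [this]
          exact eLpNorm_add_le ((hu2 n).sub hv2).1 (hv2.const_smul _).1 one_le_two
  refine tendsto_of_tendsto_of_tendsto_of_le_of_le tendsto_const_nhds ?_ (fun _ => zero_le) hb
  have hfin : eLpNorm ((2 : ℝ) • v) 2 volume ≠ ⊤ := (hv2.const_smul (2 : ℝ)).2.ne
  have h1 := ENNReal.Tendsto.mul (h.add_const (eLpNorm ((2 : ℝ) • v) 2 volume))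
    (Or.inr ENNReal.zero_ne_top) h (Or.inr (by simpa using hfin))
  have h2 := ENNReal.Tendsto.const_mul (a := ENNReal.ofReal C) h1 (Or.inr ENNReal.ofReal_ne_top)
  simpa using h2

/-- The potential and the mass are continuous in `L²` on bounded nonnegative functions. -/
theorem exists_approx (hF : Tame F) {k : ℝ} {v : Space → ℝ} {u : ℕ → Space → ℝ}
    (hv : ∀ x, v x ∈ Set.Icc 0 k) (hv2 : MemLp v 2 volume) (hu : ∀ n x, u n x ∈ Set.Icc 0 k)
    (hu2 : ∀ n, MemLp (u n) 2 volume)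
    (h : Tendsto (fun n => ∫⁻ x, ‖u n x - v x‖ₑ ^ 2) atTop (𝓝 0)) {ε : ℝ} (hε : 0 < ε) :
    ∀ᶠ n in atTop, ∫ x, F (u n x) ≤ (∫ x, F (v x)) + ε ∧ (∫ x, v x ^ 2) - ε ≤ ∫ x, u n x ^ 2 := by
  have h' : Tendsto (fun n => eLpNorm (u n - v) 2 volume) atTop (𝓝 0) :=
    tendsto_eLpNorm_two_iff.2 h
  have h1 := hF.tendsto_integral hv hv2 hu hu2 h'
  have h2 := tame_sq.tendsto_integral hv hv2 hu hu2 h'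
  filter_upwards [h1.eventually_le_const (u := (∫ x, F (v x)) + ε) (by linarith),
    h2.eventually_const_le (u := (∫ x, v x ^ 2) - ε) (by linarith)] with n h3 h4
  exact ⟨h3, h4⟩

/-- Truncation at a suitable level does not increase the potential energy by much, without any
growth condition at infinity. -/
theorem exists_truncation (hF : Tame F) {ρ : Space → ℝ} (hρ : ∀ x, 0 ≤ ρ x)
    (hρ2 : MemLp ρ 2 volume) (hi : Integrable (fun x => F (ρ x)) volume) {ε : ℝ} (hε : 0 < ε) :
    ∃ k, 0 ≤ k ∧ ∫ x, F (min (ρ x) k) ≤ (∫ x, F (ρ x)) + ε ∧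
      (∫ x, ρ x ^ 2) - ε ≤ ∫ x, min (ρ x) k ^ 2 := by
  have hm : AEMeasurable ρ volume := hρ2.1.aemeasurable
  have hns : ∀ k : ℝ, NullMeasurableSet {x | k ≤ ρ x} volume := fun k =>
    nullMeasurableSet_le aemeasurable_const hm
  have hfin : ∀ k : ℝ, 0 < k → volume {x | k ≤ ρ x} < ⊤ := by
    intro k hk
    have h1 := hρ2.integrable_sq.measure_ge_lt_top (ε := k ^ 2) (by positivity)
    refine lt_of_le_of_lt (measure_mono fun x hx => ?_) h1
    simp only [Set.mem_ofPred_eq] at hx ⊢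
    exact pow_le_pow_left₀ hk.le hx 2
  obtain ⟨N, hN⟩ : ∃ N : ℝ, 0 < N ∧ ∀ k, N ≤ k → (∫ x, ρ x ^ 2) - ε ≤ ∫ x, min (ρ x) k ^ 2 := by
    have h1 : Tendsto (fun k : ℝ => ∫ x, min (ρ x) k ^ 2) atTop (𝓝 (∫ x, ρ x ^ 2)) := by
      refine tendsto_integral_filter_of_dominated_convergence (fun x => ρ x ^ 2) ?_ ?_
        hρ2.integrable_sq (Eventually.of_forall fun x => ?_)
      · exact Eventually.of_forall fun k => ((hm.min aemeasurable_const).pow_const 2).aestronglyMeasurable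
      · filter_upwards [eventually_ge_atTop (0 : ℝ)] with k hk
        refine Eventually.of_forall fun x => ?_
        rw [Real.norm_of_nonneg (sq_nonneg _)]
        exact pow_le_pow_left₀ (le_min (hρ x) hk) (min_le_left _ _) 2
      · refine tendsto_const_nhds.congr' ?_
        filter_upwards [eventually_ge_atTop (ρ x)] with k hk
        rw [min_eq_left hk]
    obtain ⟨N, hN⟩ := eventually_atTop.1
      (h1.eventually_const_le (u := (∫ x, ρ x ^ 2) - ε) (by linarith))
    exact ⟨max N 1, by positivity, fun k hk => hN k ((le_max_left _ _).trans hk)⟩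
  -- A good level exists because `F ∘ ρ` is integrable. Otherwise, for each `K ≥ N`, where `ρ x ≥ K`
  -- one has `F (ρ x) |{ρ ≥ K}| ≥ F (ρ x) |{ρ ≥ ρ x}| > ε`, so the integral of `F ∘ ρ` over `{ρ ≥
  -- K}` is at least `ε`; but these tails tend to zero.
  obtain ⟨k, hkN, hk⟩ : ∃ k, N ≤ k ∧ F k * volume.real {x | k ≤ ρ x} ≤ ε := by
    by_contra! hcon
    have h1 : ∀ K, N ≤ K → ε ≤ ∫ x in {x | K ≤ ρ x}, F (ρ x) := by
      intro K hK
      have hK0 : 0 < K := hN.1.trans_le hK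
      have hpos : 0 < volume.real {x | K ≤ ρ x} := by
        refine lt_of_le_of_ne measureReal_nonneg fun h => ?_
        have := hcon K hK
        rw [← h, mul_zero] at this
        linarith
      have h2 : ∫ x in {x | K ≤ ρ x}, ε / volume.real {x | K ≤ ρ x}
          ≤ ∫ x in {x | K ≤ ρ x}, F (ρ x) := by
        refine setIntegral_mono_on₀ (integrableOn_const (hfin K hK0).ne) hi.integrableOn (hns K) ?_
        intro x hx
        rw [Set.mem_ofPred_eq] at hx
        rw [div_le_iff₀ hpos]
        refine (hcon (ρ x) (hK.trans hx)).le.trans ?_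
        refine mul_le_mul_of_nonneg_left ?_ (hF.nonneg _ (hρ x))
        exact measureReal_mono (fun y hy => le_trans hx hy) (hfin K hK0).ne
      rw [setIntegral_const, smul_eq_mul, mul_div_cancel₀ _ hpos.ne'] at h2
      exact h2
    have h3 : Tendsto (fun n : ℕ => ∫ x in {x | (n : ℝ) ≤ ρ x}, F (ρ x)) atTop (𝓝 0) := by
      have h4 : Tendsto (fun n : ℕ => ∫ x, {x | (n : ℝ) ≤ ρ x}.indicator (fun x => F (ρ x)) x)
          atTop (𝓝 (∫ x : Space, (0 : ℝ))) := by
        refine tendsto_integral_of_dominated_convergence (fun x => F (ρ x))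
          (fun n => hi.1.indicator₀ (hns _)) hi (fun n => Eventually.of_forall fun x => ?_)
          (Eventually.of_forall fun x => ?_)
        · refine (norm_indicator_le_norm_self _ _).trans_eq ?_
          rw [Real.norm_of_nonneg (hF.nonneg _ (hρ x))]
        · refine tendsto_const_nhds.congr' ?_
          obtain ⟨n, hn⟩ := exists_nat_gt (ρ x)
          filter_upwards [eventually_ge_atTop n] with m hm
          rw [Set.indicator_of_notMem]
          simp only [Set.mem_ofPred_eq, not_le]
          exact hn.trans_le (by exact_mod_cast hm)
      simp only [integral_indicator₀ (hns _), integral_zero] at h4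
      exact h4
    obtain ⟨n, hn1, hn2⟩ := ((h3.eventually_lt_const hε).and
      (tendsto_natCast_atTop_atTop.eventually_ge_atTop N)).exists
    exact absurd (h1 n hn2) (not_le.2 hn1)
  have hk0 : 0 < k := hN.1.trans_le hkN
  refine ⟨k, hk0.le, ?_, hN.2 k hkN⟩
  have hind : Integrable ({x | k ≤ ρ x}.indicator fun _ => F k) volume :=
    (integrableOn_const (hfin k hk0).ne).integrable_indicator₀ (hns k)
  -- Truncation can raise the potential only where `ρ ≥ k`, and there by at most `F k`, since `F ≥
  -- 0`.
  have hle : ∀ x, F (min (ρ x) k) ≤ F (ρ x) + {x | k ≤ ρ x}.indicator (fun _ => F k) x := by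
    intro x
    rcases le_total k (ρ x) with h | h
    · rw [min_eq_right h, Set.indicator_of_mem (by exact h)]
      linarith [hF.nonneg _ (hρ x)]
    · rw [min_eq_left h]
      have : 0 ≤ {x | k ≤ ρ x}.indicator (fun _ => F k) x :=
        Set.indicator_nonneg (fun _ _ => hF.nonneg k hk0.le) x
      linarith
  have hmin : ∀ x, 0 ≤ min (ρ x) k := fun x => le_min (hρ x) hk0.le
  have h5 : Integrable (fun x => F (min (ρ x) k)) volume := by
    refine (hi.add hind).mono' (hF.aestronglyMeasurable hmin
      (hm.min aemeasurable_const).aestronglyMeasurable) (Eventually.of_forall fun x => ?_)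
    rw [Real.norm_of_nonneg (hF.nonneg _ (hmin x))]
    exact hle x
  calc ∫ x, F (min (ρ x) k) ≤ ∫ x, (F (ρ x) + {x | k ≤ ρ x}.indicator (fun _ => F k) x) :=
        integral_mono h5 (hi.add hind) hle
    _ = (∫ x, F (ρ x)) + F k * volume.real {x | k ≤ ρ x} := by
        rw [integral_add hi hind, integral_indicator₀ (hns k), setIntegral_const, smul_eq_mul,
          mul_comm]
    _ ≤ _ := by linarith

end Tame

/-! ### Approximation by smooth radial functions -/

/-- A bounded nonnegative profile in `L²` with Dirichlet integral at most `D`. -/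
structure Profile (k : ℝ) (D : ℝ≥0∞) (v : Space → ℝ) : Prop where
  measurable : Measurable v
  mem_Icc : ∀ x, v x ∈ Set.Icc 0 k
  memLp : MemLp v 2 volume
  dirichletLE : DirichletLE v D

namespace Profile

variable {k : ℝ} {D : ℝ≥0∞} {v : Space → ℝ}

theorem norm_le (h : Profile k D v) (x : Space) : ‖v x‖ ≤ k := by
  rw [Real.norm_of_nonneg (h.mem_Icc x).1]
  exact (h.mem_Icc x).2

theorem locallyIntegrable (h : Profile k D v) : LocallyIntegrable v volume :=
  h.memLp.locallyIntegrable one_le_two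

theorem lintegral_mollify_sub_le (h : Profile k D v) {δ : ℝ} (hδ : 0 < δ) :
    ∫⁻ x, ‖KleinGordon.mollify δ v x - v x‖ₑ ^ 2 ≤ ENNReal.ofReal (δ ^ 2) * (molVar * D) :=
  (KleinGordon.lintegral_mollify_sub_le h.measurable h.norm_le δ).trans (h.dirichletLE δ hδ)

theorem mollify (h : Profile k D v) (hD : D ≠ ⊤) {δ : ℝ} (hδ : 0 < δ) :
    Profile k D (KleinGordon.mollify δ v) := by
  have hs := contDiff_mollify hδ h.locallyIntegrable
  refine ⟨hs.continuous.measurable, mollify_mem_Icc h.measurable h.mem_Icc δ, ?_,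
    h.dirichletLE.mollify h.measurable h.norm_le δ⟩
  have h1 : MemLp (fun x => KleinGordon.mollify δ v x - v x) 2 volume := by
    refine memLp_two_of_lintegral_lt_top
      (hs.continuous.measurable.sub h.measurable).aestronglyMeasurable ?_
    refine (h.lintegral_mollify_sub_le hδ).trans_lt ?_
    exact (ENNReal.mul_ne_top ENNReal.ofReal_ne_top (ENNReal.mul_ne_top molVar_ne_top hD)).lt_top
  have h2 := h1.add h.memLp
  convert h2 using 1
  ext x
  simp

theorem exists_mollify (h : Profile k D v) (hD : D ≠ ⊤) {F : ℝ → ℝ} (hF : Tame F) {ε : ℝ}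
    (hε : 0 < ε) : ∃ δ, 0 < δ ∧ ∫ x, F (KleinGordon.mollify δ v x) ≤ (∫ x, F (v x)) + ε ∧
      (∫ x, v x ^ 2) - ε ≤ ∫ x, KleinGordon.mollify δ v x ^ 2 := by
  have hpos : ∀ n : ℕ, (0 : ℝ) < 1 / ((n : ℝ) + 1) := fun n => by positivity
  have ht : Tendsto (fun n : ℕ => ∫⁻ x, ‖KleinGordon.mollify (1 / ((n : ℝ) + 1)) v x - v x‖ₑ ^ 2)
      atTop (𝓝 0) := by
    refine tendsto_of_tendsto_of_tendsto_of_le_of_le tendsto_const_nhds ?_ (fun _ => zero_le)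
      (fun n => h.lintegral_mollify_sub_le (hpos n))
    have h1 := ((tendsto_one_div_add_atTop_nhds_zero_nat (𝕜 := ℝ)).pow 2)
    have h2 := ENNReal.Tendsto.mul_const (b := molVar * D) (ENNReal.tendsto_ofReal h1)
      (Or.inr (ENNReal.mul_ne_top molVar_ne_top hD))
    simpa using h2
  obtain ⟨n, hn⟩ := (hF.exists_approx h.mem_Icc h.memLp
    (fun n x => (h.mollify hD (hpos n)).mem_Icc x)
    (fun n => (h.mollify hD (hpos n)).memLp) ht hε).exists
  exact ⟨_, hpos n, hn⟩

/-- The map `s ↦ max (s - τ) 0` is a contraction and lies below the identity on `[0, ∞)`. Applied to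
an average, which vanishes at infinity, it produces compact support for `τ > 0`. -/
theorem sub_cut (h : Profile k D v) {τ : ℝ} (hτ : 0 ≤ τ) :
    Profile k D (fun x => max (v x - τ) 0) := by
  have hle : ∀ x, max (v x - τ) 0 ≤ v x := fun x =>
    max_le (by linarith) (h.mem_Icc x).1
  refine ⟨(h.measurable.sub_const τ).max measurable_const, fun x =>
    ⟨le_max_right _ _, (hle x).trans (h.mem_Icc x).2⟩, ?_, ?_⟩
  · refine h.memLp.mono ((h.measurable.sub_const τ).max measurable_const).aestronglyMeasurable
      (Eventually.of_forall fun x => ?_)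
    rw [Real.norm_of_nonneg (le_max_right _ _), Real.norm_of_nonneg (h.mem_Icc x).1]
    exact hle x
  · refine h.dirichletLE.comp (T := fun s => max (s - τ) 0) fun a b => ?_
    have := abs_max_sub_max_le_abs (a - τ) (b - τ) 0
    rw [sub_sub_sub_cancel_right] at this
    simpa [Real.norm_eq_abs] using this

theorem exists_sub_cut (h : Profile k D v) {F : ℝ → ℝ} (hF : Tame F) {ε : ℝ}
    (hε : 0 < ε) : ∃ τ, 0 < τ ∧ ∫ x, F (max (v x - τ) 0) ≤ (∫ x, F (v x)) + ε ∧
      (∫ x, v x ^ 2) - ε ≤ ∫ x, max (v x - τ) 0 ^ 2 := by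
  have hpos : ∀ n : ℕ, (0 : ℝ) < 1 / ((n : ℝ) + 1) := fun n => by positivity
  have hb : ∀ (n : ℕ) x, ‖max (v x - 1 / ((n : ℝ) + 1)) 0 - v x‖ ≤ min (v x) (1 / ((n : ℝ) + 1)) := by
    intro n x
    have h1 := (h.mem_Icc x).1
    have h2 := hpos n
    rw [Real.norm_eq_abs, abs_le]
    rcases le_total (v x) (1 / ((n : ℝ) + 1)) with h3 | h3
    · rw [max_eq_right (by linarith), min_eq_left h3]
      constructor <;> linarith
    · rw [max_eq_left (by linarith), min_eq_right h3]
      constructor <;> linarith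
  have ht : Tendsto (fun n : ℕ => ∫⁻ x, ‖max (v x - 1 / ((n : ℝ) + 1)) 0 - v x‖ₑ ^ 2)
      atTop (𝓝 (∫⁻ x : Space, 0)) := by
    refine tendsto_lintegral_of_dominated_convergence (fun x => ‖v x‖ₑ ^ 2) (fun n => ?_)
      (fun n => Eventually.of_forall fun x => ?_) (lintegral_enorm_sq_lt_top h.memLp).ne
      (Eventually.of_forall fun x => ?_)
    · have := h.measurable
      fun_prop
    · dsimp only
      gcongr 1
      rw [enorm_le_iff_norm_le, Real.norm_of_nonneg (h.mem_Icc x).1]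
      exact (hb n x).trans (min_le_left _ _)
    · have h1 : Tendsto (fun n : ℕ => max (v x - 1 / ((n : ℝ) + 1)) 0 - v x) atTop (𝓝 0) :=
        squeeze_zero_norm (fun n => (hb n x).trans (min_le_right _ _))
          tendsto_one_div_add_atTop_nhds_zero_nat
      have h2 := ((ENNReal.continuous_pow 2).tendsto _).comp h1.enorm
      simpa [Function.comp_def] using h2
  rw [lintegral_zero] at ht
  obtain ⟨n, hn⟩ := (hF.exists_approx h.mem_Icc h.memLp
    (fun n x => (h.sub_cut (hpos n).le).mem_Icc x)
    (fun n => (h.sub_cut (hpos n).le).memLp) ht hε).exists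
  exact ⟨_, hpos n, hn⟩

end Profile

/-- The modulus is truncated to be bounded, averaged to be Lipschitz and small at infinity, lowered
by `τ` to have compact support, symmetrized, and averaged again to be smooth. No step increases the
Dirichlet bound; symmetrization preserves potential and mass, and each of the other four steps is
allowed `ε / 4`. -/
theorem exists_smooth_radial {F : ℝ → ℝ} (hF : Tame F) {ψ : Space → ℂ} (hψ : IsH1 ψ)
    (hi : Integrable (fun x => F ‖ψ x‖) volume) {ε : ℝ} (hε : 0 < ε) :
    ∃ V : Space → ℝ, ContDiff ℝ ((⊤ : ℕ∞) : WithTop ℕ∞) V ∧ HasCompactSupport V ∧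
      (∃ k, ∀ x, V x ∈ Set.Icc 0 k) ∧ (∀ x y, ‖x‖ = ‖y‖ → V x = V y) ∧
      ∫⁻ x, ‖grad V x‖ₑ ^ 2 ≤ ∫⁻ x, ‖weakGrad ψ x‖ₑ ^ 2 ∧
      ∫ x, F (V x) ≤ (∫ x, F ‖ψ x‖) + ε ∧ (∫ x, ‖ψ x‖ ^ 2) - ε ≤ ∫ x, V x ^ 2 := by
  set D := ∫⁻ x, ‖weakGrad ψ x‖ₑ ^ 2 with hD
  have hDt : D ≠ ⊤ := (lintegral_enorm_sq_lt_top hψ.memLp_weakGrad).ne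
  obtain ⟨ψ', hψ'm, hψψ'⟩ := hψ.1.1
  have hψ'D : DirichletLE ψ' D := hψ.dirichletLE.congr_ae hψψ'
  have hψ'2 : MemLp ψ' 2 volume := hψ.1.ae_eq hψψ'
  have e1 : ∫ x, F ‖ψ x‖ = ∫ x, F ‖ψ' x‖ := by
    refine integral_congr_ae ?_
    filter_upwards [hψψ'] with x hx; rw [hx]
  have e2 : ∫ x, ‖ψ x‖ ^ 2 = ∫ x, ‖ψ' x‖ ^ 2 := by
    refine integral_congr_ae ?_
    filter_upwards [hψψ'] with x hx; rw [hx]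
  have hi' : Integrable (fun x => F ‖ψ' x‖) volume := by
    refine hi.congr ?_
    filter_upwards [hψψ'] with x hx; rw [hx]
  have hε4 : 0 < ε / 4 := by linarith
  obtain ⟨k, hk, a1, b1⟩ := hF.exists_truncation (ρ := fun x => ‖ψ' x‖) (fun _ => norm_nonneg _)
    hψ'2.norm hi' hε4
  have p1 : Profile k D fun x => min ‖ψ' x‖ k := by
    refine ⟨hψ'm.norm.measurable.min measurable_const, fun x =>
      ⟨le_min (norm_nonneg _) hk, min_le_right _ _⟩, ?_, ?_⟩
    · refine hψ'2.mono (hψ'm.norm.measurable.min measurable_const).aestronglyMeasurable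
        (Eventually.of_forall fun x => ?_)
      rw [Real.norm_of_nonneg (le_min (norm_nonneg _) hk)]
      exact min_le_left _ _
    · refine hψ'D.comp (T := fun z => min ‖z‖ k) fun a b => ?_
      have h1 := abs_min_sub_min_le_max ‖a‖ k ‖b‖ k
      rw [sub_self, abs_zero, max_eq_left (abs_nonneg _)] at h1
      exact h1.trans (abs_norm_sub_norm_le a b)
  obtain ⟨δ, hδ, a2, b2⟩ := p1.exists_mollify hDt hF hε4
  have p2 := p1.mollify hDt hδ
  obtain ⟨τ, hτ, a3, b3⟩ := p2.exists_sub_cut hF hε4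
  have p3 := p2.sub_cut hτ.le
  obtain ⟨L, hL⟩ := exists_lipschitzWith_mollify hδ p1.locallyIntegrable p1.norm_le
  obtain ⟨R, hR⟩ := exists_mollify_lt hδ p1.measurable p1.memLp hτ
  set w : Space → ℝ := fun x => max (mollify δ (fun x => min ‖ψ' x‖ k) x - τ) 0 with hw
  have hwc : Competitor L R k D w w := by
    refine ⟨?_, p3.mem_Icc, fun x hx => ?_, p3.dirichletLE, fun _ _ _ => rfl⟩
    · refine LipschitzWith.of_dist_le_mul fun x y => ?_
      refine le_trans ?_ (hL.dist_le_mul x y)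
      have := abs_max_sub_max_le_abs (mollify δ (fun x => min ‖ψ' x‖ k) x - τ)
        (mollify δ (fun x => min ‖ψ' x‖ k) y - τ) 0
      rw [sub_sub_sub_cancel_right] at this
      exact this
    · have := (abs_lt.1 (hR x hx)).2
      exact max_eq_right (by linarith)
  obtain ⟨v, hv, hrad⟩ := hwc.exists_radial
  have hvc := hasCompactSupport_of_eq_zero hv.eq_zero
  have p4 : Profile k D v := ⟨hv.1.continuous.measurable, hv.mem_Icc,
    hv.1.continuous.memLp_of_hasCompactSupport hvc, hv.dirichletLE⟩
  have a4 : ∫ x, F (v x) = ∫ x, F (w x) := by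
    rw [Tame.comp_eq F fun x => (hv.mem_Icc x).1, Tame.comp_eq F fun x => (hwc.mem_Icc x).1]
    exact hv.integral_comp _ hF.continuous_abs (by simp [hF.zero])
  have b4 : ∫ x, v x ^ 2 = ∫ x, w x ^ 2 := hv.integral_comp (fun s => s ^ 2) (by fun_prop) (by simp)
  obtain ⟨η, hη, a5, b5⟩ := p4.exists_mollify hDt hF hε4
  have p5 := p4.mollify hDt hη
  have hs := contDiff_mollify hη p4.locallyIntegrable
  refine ⟨mollify η v, hs, ?_, ⟨k, p5.mem_Icc⟩, fun x y hxy => ?_,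
    p5.dirichletLE.lintegral_grad_le (hs.of_le (by simp)), by linarith, by linarith⟩
  · exact hasCompactSupport_of_eq_zero (R := R + η) fun x hx => mollify_eq_zero hη.le hv.eq_zero hx
  · obtain ⟨O, rfl⟩ := exists_isometry_apply_eq hxy
    exact (mollify_comp_isometry O (fun z => hrad _ _ (O.norm_map z)) η x).symm

/-! ### Removing the axis -/

theorem contDiff_apply_space {n : WithTop ℕ∞} (i : Fin 3) : ContDiff ℝ n fun x : Space => x i :=
  (EuclideanSpace.proj (𝕜 := ℝ) i : Space →L[ℝ] ℝ).contDiff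

theorem contDiff_rsq {n : WithTop ℕ∞} : ContDiff ℝ n rsq :=
  ((contDiff_apply_space 0).pow 2).add ((contDiff_apply_space 1).pow 2)

theorem rsq_nonneg (x : Space) : 0 ≤ rsq x := by unfold rsq; positivity

theorem norm_sq_eq_rsq (x : Space) : ‖x‖ ^ 2 = rsq x + x 2 ^ 2 := by
  rw [EuclideanSpace.norm_sq_eq, Fin.sum_univ_three]
  simp [rsq]

theorem hasFDerivAt_coord (i : Fin 3) (x : Space) :
    HasFDerivAt (fun x : Space => x i) (EuclideanSpace.proj (𝕜 := ℝ) i : Space →L[ℝ] ℝ) x :=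
  (EuclideanSpace.proj (𝕜 := ℝ) i : Space →L[ℝ] ℝ).hasFDerivAt

theorem fderiv_rsq (x v : Space) : fderiv ℝ rsq x v = 2 * (x 0 * v 0 + x 1 * v 1) := by
  have h := ((hasFDerivAt_coord 0 x).pow 2).add ((hasFDerivAt_coord 1 x).pow 2)
  have h2 : HasFDerivAt rsq _ x := h
  rw [h2.fderiv]
  simp
  ring

/-- The axis is a null set. -/
theorem ae_rsq_ne_zero : ∀ᵐ x : Space, rsq x ≠ 0 := by
  have h : volume {x : Space | x 0 = 0} = 0 := by
    have h1 := Measure.addHaar_submodule (volume : Measure Space)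
      (LinearMap.ker ((EuclideanSpace.proj (𝕜 := ℝ) (0 : Fin 3) : Space →L[ℝ] ℝ) : Space →ₗ[ℝ] ℝ)) ?_
    · exact h1
    · intro htop
      have : e 0 ∈ LinearMap.ker ((EuclideanSpace.proj (𝕜 := ℝ) (0 : Fin 3) : Space →L[ℝ] ℝ) : Space →ₗ[ℝ] ℝ) := by
        rw [htop]; trivial
      simp at this
  refine measure_mono_null ?_ h
  intro x hx
  simp only [Set.mem_compl_iff, Set.mem_ofPred_eq, not_not] at hx ⊢
  unfold rsq at hx
  nlinarith [sq_nonneg (x 0), sq_nonneg (x 1)]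

/-! ### Cutoffs of vanishing Dirichlet energy around the axis -/

/-- The smooth step from `0` on `(-∞, 1]` to `1` on `[2, ∞)`. -/
def step (t : ℝ) : ℝ := Real.smoothTransition (t - 1)

theorem contDiff_step {n : ℕ∞} : ContDiff ℝ n step :=
  Real.smoothTransition.contDiff.comp (contDiff_id.sub contDiff_const)

theorem step_of_le {t : ℝ} (h : t ≤ 1) : step t = 0 :=
  Real.smoothTransition.zero_of_nonpos (by linarith)

theorem step_of_ge {t : ℝ} (h : 2 ≤ t) : step t = 1 :=
  Real.smoothTransition.one_of_one_le (by linarith)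

theorem deriv_step_eq_zero {t : ℝ} (h : t < 1 ∨ 2 < t) : deriv step t = 0 := by
  rcases h with h | h
  · have : step =ᶠ[𝓝 t] fun _ => 0 := by
      filter_upwards [Iio_mem_nhds h] with s hs using step_of_le (le_of_lt hs)
    rw [this.deriv_eq]; simp
  · have : step =ᶠ[𝓝 t] fun _ => 1 := by
      filter_upwards [Ioi_mem_nhds h] with s hs using step_of_ge (le_of_lt hs)
    rw [this.deriv_eq]; simp

theorem exists_deriv_step_le : ∃ M, 0 ≤ M ∧ ∀ t, |deriv step t| ≤ M := by
  have hc : Continuous (deriv step) := (contDiff_step (n := 1)).continuous_deriv (by simp)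
  obtain ⟨M, hM⟩ := (isCompact_Icc (a := (1 : ℝ)) (b := 2)).exists_bound_of_continuousOn hc.continuousOn
  refine ⟨|M|, abs_nonneg M, fun t => ?_⟩
  by_cases h : t ∈ Set.Icc (1 : ℝ) 2
  · exact (hM t h).trans (le_abs_self M)
  · rw [deriv_step_eq_zero, abs_zero]
    · exact abs_nonneg M
    · by_contra! hcon
      exact h ⟨hcon.1, hcon.2⟩

/-- A cutoff removing the neighbourhood of size `2⁻ʲ` of the axis. -/
def ringCut (j : ℕ) (x : Space) : ℝ := step (4 ^ j * rsq x)

theorem contDiff_ringCut (j : ℕ) {n : ℕ∞} : ContDiff ℝ n (ringCut j) :=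
  contDiff_step.comp (contDiff_const.mul contDiff_rsq)

theorem fderiv_ringCut (j : ℕ) (x v : Space) :
    fderiv ℝ (ringCut j) x v =
      deriv step (4 ^ j * rsq x) * (4 ^ j * (2 * (x 0 * v 0 + x 1 * v 1))) := by
  have h1 : HasFDerivAt (fun x => 4 ^ j * rsq x) ((4 : ℝ) ^ j • fderiv ℝ rsq x) x :=
    (((contDiff_rsq (n := 1)).differentiable one_ne_zero) x).hasFDerivAt.const_mul _
  have h2 : HasDerivAt step (deriv step (4 ^ j * rsq x)) (4 ^ j * rsq x) :=
    (((contDiff_step (n := 1)).differentiable (by simp)) _).hasDerivAt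
  have h3 : HasFDerivAt (ringCut j) _ x := h2.comp_hasFDerivAt x h1
  rw [h3.fderiv]
  simp [fderiv_rsq]

theorem norm_grad_ringCut_sq (j : ℕ) (x : Space) :
    ‖grad (ringCut j) x‖ ^ 2 = deriv step (4 ^ j * rsq x) ^ 2 * (4 * 16 ^ j * rsq x) := by
  rw [EuclideanSpace.norm_sq_eq, Fin.sum_univ_three]
  simp only [grad, fderiv_ringCut, Real.norm_eq_abs, sq_abs]
  have : (16 : ℝ) ^ j = (4 ^ j) ^ 2 := by rw [← pow_mul, mul_comm, pow_mul]; norm_num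
  rw [this]
  simp [rsq]
  ring

theorem volume_box_le {a R : ℝ} (ha : 0 ≤ a) :
    volume {x : Space | |x 0| ≤ a ∧ |x 1| ≤ a ∧ |x 2| ≤ R} ≤ ENNReal.ofReal (8 * a ^ 2 * R) := by
  set b : Fin 3 → ℝ := ![a, a, R] with hb
  have h1 : {x : Space | |x 0| ≤ a ∧ |x 1| ≤ a ∧ |x 2| ≤ R} ⊆
      (MeasurableEquiv.toLp 2 (Fin 3 → ℝ)).symm ⁻¹' (Set.Icc (-b) b) := by
    rintro x ⟨h0, h1, h2⟩
    simp only [Set.mem_preimage, Set.mem_Icc, Pi.le_def, Fin.forall_fin_succ]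
    simp [hb, abs_le.1 h0, abs_le.1 h1, abs_le.1 h2]
  refine (measure_mono h1).trans ?_
  rw [(EuclideanSpace.volume_preserving_symm_measurableEquiv_toLp (Fin 3)).measure_preimage
    measurableSet_Icc.nullMeasurableSet, Real.volume_Icc_pi, Fin.prod_univ_three,
    ← ENNReal.ofReal_mul (by simp [hb]; linarith), ← ENNReal.ofReal_mul (by simp [hb]; positivity)]
  refine ENNReal.ofReal_le_ofReal (le_of_eq ?_)
  simp [hb]
  ring

/-- The average of the first `n` cutoffs, whose Dirichlet energy on bounded sets is `O(1/n)`. -/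
def avgCut (n : ℕ) (x : Space) : ℝ := (n : ℝ)⁻¹ * ∑ j ∈ Finset.range n, ringCut j x

theorem contDiff_avgCut (n : ℕ) {m : ℕ∞} : ContDiff ℝ m (avgCut n) :=
  contDiff_const.mul (ContDiff.sum fun j _ => contDiff_ringCut j)

theorem ringCut_mem_Icc (j : ℕ) (x : Space) : ringCut j x ∈ Set.Icc (0 : ℝ) 1 :=
  ⟨Real.smoothTransition.nonneg _, Real.smoothTransition.le_one _⟩

theorem avgCut_mem_Icc (n : ℕ) (x : Space) : avgCut n x ∈ Set.Icc (0 : ℝ) 1 := by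
  refine ⟨mul_nonneg (by positivity) (Finset.sum_nonneg fun j _ => (ringCut_mem_Icc j x).1), ?_⟩
  rcases Nat.eq_zero_or_pos n with rfl | hn
  · simp [avgCut]
  · have h1 : ∑ j ∈ Finset.range n, ringCut j x ≤ n := by
      have := Finset.sum_le_sum fun j (_ : j ∈ Finset.range n) => (ringCut_mem_Icc j x).2
      simpa using this
    have hn' : (0 : ℝ) < n := by exact_mod_cast hn
    rw [avgCut, inv_mul_le_iff₀ hn', mul_one]
    exact h1

theorem avgCut_eq_zero {n : ℕ} {x : Space} (h : rsq x ≤ (4 ^ n : ℝ)⁻¹) : avgCut n x = 0 := by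
  rw [avgCut, Finset.sum_eq_zero, mul_zero]
  intro j hj
  refine step_of_le ?_
  have h1 : (4 : ℝ) ^ j ≤ 4 ^ n := pow_le_pow_right₀ (by norm_num) (Finset.mem_range.1 hj).le
  calc (4 : ℝ) ^ j * rsq x ≤ 4 ^ n * (4 ^ n)⁻¹ := by
        have := rsq_nonneg x
        gcongr
    _ = 1 := mul_inv_cancel₀ (by positivity)

/-- Off the axis all but finitely many of the cutoffs equal one, so their Cesàro means tend to one.
-/
theorem tendsto_avgCut {x : Space} (hx : rsq x ≠ 0) :
    Tendsto (fun n => avgCut n x) atTop (𝓝 1) := by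
  have hpos : 0 < rsq x := lt_of_le_of_ne (rsq_nonneg x) hx.symm
  refine Tendsto.cesaro (u := fun j => ringCut j x) ?_
  have h1 : Tendsto (fun j : ℕ => (4 : ℝ) ^ j * rsq x) atTop atTop :=
    (tendsto_pow_atTop_atTop_of_one_lt (by norm_num)).atTop_mul_const hpos
  refine tendsto_const_nhds.congr' ?_
  filter_upwards [h1.eventually_ge_atTop 2] with j hj
  exact (step_of_ge hj).symm

theorem grad_avgCut (n : ℕ) (x : Space) :
    grad (avgCut n) x = (n : ℝ)⁻¹ • ∑ j ∈ Finset.range n, grad (ringCut j) x := by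
  ext i
  have h1 : HasFDerivAt (avgCut n) ((n : ℝ)⁻¹ • ∑ j ∈ Finset.range n, fderiv ℝ (ringCut j) x) x := by
    refine HasFDerivAt.const_mul ?_ _
    refine HasFDerivAt.fun_sum fun j _ => ?_
    exact (((contDiff_ringCut j (n := 1)).differentiable (by simp)) x).hasFDerivAt
  simp only [grad, h1.fderiv]
  simp [Finset.sum_apply, WithLp.ofLp_sum]

theorem grad_ringCut_eq_zero {j : ℕ} {x : Space} (h : 4 ^ j * rsq x < 1 ∨ 2 < 4 ^ j * rsq x) :
    grad (ringCut j) x = 0 := by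
  have := norm_grad_ringCut_sq j x
  rw [deriv_step_eq_zero h] at this
  simpa using this

/-- The gradients live on the shells `1 ≤ 4 ^ j r² ≤ 2`, which are disjoint, so at most one term is
nonzero at `x`. Without cross terms the energy of the sum grows like `n`, not like `n²`. -/
theorem norm_sum_grad_ringCut_sq (n : ℕ) (x : Space) :
    ‖∑ j ∈ Finset.range n, grad (ringCut j) x‖ ^ 2 ≤
      ∑ j ∈ Finset.range n, ‖grad (ringCut j) x‖ ^ 2 := by
  by_cases h : ∃ i ∈ Finset.range n, grad (ringCut i) x ≠ 0
  · obtain ⟨i, hi, hgi⟩ := h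
    have hr : 1 ≤ 4 ^ i * rsq x ∧ 4 ^ i * rsq x ≤ 2 := by
      by_contra hcon
      rw [not_and_or, not_le, not_le] at hcon
      exact hgi (grad_ringCut_eq_zero hcon)
    have hz : ∀ j ∈ Finset.range n, j ≠ i → grad (ringCut j) x = 0 := by
      intro j _ hj
      refine grad_ringCut_eq_zero ?_
      have hx := rsq_nonneg x
      rcases lt_or_gt_of_ne hj with h | h
      · left
        have h1 : (4 : ℝ) ^ (j + 1) ≤ 4 ^ i := pow_le_pow_right₀ (by norm_num) h
        rw [pow_succ] at h1
        nlinarith [mul_le_mul_of_nonneg_right h1 hx]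
      · right
        have h1 : (4 : ℝ) ^ (i + 1) ≤ 4 ^ j := pow_le_pow_right₀ (by norm_num) h
        rw [pow_succ] at h1
        nlinarith [mul_le_mul_of_nonneg_right h1 hx]
    rw [Finset.sum_eq_single_of_mem i hi hz]
    exact Finset.single_le_sum (f := fun j => ‖grad (ringCut j) x‖ ^ 2)
      (fun _ _ => sq_nonneg _) hi
  · push Not at h
    rw [Finset.sum_eq_zero h]
    simpa using Finset.sum_nonneg fun j (_ : j ∈ Finset.range n) => sq_nonneg ‖grad (ringCut j) x‖

theorem grad_mul {f g : Space → ℝ} (hf : ContDiff ℝ 1 f) (hg : ContDiff ℝ 1 g) (x : Space) :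
    grad (fun x => f x * g x) x = g x • grad f x + f x • grad g x := by
  ext i
  have h := (((hf.differentiable one_ne_zero) x).hasFDerivAt).mul
    (((hg.differentiable one_ne_zero) x).hasFDerivAt)
  have h2 : HasFDerivAt (fun x => f x * g x) _ x := h
  simp only [grad, h2.fderiv]
  simp
  ring

/-- The Dirichlet energy of the cutoffs on bounded sets tends to zero. -/
theorem tendsto_lintegral_mul_grad_avgCut {V : Space → ℝ} {k R : ℝ} (hk : ∀ x, V x ∈ Set.Icc 0 k)
    (hR : ∀ x, R < ‖x‖ → V x = 0) :
    Tendsto (fun n => ∫⁻ x, ‖V x • grad (avgCut n) x‖ₑ ^ 2) atTop (𝓝 0) := by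
  obtain ⟨M, hM0, hM⟩ := exists_deriv_step_le
  set R' := max R 0 with hR'
  set B : ℕ → Set Space := fun j => {x | |x 0| ≤ 2 * 2⁻¹ ^ j ∧ |x 1| ≤ 2 * 2⁻¹ ^ j ∧ |x 2| ≤ R'}
    with hB
  have hBm : ∀ j, MeasurableSet (B j) := by
    intro j
    refine IsClosed.measurableSet ?_
    have hc : ∀ i : Fin 3, Continuous fun x : Space => |x i| := fun i => by fun_prop
    exact (isClosed_le (hc 0) continuous_const).inter
      ((isClosed_le (hc 1) continuous_const).inter (isClosed_le (hc 2) continuous_const))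
  have hpt : ∀ j x, V x ^ 2 * ‖grad (ringCut j) x‖ ^ 2 ≤
      (B j).indicator (fun _ => k ^ 2 * (M ^ 2 * (8 * 4 ^ j))) x := by
    intro j x
    by_cases h0 : V x = 0 ∨ grad (ringCut j) x = 0
    · have : V x ^ 2 * ‖grad (ringCut j) x‖ ^ 2 = 0 := by
        rcases h0 with h | h <;> simp [h]
      rw [this]
      exact Set.indicator_nonneg (fun _ _ => by positivity) x
    · rw [not_or] at h0
      have hxR : ‖x‖ ≤ R' := by
        by_contra hcon
        exact h0.1 (hR x ((le_max_left _ _).trans_lt (not_le.1 hcon)))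
      have hr : 4 ^ j * rsq x ≤ 2 := by
        by_contra hcon
        exact h0.2 (grad_ringCut_eq_zero (Or.inr (not_le.1 hcon)))
      have h4 : (4 : ℝ) ^ j * (2⁻¹ ^ j) ^ 2 = 1 := by
        rw [← pow_mul, mul_comm j, pow_mul, ← mul_pow]; norm_num
      have hb : rsq x ≤ (2 * 2⁻¹ ^ j) ^ 2 := by
        have h5 : (4 : ℝ) ^ j * rsq x ≤ 4 ^ j * (2 * 2⁻¹ ^ j) ^ 2 := by
          rw [mul_pow, mul_left_comm, h4]; linarith
        exact le_of_mul_le_mul_left h5 (by positivity)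
      have hmem : x ∈ B j := by
        have hp : (0 : ℝ) ≤ 2 * 2⁻¹ ^ j := by positivity
        refine ⟨abs_le_of_sq_le_sq ?_ hp, abs_le_of_sq_le_sq ?_ hp, ?_⟩
        · have := sq_nonneg (x 1); unfold rsq at hb; linarith
        · have := sq_nonneg (x 0); unfold rsq at hb; linarith
        · exact (PiLp.norm_apply_le x 2).trans hxR
      rw [Set.indicator_of_mem hmem, norm_grad_ringCut_sq]
      have h1 : V x ^ 2 ≤ k ^ 2 := pow_le_pow_left₀ (hk x).1 (hk x).2 2
      have h2 : deriv step (4 ^ j * rsq x) ^ 2 ≤ M ^ 2 := sq_le_sq' (abs_le.1 (hM _)).1 (abs_le.1 (hM _)).2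
      have h3 : (4 : ℝ) * 16 ^ j * rsq x ≤ 8 * 4 ^ j := by
        have h16 : (16 : ℝ) ^ j = 4 ^ j * 4 ^ j := by rw [← mul_pow]; norm_num
        rw [h16]
        have : (0 : ℝ) < 4 ^ j := by positivity
        nlinarith
      have h5 := rsq_nonneg x
      gcongr
  -- The squared gradient of the cutoff is at most `8 M² 4 ^ j`, on a box of volume at most `32 ·
  -- 4⁻ʲ R'`; the powers of four cancel because the space across the axis is two-dimensional.
  set K : ℝ := 256 * k ^ 2 * M ^ 2 * R' with hK
  have hBint : ∀ j, ∫⁻ x, ENNReal.ofReal ((B j).indicator (fun _ => k ^ 2 * (M ^ 2 * (8 * 4 ^ j))) x)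
      ≤ ENNReal.ofReal K := by
    intro j
    have h1 : ∀ x, ENNReal.ofReal ((B j).indicator (fun _ => k ^ 2 * (M ^ 2 * (8 * 4 ^ j))) x) =
        (B j).indicator (fun _ => ENNReal.ofReal (k ^ 2 * (M ^ 2 * (8 * 4 ^ j)))) x := by
      intro x
      by_cases hx : x ∈ B j <;> simp [hx]
    simp_rw [h1]
    rw [lintegral_indicator_const (hBm j)]
    calc ENNReal.ofReal (k ^ 2 * (M ^ 2 * (8 * 4 ^ j))) * volume (B j)
        ≤ ENNReal.ofReal (k ^ 2 * (M ^ 2 * (8 * 4 ^ j))) *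
            ENNReal.ofReal (8 * (2 * 2⁻¹ ^ j) ^ 2 * R') := by
          gcongr
          exact volume_box_le (by positivity)
      _ = ENNReal.ofReal K := by
          rw [← ENNReal.ofReal_mul (by positivity)]
          congr 1
          have h4 : (4 : ℝ) ^ j * (2⁻¹ ^ j) ^ 2 = 1 := by
            rw [← pow_mul, mul_comm j, pow_mul, ← mul_pow]; norm_num
          rw [hK, mul_pow]
          linear_combination (256 * k ^ 2 * M ^ 2 * R') * h4
  -- The factor `n⁻²` from the average meets `n` shells of energy at most `K` each.
  have hmain : ∀ n : ℕ, ∫⁻ x, ‖V x • grad (avgCut n) x‖ₑ ^ 2 ≤ ENNReal.ofReal ((n : ℝ)⁻¹ * K) := by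
    intro n
    have h1 : ∀ x, ‖V x • grad (avgCut n) x‖ₑ ^ 2 ≤ ENNReal.ofReal ((n : ℝ)⁻¹ ^ 2) *
        ∑ j ∈ Finset.range n,
          ENNReal.ofReal ((B j).indicator (fun _ => k ^ 2 * (M ^ 2 * (8 * 4 ^ j))) x) := by
      intro x
      rw [← ENNReal.ofReal_sum_of_nonneg fun j _ => Set.indicator_nonneg (fun _ _ => by positivity) x,
        ← ENNReal.ofReal_mul (by positivity), ← ofReal_norm_sq]
      refine ENNReal.ofReal_le_ofReal ?_
      rw [grad_avgCut, norm_smul, norm_smul, mul_pow, mul_pow, Real.norm_eq_abs, Real.norm_eq_abs,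
        sq_abs, sq_abs, mul_left_comm]
      gcongr
      calc V x ^ 2 * ‖∑ j ∈ Finset.range n, grad (ringCut j) x‖ ^ 2
          ≤ V x ^ 2 * ∑ j ∈ Finset.range n, ‖grad (ringCut j) x‖ ^ 2 := by
            gcongr
            exact norm_sum_grad_ringCut_sq n x
        _ ≤ _ := by
            rw [Finset.mul_sum]
            exact Finset.sum_le_sum fun j _ => hpt j x
    refine (lintegral_mono h1).trans ?_
    rw [lintegral_const_mul' _ _ ENNReal.ofReal_ne_top, lintegral_finsetSum _ fun j _ =>
      (measurable_const.indicator (hBm j)).ennreal_ofReal]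
    calc ENNReal.ofReal ((n : ℝ)⁻¹ ^ 2) * ∑ j ∈ Finset.range n, ∫⁻ x,
          ENNReal.ofReal ((B j).indicator (fun _ => k ^ 2 * (M ^ 2 * (8 * 4 ^ j))) x)
        ≤ ENNReal.ofReal ((n : ℝ)⁻¹ ^ 2) * ∑ j ∈ Finset.range n, ENNReal.ofReal K := by
          gcongr with j _
          exact hBint j
      _ = ENNReal.ofReal ((n : ℝ)⁻¹ * K) := by
          have hK0 : 0 ≤ K := by positivity
          rw [Finset.sum_const, Finset.card_range, ← ENNReal.ofReal_nsmul,
            ← ENNReal.ofReal_mul (by positivity), nsmul_eq_mul]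
          congr 1
          rcases Nat.eq_zero_or_pos n with rfl | hn
          · simp
          · have : (n : ℝ) ≠ 0 := by positivity
            field_simp
  refine tendsto_of_tendsto_of_tendsto_of_le_of_le tendsto_const_nhds ?_ (fun _ => zero_le) hmain
  have h1 := (tendsto_inv_atTop_nhds_zero_nat (𝕜 := ℝ)).mul_const K
  simpa using ENNReal.tendsto_ofReal h1

/-- Smooth radial functions are approximated by functions vanishing near the axis. -/
theorem exists_isCylTest {F : ℝ → ℝ} (hF : Tame F) {V : Space → ℝ}
    (hV : ContDiff ℝ ((⊤ : ℕ∞) : WithTop ℕ∞) V) (hVc : HasCompactSupport V) {k : ℝ}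
    (hk : ∀ x, V x ∈ Set.Icc 0 k) (hrad : ∀ x y, ‖x‖ = ‖y‖ → V x = V y) {ε : ℝ} (hε : 0 < ε) :
    ∃ U, IsCylTest U ∧ (∀ x, 0 ≤ U x) ∧
      ∫⁻ x, ‖grad U x‖ₑ ^ 2 ≤ (∫⁻ x, ‖grad V x‖ₑ ^ 2) + ENNReal.ofReal ε ∧
      ∫ x, F (U x) ≤ (∫ x, F (V x)) + ε ∧ (∫ x, V x ^ 2) - ε ≤ ∫ x, U x ^ 2 := by
  have hV1 : ContDiff ℝ 1 V := hV.of_le (by simp)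
  set U : ℕ → Space → ℝ := fun n x => V x * avgCut n x with hU
  have hUs : ∀ n, ContDiff ℝ ((⊤ : ℕ∞) : WithTop ℕ∞) (U n) := fun n => hV.mul (contDiff_avgCut n)
  have hUc : ∀ n, HasCompactSupport (U n) := fun n => hVc.mul_right
  have hU0 : ∀ n x, 0 ≤ U n x := fun n x => mul_nonneg (hk x).1 (avgCut_mem_Icc n x).1
  have hUle : ∀ n x, U n x ≤ V x := fun n x =>
    mul_le_of_le_one_right (hk x).1 (avgCut_mem_Icc n x).2
  have hcyl : ∀ n, IsCylTest (U n) := by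
    intro n
    refine ⟨hUs n, hUc n, ?_, ?_⟩
    · have h1 : tsupport (U n) ⊆ {x | (4 ^ n : ℝ)⁻¹ ≤ rsq x} := by
        refine closure_minimal (fun x hx => ?_)
          (isClosed_le continuous_const (contDiff_rsq (n := 0)).continuous)
        by_contra hcon
        simp only [Set.mem_ofPred_eq, not_le] at hcon
        exact hx (by simp [hU, avgCut_eq_zero hcon.le])
      refine h1.trans fun x hx => ?_
      have : (0 : ℝ) < (4 ^ n)⁻¹ := by positivity
      exact (this.trans_le hx).ne'
    · intro x x' h1 h2
      have hn : ‖x‖ = ‖x'‖ := by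
        rw [← sq_eq_sq₀ (norm_nonneg _) (norm_nonneg _), norm_sq_eq_rsq, norm_sq_eq_rsq, h1, h2]
      simp only [hU, hrad x x' hn, avgCut, ringCut, h1]
  have hV2 : MemLp V 2 volume := hV.continuous.memLp_of_hasCompactSupport hVc
  have hU2 : ∀ n, MemLp (U n) 2 volume := fun n =>
    (hUs n).continuous.memLp_of_hasCompactSupport (hUc n)
  have hlim : Tendsto (fun n => ∫⁻ x, ‖U n x - V x‖ₑ ^ 2) atTop (𝓝 (∫⁻ x : Space, 0)) := by
    refine tendsto_lintegral_of_dominated_convergence (fun x => ‖V x‖ₑ ^ 2) (fun n => ?_)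
      (fun n => Eventually.of_forall fun x => ?_) (lintegral_enorm_sq_lt_top hV2).ne ?_
    · exact ((hUs n).continuous.sub hV.continuous).measurable.enorm.pow_const 2
    · dsimp only
      gcongr 1
      rw [enorm_le_iff_norm_le, Real.norm_eq_abs, Real.norm_of_nonneg (hk x).1, abs_le]
      have h1 := hU0 n x
      have h2 := hUle n x
      constructor <;> linarith [(hk x).1]
    · filter_upwards [ae_rsq_ne_zero] with x hx
      have h1 : Tendsto (fun n => U n x - V x) atTop (𝓝 0) := by
        have := ((tendsto_avgCut hx).const_mul (V x)).sub_const (V x)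
        simpa using this
      have h2 := ((ENNReal.continuous_pow 2).tendsto _).comp h1.enorm
      simpa [Function.comp_def] using h2
  rw [lintegral_zero] at hlim
  have hap := hF.exists_approx hk hV2 (fun n x => ⟨hU0 n x, (hUle n x).trans (hk x).2⟩) hU2 hlim hε
  obtain ⟨R, hR⟩ := hVc.isCompact.isBounded.subset_closedBall (0 : Space)
  have hgr := tendsto_eLpNorm_two_iff.2 (tendsto_lintegral_mul_grad_avgCut (R := R) hk fun x hx => by
    refine image_eq_zero_of_notMem_tsupport fun hmem => ?_
    have := hR hmem
    rw [mem_closedBall_zero_iff] at this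
    linarith)
  have hgV : MemLp (grad V) 2 volume :=
    (continuous_grad hV1).memLp_of_hasCompactSupport (hasCompactSupport_grad hVc)
  -- Product rule and Minkowski: the first term is dominated by the gradient of `V` since the cutoff
  -- is at most one, and the second tends to zero.
  have hbound : ∀ n, ∫⁻ x, ‖grad (U n) x‖ₑ ^ 2 ≤
      (eLpNorm (grad V) 2 volume + eLpNorm (fun x => V x • grad (avgCut n) x) 2 volume) ^ 2 := by
    intro n
    have hc1 : ContDiff ℝ 1 (avgCut n) := contDiff_avgCut n (m := 1)
    rw [lintegral_enorm_sq_eq]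
    gcongr
    have h1 : grad (U n) = (fun x => avgCut n x • grad V x) + fun x => V x • grad (avgCut n) x := by
      ext1 x
      exact grad_mul hV1 hc1 x
    rw [h1]
    refine (eLpNorm_add_le ?_ ?_ one_le_two).trans ?_
    · exact (hc1.continuous.smul (continuous_grad hV1)).aestronglyMeasurable
    · exact (hV.continuous.smul (continuous_grad hc1)).aestronglyMeasurable
    · gcongr
      refine eLpNorm_mono fun x => ?_
      rw [norm_smul, Real.norm_of_nonneg (avgCut_mem_Icc n x).1]
      exact mul_le_of_le_one_left (norm_nonneg _) (avgCut_mem_Icc n x).2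
  have hlim2 : Tendsto (fun n => (eLpNorm (grad V) 2 volume +
      eLpNorm (fun x => V x • grad (avgCut n) x) 2 volume) ^ 2) atTop
      (𝓝 (∫⁻ x, ‖grad V x‖ₑ ^ 2)) := by
    rw [lintegral_enorm_sq_eq]
    have h1 := hgr.const_add (eLpNorm (grad V) 2 volume)
    rw [add_zero] at h1
    exact ((ENNReal.continuous_pow 2).tendsto _).comp h1
  have hev : ∀ᶠ n in atTop, (eLpNorm (grad V) 2 volume +
      eLpNorm (fun x => V x • grad (avgCut n) x) 2 volume) ^ 2 ≤
        (∫⁻ x, ‖grad V x‖ₑ ^ 2) + ENNReal.ofReal ε := by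
    refine hlim2.eventually_le_const ?_
    exact ENNReal.lt_add_right (lintegral_enorm_sq_lt_top hgV).ne (by simpa using hε)
  obtain ⟨n, h1, h2⟩ := (hev.and hap).exists
  exact ⟨U n, hcyl n, hU0 n, (hbound n).trans h1, h2.1, h2.2⟩

/-! ### The phase of a vortex -/

/-- The phase factor `exp (i (ℓ θ - ω t))`. -/
def phase (ω : ℝ) (ℓ : ℤ) (t : ℝ) (x : Space) : ℂ :=
  Complex.exp (Complex.I * (((ℓ : ℝ) * theta x - ω * t : ℝ) : ℂ))

theorem norm_phase (ω : ℝ) (ℓ : ℤ) (t : ℝ) (x : Space) : ‖phase ω ℓ t x‖ = 1 := by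
  rw [phase, mul_comm, Complex.norm_exp_ofReal_mul_I]

theorem measurable_theta : Measurable theta := by
  unfold theta
  exact Complex.measurable_im.comp (Complex.measurable_log.comp (by fun_prop))

theorem measurable_phase (ω : ℝ) (ℓ : ℤ) (t : ℝ) : Measurable (phase ω ℓ t) := by
  have := measurable_theta
  unfold phase
  fun_prop

/-- The horizontal direction `(y₁ + i y₂) / |y|`. -/
def unitDir (x : Space) : ℂ := ((x 0 : ℂ) + Complex.I * (x 1 : ℂ)) * (((√(rsq x))⁻¹ : ℝ) : ℂ)

theorem sqrt_rsq_ne_zero {x : Space} (hx : rsq x ≠ 0) : √(rsq x) ≠ 0 :=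
  (Real.sqrt_pos.2 (lt_of_le_of_ne (rsq_nonneg x) hx.symm)).ne'

theorem exp_theta {x : Space} (hx : rsq x ≠ 0) :
    Complex.exp (Complex.I * (theta x : ℂ)) = unitDir x := by
  have hn : ‖(x 0 : ℂ) + Complex.I * (x 1 : ℂ)‖ = √(rsq x) := by
    rw [mul_comm, Complex.norm_add_mul_I, rsq]
  have h := Complex.norm_mul_exp_arg_mul_I ((x 0 : ℂ) + Complex.I * (x 1 : ℂ))
  rw [hn] at h
  have hs : ((√(rsq x) : ℝ) : ℂ) ≠ 0 := by exact_mod_cast sqrt_rsq_ne_zero hx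
  rw [unitDir, theta, Complex.log_im, mul_comm Complex.I, Complex.ofReal_inv]
  conv_rhs => rw [← h]
  field_simp

theorem unitDir_ne_zero {x : Space} (hx : rsq x ≠ 0) : unitDir x ≠ 0 := by
  rw [← exp_theta hx]
  exact Complex.exp_ne_zero _

/-- Because `ℓ` is an integer, the branch cut of the logarithm disappears: what remains is a power
of a direction field that is smooth off the axis. -/
theorem phase_eq {x : Space} (hx : rsq x ≠ 0) (ω : ℝ) (ℓ : ℤ) (t : ℝ) :
    phase ω ℓ t x = Complex.exp (-(Complex.I * (ω * t : ℝ))) * unitDir x ^ ℓ := by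
  rw [phase, ← exp_theta hx, ← Complex.exp_int_mul, ← Complex.exp_add]
  congr 1
  push_cast
  ring

/-- The gradient of the angular variable. -/
def gradTheta (x : Space) : Space := !₂[-x 1 / rsq x, x 0 / rsq x, 0]

theorem norm_gradTheta_sq (x : Space) : ‖gradTheta x‖ ^ 2 = 1 / rsq x := by
  rw [EuclideanSpace.norm_sq_eq, Fin.sum_univ_three]
  have h2 : gradTheta x 2 = 0 := rfl
  have h0 : gradTheta x 0 = -x 1 / rsq x := rfl
  have h1 : gradTheta x 1 = x 0 / rsq x := rfl
  simp only [h0, h1, h2, Real.norm_eq_abs, sq_abs]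
  by_cases h : rsq x = 0
  · simp [h]
  · field_simp
    rw [rsq]; ring

/-- The real and imaginary parts of the rule that the derivative of `y / |y|` is `i (y / |y|) dθ`,
at `y = a + i b` in the direction `v + i w`, with `s = |y|`. -/
theorem radial_derivative_identity {a b v w s R : ℝ} (hs : s ≠ 0) (h : s * s = a ^ 2 + b ^ 2)
    (hR : s * s = R) :
    a * (-(s ^ 2)⁻¹ * (1 / (2 * s) * (2 * (a * v + b * w)))) + s⁻¹ * v =
        -(b * s⁻¹ * ((a * w - b * v) / R)) ∧
      b * (-(s ^ 2)⁻¹ * (1 / (2 * s) * (2 * (a * v + b * w)))) + s⁻¹ * w =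
        a * s⁻¹ * ((a * w - b * v) / R) := by
  subst hR
  constructor
  · field_simp
    linear_combination v * h
  · field_simp
    linear_combination w * h

theorem hasFDerivAt_unitDir {x : Space} (hx : rsq x ≠ 0) :
    ∃ T : Space →L[ℝ] ℂ, HasFDerivAt unitDir T x ∧
      ∀ v, T v = Complex.I * unitDir x * ((inner ℝ (gradTheta x) v : ℝ) : ℂ) := by
  have h0 : HasFDerivAt (fun x : Space => (x 0 : ℂ)) _ x :=
    Complex.ofRealCLM.hasFDerivAt.comp x (hasFDerivAt_coord 0 x)
  have h1 : HasFDerivAt (fun x : Space => (x 1 : ℂ)) _ x :=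
    Complex.ofRealCLM.hasFDerivAt.comp x (hasFDerivAt_coord 1 x)
  have hr : HasFDerivAt rsq (fderiv ℝ rsq x) x :=
    (((contDiff_rsq (n := 1)).differentiable one_ne_zero) x).hasFDerivAt
  have hs := (Real.hasDerivAt_sqrt hx).comp_hasFDerivAt x hr
  have hi := (hasDerivAt_inv (sqrt_rsq_ne_zero hx)).comp_hasFDerivAt x hs
  have hi' : HasFDerivAt (fun x : Space => (((√(rsq x))⁻¹ : ℝ) : ℂ)) _ x :=
    Complex.ofRealCLM.hasFDerivAt.comp x hi
  have hT : HasFDerivAt unitDir _ x := (h0.add (h1.const_mul Complex.I)).mul hi'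
  refine ⟨_, hT, fun v => ?_⟩
  have hsq : √(rsq x) * √(rsq x) = rsq x := Real.mul_self_sqrt (rsq_nonneg x)
  have hs0 := sqrt_rsq_ne_zero hx
  have hin : inner ℝ (gradTheta x) v = (x 0 * v 1 - x 1 * v 0) / rsq x := by
    rw [PiLp.inner_apply, Fin.sum_univ_three]
    simp [gradTheta]
    ring
  rw [hin, unitDir]
  set D : ℝ := -(√(rsq x) ^ 2)⁻¹ * (1 / (2 * √(rsq x)) * (2 * (x 0 * v 0 + x 1 * v 1))) with hD
  have hTv : ((((x 0 : ℂ) + Complex.I * (x 1 : ℂ)) • (Complex.ofRealCLM ∘SL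
      (-(√(rsq x) ^ 2)⁻¹ • (1 / (2 * √(rsq x))) • fderiv ℝ rsq x)) +
      (((√(rsq x))⁻¹ : ℝ) : ℂ) • (Complex.ofRealCLM ∘SL EuclideanSpace.proj 0 +
        Complex.I • Complex.ofRealCLM ∘SL EuclideanSpace.proj 1) : Space →L[ℝ] ℂ)) v =
      ((x 0 : ℂ) + Complex.I * (x 1 : ℂ)) * (D : ℂ) +
        (((√(rsq x))⁻¹ : ℝ) : ℂ) * ((v 0 : ℂ) + Complex.I * (v 1 : ℂ)) := by
    simp only [_root_.add_apply, _root_.smul_apply,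
      ContinuousLinearMap.comp_apply, fderiv_rsq, smul_eq_mul, hD]
    rfl
  refine Eq.trans hTv ?_
  have hA : x 0 * D + (√(rsq x))⁻¹ * v 0 = -(x 1 * (√(rsq x))⁻¹ * ((x 0 * v 1 - x 1 * v 0) / rsq x)) := by
    rw [hD]
    exact (radial_derivative_identity hs0 hsq hsq).1
  have hB : x 1 * D + (√(rsq x))⁻¹ * v 1 = x 0 * (√(rsq x))⁻¹ * ((x 0 * v 1 - x 1 * v 0) / rsq x) := by
    rw [hD]
    exact (radial_derivative_identity hs0 hsq hsq).2
  generalize (x 0 * v 1 - x 1 * v 0) / rsq x = q at hA hB ⊢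
  generalize (√(rsq x))⁻¹ = r at hA hB ⊢
  have hA' := congrArg (fun a : ℝ => (a : ℂ)) hA
  have hB' := congrArg (fun a : ℝ => (a : ℂ)) hB
  push_cast at hA' hB'
  linear_combination hA' + Complex.I * hB' + (-(x 1 : ℂ) * r * q) * Complex.I_sq

theorem contDiffAt_unitDir {x : Space} (hx : rsq x ≠ 0) {n : WithTop ℕ∞} :
    ContDiffAt ℝ n unitDir x := by
  have h0 : ∀ i : Fin 3, ContDiffAt ℝ n (fun x : Space => (x i : ℂ)) x := fun i =>
    Complex.ofRealCLM.contDiff.contDiffAt.comp x (contDiff_apply_space i).contDiffAt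
  have hs : ContDiffAt ℝ n (fun x => √(rsq x)) x := contDiff_rsq.contDiffAt.sqrt hx
  have hi : ContDiffAt ℝ n (fun x => (((√(rsq x))⁻¹ : ℝ) : ℂ)) x :=
    Complex.ofRealCLM.contDiff.contDiffAt.comp x (hs.inv (sqrt_rsq_ne_zero hx))
  exact ((h0 0).add (contDiffAt_const.mul (h0 1))).mul hi

theorem eventually_rsq_ne_zero {x : Space} (hx : rsq x ≠ 0) : ∀ᶠ y in 𝓝 x, rsq y ≠ 0 :=
  (contDiff_rsq (n := 0)).continuous.continuousAt.eventually_ne hx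

theorem contDiffAt_phase {x : Space} (hx : rsq x ≠ 0) (ω : ℝ) (ℓ : ℤ) (t : ℝ) :
    ContDiffAt ℝ 1 (phase ω ℓ t) x := by
  have h1 : phase ω ℓ t =ᶠ[𝓝 x] fun y =>
      Complex.exp (-(Complex.I * (ω * t : ℝ))) * unitDir y ^ ℓ := by
    filter_upwards [eventually_rsq_ne_zero hx] with y hy using phase_eq hy ω ℓ t
  refine ContDiffAt.congr_of_eventuallyEq ?_ h1
  refine contDiffAt_const.mul ?_
  have h2 : ContDiffAt ℂ 1 (fun z : ℂ => z ^ ℓ) (unitDir x) :=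
    ((analyticAt_id (𝕜 := ℂ)).zpow (unitDir_ne_zero hx)).contDiffAt
  exact (h2.restrict_scalars ℝ).comp x (contDiffAt_unitDir hx)

theorem fderiv_phase {x : Space} (hx : rsq x ≠ 0) (ω : ℝ) (ℓ : ℤ) (t : ℝ) (v : Space) :
    fderiv ℝ (phase ω ℓ t) x v =
      phase ω ℓ t x * (Complex.I * ((ℓ * inner ℝ (gradTheta x) v : ℝ) : ℂ)) := by
  have h1 : phase ω ℓ t =ᶠ[𝓝 x] fun y =>
      Complex.exp (-(Complex.I * (ω * t : ℝ))) * unitDir y ^ ℓ := by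
    filter_upwards [eventually_rsq_ne_zero hx] with y hy using phase_eq hy ω ℓ t
  obtain ⟨T, hT, hTv⟩ := hasFDerivAt_unitDir hx
  have hz := unitDir_ne_zero hx
  have h2 : HasDerivAt (fun z : ℂ => z ^ ℓ) (ℓ * unitDir x ^ (ℓ - 1)) (unitDir x) :=
    hasDerivAt_zpow ℓ _ (Or.inl hz)
  have h3 := (h2.comp_hasFDerivAt x hT).const_mul (Complex.exp (-(Complex.I * (ω * t : ℝ))))
  rw [h1.fderiv_eq]
  have h4 : HasFDerivAt (fun y => Complex.exp (-(Complex.I * (ω * t : ℝ))) * unitDir y ^ ℓ) _ x := h3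
  rw [h4.fderiv, phase_eq hx]
  simp only [_root_.smul_apply, hTv, smul_eq_mul]
  rw [zpow_sub_one₀ hz]
  push_cast
  field_simp

/-! ### Vortices -/

/-- The gradient of `u exp (i (ℓ θ - ω t))` in terms of the gradient `g` of `u`. -/
def vortexGrad (u : Space → ℝ) (g : Space → Space) (ω : ℝ) (ℓ : ℤ) (t : ℝ) (x : Space) :
    EuclideanSpace ℂ (Fin 3) :=
  WithLp.toLp 2 fun i =>
    phase ω ℓ t x * ((g x i : ℂ) + Complex.I * ((ℓ * (u x * gradTheta x i) : ℝ) : ℂ))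

theorem vortex_eq (u : Space → ℝ) (ω : ℝ) (ℓ : ℤ) (t : ℝ) :
    vortex u ω ℓ t = fun x => (u x : ℂ) * phase ω ℓ t x := rfl

theorem norm_vortex (u : Space → ℝ) (ω : ℝ) (ℓ : ℤ) (t : ℝ) (x : Space) :
    ‖vortex u ω ℓ t x‖ = |u x| := by
  rw [vortex_eq, norm_mul, norm_phase, mul_one, Complex.norm_real, Real.norm_eq_abs]

/-- Apart from a unimodular factor, `g` is the real part and `ℓ u ∇θ` the imaginary part, so there
is no cross term. On the axis, division by zero makes both `gradTheta` and the centrifugal term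
zero. -/
theorem norm_vortexGrad_sq (u : Space → ℝ) (g : Space → Space) (ω : ℝ) (ℓ : ℤ) (t : ℝ) (x : Space) :
    ‖vortexGrad u g ω ℓ t x‖ ^ 2 = ‖g x‖ ^ 2 + (ℓ : ℝ) ^ 2 / rsq x * u x ^ 2 := by
  have h1 : (ℓ : ℝ) ^ 2 / rsq x * u x ^ 2 = ∑ i, (ℓ * (u x * gradTheta x i)) ^ 2 := by
    have h2 := norm_gradTheta_sq x
    rw [EuclideanSpace.norm_sq_eq] at h2
    simp only [Real.norm_eq_abs, sq_abs] at h2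
    rw [div_eq_mul_one_div, ← h2, Finset.mul_sum, Finset.sum_mul]
    exact Finset.sum_congr rfl fun i _ => by ring
  rw [h1, EuclideanSpace.norm_sq_eq, EuclideanSpace.norm_sq_eq, ← Finset.sum_add_distrib]
  refine Finset.sum_congr rfl fun i _ => ?_
  simp only [vortexGrad]
  rw [norm_mul, norm_phase, one_mul, mul_comm Complex.I, Complex.norm_add_mul_I,
    Real.sq_sqrt (by positivity), Real.norm_eq_abs, sq_abs]

theorem vortexGrad_sub (u u' : Space → ℝ) (g g' : Space → Space) (ω : ℝ) (ℓ : ℤ) (t : ℝ) :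
    vortexGrad u g ω ℓ t - vortexGrad u' g' ω ℓ t = vortexGrad (u - u') (g - g') ω ℓ t := by
  ext x i
  simp only [vortexGrad, Pi.sub_apply, PiLp.sub_apply]
  push_cast
  ring

/-- The support of a test function avoids the axis, the only place where the phase fails to be
smooth. -/
theorem contDiff_vortex {φ : Space → ℝ} (hφ : IsCylTest φ) (ω : ℝ) (ℓ : ℤ) (t : ℝ) :
    ContDiff ℝ 1 (vortex φ ω ℓ t) := by
  refine contDiff_iff_contDiffAt.2 fun x => ?_
  by_cases hx : x ∈ tsupport φ
  · have h1 : ContDiffAt ℝ 1 (fun x => (φ x : ℂ)) x :=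
      Complex.ofRealCLM.contDiff.contDiffAt.comp x (hφ.1.of_le (by simp)).contDiffAt
    exact h1.mul (contDiffAt_phase (hφ.2.2.1 hx) ω ℓ t)
  · have h1 : vortex φ ω ℓ t =ᶠ[𝓝 x] fun _ => 0 := by
      filter_upwards [(isClosed_tsupport φ).isOpen_compl.mem_nhds hx] with y hy
      simp [vortex_eq, image_eq_zero_of_notMem_tsupport hy]
    exact contDiffAt_const.congr_of_eventuallyEq h1

theorem hasCompactSupport_vortex {φ : Space → ℝ} (hφ : HasCompactSupport φ) (ω : ℝ) (ℓ : ℤ) (t : ℝ) :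
    HasCompactSupport (vortex φ ω ℓ t) :=
  HasCompactSupport.intro hφ fun x hx => by
    simp [vortex_eq, image_eq_zero_of_notMem_tsupport hx]

theorem grad_vortex {φ : Space → ℝ} (hφ : IsCylTest φ) (ω : ℝ) (ℓ : ℤ) (t : ℝ) :
    grad (vortex φ ω ℓ t) = vortexGrad φ (grad φ) ω ℓ t := by
  ext x i
  by_cases hx : x ∈ tsupport φ
  · have h1 : HasFDerivAt (fun x => (φ x : ℂ)) _ x := Complex.ofRealCLM.hasFDerivAt.comp x
      ((hφ.1.differentiable (by simp)) x).hasFDerivAt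
    have h2 := ((contDiffAt_phase (hφ.2.2.1 hx) ω ℓ t).differentiableAt one_ne_zero).hasFDerivAt
    have h3 : HasFDerivAt (vortex φ ω ℓ t) ((φ x : ℂ) • fderiv ℝ (phase ω ℓ t) x +
      phase ω ℓ t x • (Complex.ofRealCLM ∘SL fderiv ℝ φ x)) x := h1.mul h2
    have h4 : inner ℝ (gradTheta x) (e i) = gradTheta x i := by
      rw [EuclideanSpace.inner_single_right]; simp
    simp only [grad, vortexGrad, h3.fderiv]
    simp only [_root_.add_apply, _root_.smul_apply, fderiv_phase (hφ.2.2.1 hx), smul_eq_mul, h4,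
      ContinuousLinearMap.comp_apply, Complex.ofRealCLM_apply]
    push_cast
    ring
  · have h1 : x ∉ tsupport (vortex φ ω ℓ t) := fun hmem =>
      hx (closure_mono (fun y hy => by
        rw [Function.mem_support] at hy ⊢
        intro h0
        exact hy (by simp [vortex_eq, h0])) hmem)
    rw [grad_eq_zero h1]
    simp [vortexGrad, grad_eq_zero hx, image_eq_zero_of_notMem_tsupport hx]

/-! ### From test functions to their closure -/

/-- The closure of the cylindrical test functions. -/
def CylClosure (u : Space → ℝ) : Prop :=
  IsH1 u ∧ ∀ ε : ENNReal, 0 < ε → ∃ φ, IsCylTest φ ∧ cylNormSq (u - φ) < ε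

theorem isH1_of_isCylTest {φ : Space → ℝ} (hφ : IsCylTest φ) : IsH1 φ :=
  isH1_of_contDiff (hφ.1.of_le (by simp)) hφ.2.1

theorem weakGrad_isCylTest {φ : Space → ℝ} (hφ : IsCylTest φ) : weakGrad φ =ᵐ[volume] grad φ :=
  (hasWeakGradient_grad (hφ.1.of_le (by simp))).weakGrad_ae_eq

theorem weakGrad_sub {u φ : Space → ℝ} (hu : IsH1 u) (hφ : IsCylTest φ) :
    weakGrad (u - φ) =ᵐ[volume] weakGrad u - grad φ := by
  have h1 := (hasWeakGradient_grad (hφ.1.of_le (m := 1) (by simp))).const_mul (-1 : ℝ)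
  have h2 := hu.hasWeakGradient.add h1
  have e1 : u + (fun x => -1 * φ x) = u - φ := by ext x; simp [sub_eq_add_neg]
  have e2 : weakGrad u + (fun x => (-1 : ℝ) • grad φ x) = weakGrad u - grad φ := by
    ext1 x; simp [sub_eq_add_neg]
  rw [e1, e2] at h2
  exact h2.weakGrad_ae_eq

theorem IsCylTest.cylClosure {φ : Space → ℝ} (hφ : IsCylTest φ) : CylClosure φ := by
  refine ⟨isH1_of_isCylTest hφ, fun ε hε => ⟨φ, hφ, ?_⟩⟩
  have h1 := weakGrad_sub (isH1_of_isCylTest hφ) hφ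
  have h2 : cylNormSq (φ - φ) = 0 := by
    rw [cylNormSq]
    refine (lintegral_congr_ae ?_).trans lintegral_zero
    filter_upwards [h1, weakGrad_isCylTest hφ] with x hx hx'
    rw [hx]
    simp [hx']
  rw [h2]
  exact hε

namespace CylClosure

variable {u : Space → ℝ}

theorem exists_seq (hu : CylClosure u) : ∃ φ : ℕ → Space → ℝ, (∀ n, IsCylTest (φ n)) ∧
    Tendsto (fun n => cylNormSq (u - φ n)) atTop (𝓝 0) := by
  have hpos : ∀ n : ℕ, (0 : ℝ≥0∞) < ((n : ℝ≥0∞) + 1)⁻¹ := fun n => by simp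
  choose φ h1 h2 using fun n : ℕ => hu.2 _ (hpos n)
  refine ⟨φ, h1, tendsto_of_tendsto_of_tendsto_of_le_of_le tendsto_const_nhds ?_
    (fun _ => zero_le) (fun n => (h2 n).le)⟩
  have := (tendsto_add_atTop_iff_nat 1).2 ENNReal.tendsto_inv_nat_nhds_zero
  simpa using this

/-- The weight `1 / r²` in the norm is what controls the gradient of the phase, whose square is `ℓ²
/ r²`. -/
theorem lintegral_vortexGrad_sub_le {φ : Space → ℝ} (hu : IsH1 u) (hφ : IsCylTest φ)
    (ω : ℝ) (ℓ : ℤ) (t : ℝ) :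
    ∫⁻ x, ‖(vortexGrad u (weakGrad u) ω ℓ t - vortexGrad φ (grad φ) ω ℓ t) x‖ₑ ^ 2 ≤
      ENNReal.ofReal (1 + (ℓ : ℝ) ^ 2) * cylNormSq (u - φ) := by
  rw [vortexGrad_sub, cylNormSq, ← lintegral_const_mul' _ _ ENNReal.ofReal_ne_top]
  refine lintegral_mono_ae ?_
  filter_upwards [weakGrad_sub hu hφ] with x hx
  rw [← ofReal_norm_sq, norm_vortexGrad_sq, ← ENNReal.ofReal_mul (by positivity), ← hx]
  refine ENNReal.ofReal_le_ofReal ?_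
  have h1 : 0 ≤ 1 / rsq x := one_div_nonneg.2 (rsq_nonneg x)
  have h2 : (ℓ : ℝ) ^ 2 / rsq x = (ℓ : ℝ) ^ 2 * (1 / rsq x) := by ring
  rw [h2]
  have h3 := sq_nonneg ((u - φ) x)
  have h4 := sq_nonneg ‖weakGrad (u - φ) x‖
  have h5 := sq_nonneg (ℓ : ℝ)
  nlinarith [mul_nonneg h5 h4, mul_nonneg h5 h3, mul_nonneg h1 h3, mul_nonneg h5 (mul_nonneg h1 h3)]

theorem lintegral_sub_le (u φ : Space → ℝ) :
    ∫⁻ x, ‖(u - φ) x‖ₑ ^ 2 ≤ cylNormSq (u - φ) := by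
  refine lintegral_mono fun x => ?_
  dsimp only
  rw [← ofReal_sq]
  refine ENNReal.ofReal_le_ofReal ?_
  have h1 : 0 ≤ 1 / rsq x := one_div_nonneg.2 (rsq_nonneg x)
  nlinarith [sq_nonneg ‖weakGrad (u - φ) x‖, mul_nonneg h1 (sq_nonneg ((u - φ) x))]

theorem aestronglyMeasurable_vortexGrad {g : Space → Space} (hu : AEStronglyMeasurable u volume)
    (hg : AEStronglyMeasurable g volume) (ω : ℝ) (ℓ : ℤ) (t : ℝ) :
    AEStronglyMeasurable (vortexGrad u g ω ℓ t) volume := by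
  have h1 := measurable_phase ω ℓ t
  have h2 : ∀ i, Measurable fun x : Space => gradTheta x i := by
    have hr : Measurable rsq := (contDiff_rsq (n := 0)).continuous.measurable
    intro i
    fin_cases i
    · change Measurable fun x : Space => -x 1 / rsq x
      fun_prop
    · change Measurable fun x : Space => x 0 / rsq x
      fun_prop
    · exact measurable_const
  refine AEMeasurable.aestronglyMeasurable ?_
  refine (WithLp.measurable_toLp 2 (Fin 3 → ℂ)).comp_aemeasurable (aemeasurable_pi_iff.2 fun i => ?_)
  have h3 : AEMeasurable (fun x => g x i) volume := by
    have := hg.aemeasurable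
    exact (by fun_prop : Measurable fun y : Space => y i).comp_aemeasurable this
  have h4 := hu.aemeasurable
  have h5 := h2 i
  refine h1.aemeasurable.mul ((Complex.measurable_ofReal.comp_aemeasurable h3).add
    (aemeasurable_const.mul (Complex.measurable_ofReal.comp_aemeasurable
      (aemeasurable_const.mul (h4.mul h5.aemeasurable)))))

theorem memLp_vortexGrad (hu : CylClosure u) (ω : ℝ) (ℓ : ℤ) (t : ℝ) :
    MemLp (vortexGrad u (weakGrad u) ω ℓ t) 2 volume := by
  obtain ⟨φ, hφ, hlt⟩ := hu.2 1 one_pos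
  have h1 : MemLp (vortexGrad φ (grad φ) ω ℓ t) 2 volume := by
    rw [← grad_vortex hφ]
    exact (continuous_grad (contDiff_vortex hφ ω ℓ t)).memLp_of_hasCompactSupport
      (hasCompactSupport_grad (hasCompactSupport_vortex hφ.2.1 ω ℓ t))
  have h2 : MemLp (vortexGrad u (weakGrad u) ω ℓ t - vortexGrad φ (grad φ) ω ℓ t) 2 volume := by
    refine memLp_two_of_lintegral_lt_top ?_ ((lintegral_vortexGrad_sub_le hu.1 hφ ω ℓ t).trans_lt ?_)
    · exact (aestronglyMeasurable_vortexGrad hu.1.1.1 hu.1.memLp_weakGrad.1 ω ℓ t).sub h1.1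
    · exact ENNReal.mul_lt_top ENNReal.ofReal_lt_top (hlt.trans ENNReal.one_lt_top)
  simpa using h2.add h1

theorem memLp_vortex (hu : MemLp u 2 volume) (ω : ℝ) (ℓ : ℤ) (t : ℝ) :
    MemLp (vortex u ω ℓ t) 2 volume := by
  refine hu.congr_norm ?_ (Eventually.of_forall fun x => ?_)
  · exact (Complex.continuous_ofReal.comp_aestronglyMeasurable hu.1).mul
      (measurable_phase ω ℓ t).aestronglyMeasurable
  · rw [norm_vortex, Real.norm_eq_abs]

/-- A vortex has the expected weak gradient, across the axis. -/
theorem hasWeakGradient_vortex (hu : CylClosure u) (ω : ℝ) (ℓ : ℤ) (t : ℝ) :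
    HasWeakGradient (vortex u ω ℓ t) (vortexGrad u (weakGrad u) ω ℓ t) := by
  obtain ⟨φ, hφ, hlim⟩ := hu.exists_seq
  have hs := fun n => contDiff_vortex (hφ n) ω ℓ t
  have hc := fun n => hasCompactSupport_vortex (hφ n).2.1 ω ℓ t
  -- The approximating vortices are `C¹` on all of space, so no boundary term arises at the axis;
  -- fields and gradients both converge in `L²`.
  refine HasWeakGradient.of_tendsto (fs := fun n => vortex (φ n) ω ℓ t)
    (gs := fun n => grad (vortex (φ n) ω ℓ t)) (fun n => hasWeakGradient_grad (hs n))
    (fun n => (hs n).continuous.memLp_of_hasCompactSupport (hc n))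
    (fun n => (continuous_grad (hs n)).memLp_of_hasCompactSupport (hasCompactSupport_grad (hc n)))
    (memLp_vortex hu.1.1 ω ℓ t) (hu.memLp_vortexGrad ω ℓ t) ?_ ?_
  · rw [tendsto_eLpNorm_two_iff]
    refine tendsto_of_tendsto_of_tendsto_of_le_of_le tendsto_const_nhds hlim (fun _ => zero_le) ?_
    intro n
    refine le_trans (le_of_eq ?_) (lintegral_sub_le u (φ n))
    refine lintegral_congr fun x => ?_
    rw [← ofReal_norm_sq, ← ofReal_norm_sq, Pi.sub_apply, vortex_eq, vortex_eq, ← sub_mul, norm_mul,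
      norm_phase, mul_one, ← Complex.ofReal_sub, Complex.norm_real, Pi.sub_apply, norm_sub_rev]
  · rw [tendsto_eLpNorm_two_iff]
    have h1 := ENNReal.Tendsto.const_mul (a := ENNReal.ofReal (1 + (ℓ : ℝ) ^ 2)) hlim
      (Or.inr ENNReal.ofReal_ne_top)
    rw [mul_zero] at h1
    refine tendsto_of_tendsto_of_tendsto_of_le_of_le tendsto_const_nhds h1 (fun _ => zero_le) ?_
    intro n
    refine le_trans (le_of_eq ?_) (lintegral_vortexGrad_sub_le hu.1 (hφ n) ω ℓ t)
    refine lintegral_congr fun x => ?_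
    rw [grad_vortex (hφ n), ← ofReal_norm_sq, ← ofReal_norm_sq, Pi.sub_apply, Pi.sub_apply,
      norm_sub_rev]

theorem isH1_vortex (hu : CylClosure u) (ω : ℝ) (ℓ : ℤ) (t : ℝ) : IsH1 (vortex u ω ℓ t) :=
  ⟨memLp_vortex hu.1.1 ω ℓ t, _, hu.hasWeakGradient_vortex ω ℓ t, hu.memLp_vortexGrad ω ℓ t⟩

theorem weakGrad_vortex (hu : CylClosure u) (ω : ℝ) (ℓ : ℤ) (t : ℝ) :
    weakGrad (vortex u ω ℓ t) =ᵐ[volume] vortexGrad u (weakGrad u) ω ℓ t :=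
  (hu.hasWeakGradient_vortex ω ℓ t).weakGrad_ae_eq

end CylClosure

/-! ### Charge, energy and angular momentum of vortices -/

theorem hasDerivAt_vortex (u : Space → ℝ) (ω : ℝ) (ℓ : ℤ) (t : ℝ) (x : Space) :
    HasDerivAt (fun s => vortex u ω ℓ s x) (-(Complex.I * ω) * vortex u ω ℓ t x) t := by
  have h1 : HasDerivAt (fun s : ℝ => (ℓ : ℝ) * theta x - ω * s) (-ω) t := by
    simpa using ((hasDerivAt_id t).const_mul ω).const_sub ((ℓ : ℝ) * theta x)
  have h2 := ((h1.ofReal_comp.const_mul Complex.I).cexp).const_mul (u x : ℂ)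
  refine h2.congr_deriv ?_
  rw [vortex]
  push_cast
  ring

theorem stateAt_vortex_snd (u : Space → ℝ) (ω : ℝ) (ℓ : ℤ) (t : ℝ) :
    (stateAt (vortex u ω ℓ) t).2 = fun x => -(Complex.I * ω) * vortex u ω ℓ t x :=
  funext fun x => (hasDerivAt_vortex u ω ℓ t x).deriv

theorem stateAt_vortex_fst (u : Space → ℝ) (ω : ℝ) (ℓ : ℤ) (t : ℝ) :
    (stateAt (vortex u ω ℓ) t).1 = vortex u ω ℓ t := rfl

theorem phase_mul_conj (ω : ℝ) (ℓ : ℤ) (t : ℝ) (x : Space) :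
    phase ω ℓ t x * starRingEnd ℂ (phase ω ℓ t x) = 1 := by
  rw [Complex.mul_conj, Complex.normSq_eq_norm_sq, norm_phase]
  simp

theorem charge_vortex (u : Space → ℝ) (ω : ℝ) (ℓ : ℤ) (t : ℝ) :
    charge (stateAt (vortex u ω ℓ) t) = staticCharge u ω := by
  have h1 : ∀ x, (stateAt (vortex u ω ℓ) t).2 x * starRingEnd ℂ ((stateAt (vortex u ω ℓ) t).1 x) =
      -Complex.I * ((ω * u x ^ 2 : ℝ) : ℂ) := by
    intro x
    rw [stateAt_vortex_snd, stateAt_vortex_fst, vortex_eq]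
    have := phase_mul_conj ω ℓ t x
    simp only [map_mul, Complex.conj_ofReal]
    push_cast
    linear_combination (-(Complex.I * ω) * (u x : ℂ) ^ 2) * this
  rw [charge, staticCharge]
  simp_rw [h1]
  rw [integral_const_mul, integral_complex_ofReal]
  simp

theorem staticCharge_eq (u : Space → ℝ) (ω : ℝ) : staticCharge u ω = -(ω * ∫ x, u x ^ 2) := by
  rw [staticCharge, integral_const_mul]

namespace CylClosure

variable {u : Space → ℝ}

theorem stateAt_vortex_mem_phaseSpace (hu : CylClosure u) (ω : ℝ) (ℓ : ℤ) (t : ℝ) :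
    stateAt (vortex u ω ℓ) t ∈ phaseSpace := by
  refine ⟨hu.isH1_vortex ω ℓ t, ?_⟩
  rw [stateAt_vortex_snd]
  exact (memLp_vortex hu.1.1 ω ℓ t).const_mul _

theorem energy_vortex (F : ℝ → ℝ) (hu : CylClosure u) (h0 : ∀ᵐ x, 0 ≤ u x) (ω : ℝ) (ℓ : ℤ) (t : ℝ) :
    energy F (stateAt (vortex u ω ℓ) t) = staticEnergy F u ω ℓ := by
  rw [energy, staticEnergy, stateAt_vortex_snd, stateAt_vortex_fst]
  refine lintegral_congr_ae ?_
  filter_upwards [hu.weakGrad_vortex ω ℓ t, h0] with x hx hx0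
  rw [hx, norm_vortexGrad_sq, norm_mul, norm_vortex, abs_of_nonneg hx0]
  simp only [norm_neg, norm_mul, Complex.norm_I, Complex.norm_real, Real.norm_eq_abs, one_mul,
    mul_pow, sq_abs]
  congr 1
  ring

end CylClosure

/-- The angular momentum density of a vortex comes from the gradient of its phase only. -/
theorem angularDensity_of_vortexGrad {Ψ : State} {u : Space → ℝ} {g : Space → Space} {ω : ℝ}
    {ℓ : ℤ} {t : ℝ} {x : Space} (h1 : weakGrad Ψ.1 x = vortexGrad u g ω ℓ t x)
    (h2 : Ψ.2 x = -(Complex.I * ω) * vortex u ω ℓ t x) (i : Fin 3) :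
    angularDensity Ψ x i =
      -(ω * ℓ * u x ^ 2 * crossProduct (fun j => x j) (fun j => gradTheta x j) i) := by
  have hp := phase_mul_conj ω ℓ t x
  have key : ∀ j k : Fin 3, ((x j : ℂ) * weakGrad Ψ.1 x k - (x k : ℂ) * weakGrad Ψ.1 x j) *
      starRingEnd ℂ (Ψ.2 x) =
      ((-(ω * ℓ * u x ^ 2 * (x j * gradTheta x k - x k * gradTheta x j)) : ℝ) : ℂ) +
        Complex.I * ((ω * u x * (x j * g x k - x k * g x j) : ℝ) : ℂ) := by
    intro j k
    rw [h1, h2, vortex_eq]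
    simp only [vortexGrad, map_mul, map_neg, Complex.conj_I, Complex.conj_ofReal]
    push_cast
    linear_combination ((Complex.I * ω * u x) * ((x j : ℂ) * (g x k + Complex.I * (ℓ * (u x * gradTheta x k)))
      - (x k : ℂ) * (g x j + Complex.I * (ℓ * (u x * gradTheta x j))))) * hp +
      (ω * u x) * (ℓ * u x * ((x j : ℂ) * gradTheta x k - x k * gradTheta x j)) * Complex.I_sq
  have key' : ∀ j k : Fin 3, (((x j : ℂ) * weakGrad Ψ.1 x k - (x k : ℂ) * weakGrad Ψ.1 x j) *
      starRingEnd ℂ (Ψ.2 x)).re = -(ω * ℓ * u x ^ 2 * (x j * gradTheta x k - x k * gradTheta x j)) := by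
    intro j k
    rw [key, Complex.add_re, Complex.ofReal_re, Complex.mul_re, Complex.I_re, Complex.ofReal_im]
    simp
  rw [angularDensity, cross_apply, cross_apply]
  fin_cases i
  · exact key' 1 2
  · exact key' 2 0
  · exact key' 0 1

/-! ### Half-turn symmetry and the angular momentum of a vortex -/

/-- The half turn about the axis. -/
def halfTurn : Space ≃ₗᵢ[ℝ] Space :=
  LinearIsometryEquiv.piLpCongrRight 2 fun i : Fin 3 =>
    if i = 2 then LinearIsometryEquiv.refl ℝ ℝ else LinearIsometryEquiv.neg ℝ

theorem halfTurn_zero (x : Space) : halfTurn x 0 = -x 0 := by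
  simp [halfTurn]

theorem halfTurn_one (x : Space) : halfTurn x 1 = -x 1 := by
  simp [halfTurn]

theorem halfTurn_two (x : Space) : halfTurn x 2 = x 2 := by
  simp [halfTurn]

theorem rsq_halfTurn (x : Space) : rsq (halfTurn x) = rsq x := by
  simp [rsq, halfTurn_zero, halfTurn_one]

namespace CylClosure

variable {u : Space → ℝ}

/-- The approximating test functions are invariant under the half turn, which preserves volume, and
they converge to `u` in `L²`. -/
theorem comp_halfTurn (hu : CylClosure u) : (fun x => u (halfTurn x)) =ᵐ[volume] u := by
  have hmp : MeasurePreserving halfTurn volume volume := halfTurn.measurePreserving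
  obtain ⟨φ, hφ, hlim⟩ := hu.exists_seq
  have hm : ∀ n, AEMeasurable (fun x => ‖(u - φ n) x‖ₑ ^ 2) volume := fun n =>
    (hu.1.1.1.sub (hφ n).1.continuous.aestronglyMeasurable).enorm.pow_const 2
  have hle : ∀ n, ∫⁻ x, ‖u (halfTurn x) - u x‖ₑ ^ 2 ≤ 4 * cylNormSq (u - φ n) := by
    intro n
    have h1 : ∀ x, φ n (halfTurn x) = φ n x := fun x =>
      (hφ n).2.2.2 _ _ (rsq_halfTurn x) (halfTurn_two x)
    have h2 : ∫⁻ x, ‖(u - φ n) (halfTurn x)‖ₑ ^ 2 = ∫⁻ x, ‖(u - φ n) x‖ₑ ^ 2 :=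
      hmp.lintegral_comp_emb halfTurn.toHomeomorph.measurableEmbedding
        (fun x => ‖(u - φ n) x‖ₑ ^ 2)
    calc ∫⁻ x, ‖u (halfTurn x) - u x‖ₑ ^ 2
        ≤ ∫⁻ x, (2 * ‖(u - φ n) (halfTurn x)‖ₑ ^ 2 + 2 * ‖(u - φ n) x‖ₑ ^ 2) := by
          refine lintegral_mono fun x => ?_
          dsimp only
          have h3 : ∀ r : ℝ, 2 * ENNReal.ofReal r = ENNReal.ofReal (2 * r) := fun r => by
            rw [ENNReal.ofReal_mul zero_le_two]
            simp
          rw [← ofReal_norm_sq, ← ofReal_norm_sq, ← ofReal_norm_sq, h3, h3,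
            ← ENNReal.ofReal_add (by positivity) (by positivity)]
          refine ENNReal.ofReal_le_ofReal ?_
          simp only [Pi.sub_apply, h1, Real.norm_eq_abs, sq_abs]
          nlinarith [sq_nonneg (u (halfTurn x) + u x - 2 * φ n x)]
      _ = 4 * ∫⁻ x, ‖(u - φ n) x‖ₑ ^ 2 := by
          rw [lintegral_add_right' _ ((hm n).const_mul 2), lintegral_const_mul' _ _ (by simp),
            lintegral_const_mul' _ _ (by simp), h2, ← add_mul]
          norm_num
      _ ≤ 4 * cylNormSq (u - φ n) := by
          gcongr
          exact lintegral_sub_le u (φ n)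
  have h0 : ∫⁻ x, ‖u (halfTurn x) - u x‖ₑ ^ 2 = 0 := by
    have h4 : Tendsto (fun n => 4 * cylNormSq (u - φ n)) atTop (𝓝 0) := by
      simpa using ENNReal.Tendsto.const_mul (a := 4) hlim (Or.inr (by simp))
    exact le_antisymm (ge_of_tendsto h4 (Eventually.of_forall hle)) zero_le
  have hm' : AEStronglyMeasurable (fun x => u (halfTurn x)) volume :=
    hu.1.1.1.comp_quasiMeasurePreserving hmp.quasiMeasurePreserving
  replace h0 := (lintegral_eq_zero_iff' ((hm'.sub hu.1.1.1).enorm.pow_const 2)).1 h0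
  filter_upwards [h0] with x hx
  simpa [sub_eq_zero] using hx

/-- The half turn changes the sign of the integrand and preserves the integral. Integrability is not
required: a divergent integral has the default value zero, which is the convention for the first two
components of the angular momentum. -/
theorem integral_mul_odd (hu : CylClosure u) {k : Space → ℝ} (hk : ∀ x, k (halfTurn x) = -k x)
    (c : ℝ) : ∫ x, -(c * u x ^ 2 * k x) = 0 := by
  have hmp : MeasurePreserving halfTurn volume volume := halfTurn.measurePreserving
  have h1 : ∫ x, -(c * u (halfTurn x) ^ 2 * k (halfTurn x)) = ∫ x, -(c * u x ^ 2 * k x) :=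
    hmp.integral_comp halfTurn.toHomeomorph.measurableEmbedding (fun x => -(c * u x ^ 2 * k x))
  have h2 : ∫ x, -(c * u (halfTurn x) ^ 2 * k (halfTurn x)) = -∫ x, -(c * u x ^ 2 * k x) := by
    rw [← integral_neg]
    refine integral_congr_ae ?_
    filter_upwards [hu.comp_halfTurn] with x hx
    rw [hx, hk]
    ring
  linarith

/-- Off the axis the third component of `x × ∇θ` is `1`, which yields `ℓ` times the charge; the
other two components are odd under the half turn. -/
theorem angularMomentum_vortex (hu : CylClosure u) (ω : ℝ) (ℓ : ℤ) (t : ℝ) :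
    angularMomentum (stateAt (vortex u ω ℓ) t) = ![0, 0, ℓ * staticCharge u ω] := by
  have hd : ∀ i, angularMomentum (stateAt (vortex u ω ℓ) t) i =
      ∫ x, -(ω * ℓ * u x ^ 2 * crossProduct (fun j => x j) (fun j => gradTheta x j) i) := by
    intro i
    refine integral_congr_ae ?_
    filter_upwards [hu.weakGrad_vortex ω ℓ t] with x hx
    exact angularDensity_of_vortexGrad hx (congrFun (stateAt_vortex_snd u ω ℓ t) x) i
  have g0 : ∀ x, gradTheta x 0 = -x 1 / rsq x := fun _ => rfl
  have g1 : ∀ x, gradTheta x 1 = x 0 / rsq x := fun _ => rfl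
  have g2 : ∀ x, gradTheta x 2 = 0 := fun _ => rfl
  ext i
  rw [hd]
  fin_cases i
  · refine hu.integral_mul_odd (fun x => ?_) _
    simp [cross_apply, g1, g2, halfTurn_two, halfTurn_one, halfTurn_zero, rsq_halfTurn]
    ring
  · refine hu.integral_mul_odd (fun x => ?_) _
    simp [cross_apply, g0, g2, halfTurn_two, halfTurn_one, halfTurn_zero, rsq_halfTurn]
    ring
  · have h1 : ∫ x, -(ω * ℓ * u x ^ 2 * crossProduct (fun j => x j) (fun j => gradTheta x j) 2) =
        ∫ x, -(ω * ℓ) * u x ^ 2 := by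
      refine integral_congr_ae ?_
      filter_upwards [ae_rsq_ne_zero] with x hx
      have h2 : x 0 * (x 0 / rsq x) - x 1 * (-x 1 / rsq x) = 1 := by
        field_simp
        rw [rsq]
        ring
      simp only [cross_apply, g0, g1, Matrix.cons_val]
      rw [h2]
      ring
    refine h1.trans ?_
    rw [integral_const_mul, staticCharge_eq]
    simp
    ring

end CylClosure

theorem cylClosure_of_mem_cylCone {u : Space → ℝ} (hu : u ∈ cylCone) : CylClosure u :=
  ⟨hu.1, hu.2.1⟩

theorem IsCylTest.mem_cylCone {φ : Space → ℝ} (hφ : IsCylTest φ) (h0 : ∀ x, 0 ≤ φ x) : φ ∈ cylCone :=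
  ⟨hφ.cylClosure.1, hφ.cylClosure.2, Eventually.of_forall h0⟩

/-! ### Superposition of fields with disjoint supports -/

/-- States with a `C¹` field and a continuous time derivative, both of compact support. -/
structure RegularState (A : State) : Prop where
  contDiff : ContDiff ℝ 1 A.1
  hasCompactSupport : HasCompactSupport A.1
  continuous_snd : Continuous A.2
  hasCompactSupport_snd : HasCompactSupport A.2

/-- The field, its gradient and its time derivative vanish at `x`. -/
def VanishesAt (A : State) (x : Space) : Prop := A.1 x = 0 ∧ grad A.1 x = 0 ∧ A.2 x = 0

namespace RegularState

variable {A B : State}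

theorem mem_phaseSpace (hA : RegularState A) : A ∈ phaseSpace :=
  ⟨isH1_of_contDiff hA.contDiff hA.hasCompactSupport,
    hA.continuous_snd.memLp_of_hasCompactSupport hA.hasCompactSupport_snd⟩

theorem weakGrad_ae_eq (hA : RegularState A) : weakGrad A.1 =ᵐ[volume] grad A.1 :=
  (hasWeakGradient_grad hA.contDiff).weakGrad_ae_eq

protected theorem add (hA : RegularState A) (hB : RegularState B) : RegularState (A + B) :=
  ⟨hA.contDiff.add hB.contDiff, hA.hasCompactSupport.add hB.hasCompactSupport,
    hA.continuous_snd.add hB.continuous_snd, hA.hasCompactSupport_snd.add hB.hasCompactSupport_snd⟩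

theorem weakGrad_add_ae_eq (hA : RegularState A) (hB : RegularState B) :
    weakGrad (A + B).1 =ᵐ[volume] weakGrad A.1 + weakGrad B.1 :=
  ((hasWeakGradient_grad hA.contDiff).weakGrad.add
    (hasWeakGradient_grad hB.contDiff).weakGrad).weakGrad_ae_eq

/-- The compact support of the time derivative absorbs the growth of the factor `x`, leaving a
product of two `L²` functions. -/
theorem integrable_angularDensity (hA : RegularState A) (i : Fin 3) :
    Integrable (fun x => angularDensity A x i) volume := by
  have h1 : ∀ j k : Fin 3, Integrable
      (fun x => (x j : ℂ) * weakGrad A.1 x k * starRingEnd ℂ (A.2 x)) volume := by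
    intro j k
    have hc : Continuous fun x : Space => (x j : ℂ) * starRingEnd ℂ (A.2 x) :=
      (Complex.continuous_ofReal.comp (contDiff_apply_space (n := 0) j).continuous).mul
        (Complex.continuous_conj.comp hA.continuous_snd)
    have hs : HasCompactSupport fun x : Space => (x j : ℂ) * starRingEnd ℂ (A.2 x) :=
      HasCompactSupport.intro hA.hasCompactSupport_snd fun x hx => by
        simp [image_eq_zero_of_notMem_tsupport hx]
    have h2 := memLp_one_iff_integrable.1 ((memLp_apply hA.mem_phaseSpace.1.memLp_weakGrad k).smul
      (hc.memLp_of_hasCompactSupport hs (p := 2) (μ := volume)) (r := 1))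
    refine h2.congr (Eventually.of_forall fun x => ?_)
    simp only [Pi.smul_apply', smul_eq_mul]
    ring
  have h2 : ∀ j k : Fin 3, Integrable (fun x => (((x j : ℂ) * weakGrad A.1 x k -
      (x k : ℂ) * weakGrad A.1 x j) * starRingEnd ℂ (A.2 x)).re) volume := by
    intro j k
    have h3 := ((h1 j k).sub (h1 k j)).re
    refine h3.congr (Eventually.of_forall fun x => ?_)
    simp only [Pi.sub_apply, sub_mul]
    rfl
  have h3 : (fun x => angularDensity A x i) = fun x => (![((x 1 : ℂ) * weakGrad A.1 x 2 -
      (x 2 : ℂ) * weakGrad A.1 x 1), ((x 2 : ℂ) * weakGrad A.1 x 0 - (x 0 : ℂ) * weakGrad A.1 x 2),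
      ((x 0 : ℂ) * weakGrad A.1 x 1 - (x 1 : ℂ) * weakGrad A.1 x 0)] i * starRingEnd ℂ (A.2 x)).re := by
    ext x
    rw [angularDensity, cross_apply]
  rw [h3]
  fin_cases i
  · exact h2 1 2
  · exact h2 2 0
  · exact h2 0 1

/-- Transfers disjointness from classical to chosen weak gradients, so that cross terms in energy
and angular momentum vanish almost everywhere. -/
theorem vanishesAt_weakGrad (hA : RegularState A) (hB : RegularState B)
    (hd : ∀ x, VanishesAt A x ∨ VanishesAt B x) : ∀ᵐ x,
      (A.1 x = 0 ∧ weakGrad A.1 x = 0 ∧ A.2 x = 0) ∨ (B.1 x = 0 ∧ weakGrad B.1 x = 0 ∧ B.2 x = 0) := by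
  filter_upwards [hA.weakGrad_ae_eq, hB.weakGrad_ae_eq] with x h1 h2
  rw [h1, h2]
  exact hd x

theorem charge_add (hA : RegularState A) (hB : RegularState B)
    (hd : ∀ x, VanishesAt A x ∨ VanishesAt B x) : charge (A + B) = charge A + charge B := by
  have hi : ∀ {A : State}, RegularState A →
      Integrable (fun x => A.2 x * starRingEnd ℂ (A.1 x)) volume := fun hA =>
    (hA.continuous_snd.mul (Complex.continuous_conj.comp hA.contDiff.continuous)).integrable_of_hasCompactSupport
      hA.hasCompactSupport_snd.mul_right
  rw [charge, charge, charge, ← Complex.add_im, ← integral_add (hi hA) (hi hB)]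
  congr 2
  ext x
  rcases hd x with ⟨h1, -, h2⟩ | ⟨h1, -, h2⟩ <;> simp [h1, h2]

theorem energy_add {F : ℝ → ℝ} (hF : Tame F) (hA : RegularState A) (hB : RegularState B)
    (hd : ∀ x, VanishesAt A x ∨ VanishesAt B x) : energy F (A + B) = energy F A + energy F B := by
  have hm : AEMeasurable (fun x => ENNReal.ofReal
      (1 / 2 * ‖A.2 x‖ ^ 2 + 1 / 2 * ‖weakGrad A.1 x‖ ^ 2 + F ‖A.1 x‖)) volume := by
    have h1 : (fun x => F ‖A.1 x‖) = fun x => F |‖A.1 x‖| := by simp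
    have h2 : Continuous fun x => F ‖A.1 x‖ := by
      rw [h1]
      exact hF.continuous_abs.comp hA.contDiff.continuous.norm
    have h3 := hA.mem_phaseSpace.1.memLp_weakGrad.1.norm.aemeasurable
    have h4 := hA.continuous_snd.norm.measurable
    have h5 := h2.measurable
    exact (((h4.pow_const 2).const_mul _).aemeasurable.add ((h3.pow_const 2).const_mul _)).add
      h5.aemeasurable |>.ennreal_ofReal
  rw [energy, energy, energy, ← lintegral_add_left' hm]
  refine lintegral_congr_ae ?_
  filter_upwards [hA.weakGrad_add_ae_eq hB, hA.vanishesAt_weakGrad hB hd] with x h1 h2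
  rw [h1]
  rcases h2 with ⟨h2, h3, h4⟩ | ⟨h2, h3, h4⟩ <;> simp [h2, h3, h4, hF.zero]

theorem angularMomentum_add (hA : RegularState A) (hB : RegularState B)
    (hd : ∀ x, VanishesAt A x ∨ VanishesAt B x) :
    angularMomentum (A + B) = angularMomentum A + angularMomentum B := by
  ext i
  rw [Pi.add_apply, angularMomentum, angularMomentum, angularMomentum,
    ← integral_add (hA.integrable_angularDensity i) (hB.integrable_angularDensity i)]
  refine integral_congr_ae ?_
  filter_upwards [hA.weakGrad_add_ae_eq hB, hA.vanishesAt_weakGrad hB hd] with x h1 h2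
  simp only [angularDensity]
  rw [h1]
  rcases h2 with ⟨-, h3, h4⟩ | ⟨-, h3, h4⟩ <;> fin_cases i <;> simp [cross_apply, h3, h4]

end RegularState

theorem IsCylTest.regularState {φ : Space → ℝ} (hφ : IsCylTest φ) (ω : ℝ) (ℓ : ℤ) (t : ℝ) :
    RegularState (stateAt (vortex φ ω ℓ) t) := by
  have h1 := contDiff_vortex hφ ω ℓ t
  have h2 := hasCompactSupport_vortex hφ.2.1 ω ℓ t
  refine ⟨h1, h2, ?_, ?_⟩
  · rw [stateAt_vortex_snd]
    exact continuous_const.mul h1.continuous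
  · rw [stateAt_vortex_snd]
    exact h2.mul_left

theorem vanishesAt_vortex {φ : Space → ℝ} {x : Space} (hx : x ∉ tsupport φ) (hφ : IsCylTest φ)
    (ω : ℝ) (ℓ : ℤ) (t : ℝ) : VanishesAt (stateAt (vortex φ ω ℓ) t) x := by
  have h1 := image_eq_zero_of_notMem_tsupport hx
  have h2 : vortex φ ω ℓ t x = 0 := by simp [vortex_eq, h1]
  refine ⟨h2, ?_, ?_⟩
  · rw [stateAt_vortex_fst, grad_vortex hφ]
    ext i
    simp [vortexGrad, grad_eq_zero hx, h1]
  · simp [stateAt_vortex_snd, h2]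

/-! ### Large rings of small amplitude -/

/-- A cylindrically symmetric bump supported in a solid torus around the axis. -/
def ringProfile (x : Space) : ℝ := Real.smoothTransition (1 - ((rsq x - 2) ^ 2 + x 2 ^ 2))

theorem ringProfile_nonneg (x : Space) : 0 ≤ ringProfile x := Real.smoothTransition.nonneg _

theorem ringProfile_le_one (x : Space) : ringProfile x ≤ 1 := Real.smoothTransition.le_one _

theorem contDiff_ringProfile {n : ℕ∞} : ContDiff ℝ n ringProfile := by
  have h1 : ContDiff ℝ n rsq := contDiff_rsq
  have h2 : ContDiff ℝ n (fun x : Space => x 2) := contDiff_apply_space 2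
  exact Real.smoothTransition.contDiff.comp
    (contDiff_const.sub (((h1.sub contDiff_const).pow 2).add (h2.pow 2)))

theorem tsupport_ringProfile_subset :
    tsupport ringProfile ⊆ {x | (rsq x - 2) ^ 2 + x 2 ^ 2 ≤ 1} := by
  have h1 : Continuous rsq := (contDiff_rsq (n := 0)).continuous
  have h2 : Continuous fun x : Space => x 2 := (contDiff_apply_space (n := 0) 2).continuous
  refine closure_minimal (fun x hx => ?_)
    (isClosed_le (((h1.sub continuous_const).pow 2).add (h2.pow 2)) continuous_const)
  by_contra hc
  have hc' : ¬ (rsq x - 2) ^ 2 + x 2 ^ 2 ≤ 1 := hc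
  exact hx (Real.smoothTransition.zero_of_nonpos (by linarith))

theorem one_le_rsq_of_mem_tsupport {x : Space} (hx : x ∈ tsupport ringProfile) : 1 ≤ rsq x := by
  have h1 : (rsq x - 2) ^ 2 + x 2 ^ 2 ≤ 1 := tsupport_ringProfile_subset hx
  nlinarith [sq_nonneg (x 2)]

theorem hasCompactSupport_ringProfile : HasCompactSupport ringProfile := by
  refine (isCompact_closedBall (0 : Space) 2).of_isClosed_subset (isClosed_tsupport _) fun x hx => ?_
  have h1 : (rsq x - 2) ^ 2 + x 2 ^ 2 ≤ 1 := tsupport_ringProfile_subset hx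
  have h2 : ‖x‖ ^ 2 ≤ 2 ^ 2 := by
    rw [norm_sq_eq_rsq]
    nlinarith [sq_nonneg (rsq x - 3)]
  rw [mem_closedBall_zero_iff]
  exact le_of_sq_le_sq h2 zero_le_two

theorem integral_ringProfile_sq_pos : 0 < ∫ x, ringProfile x ^ 2 := by
  have hc : Continuous ringProfile := (contDiff_ringProfile (n := 0)).continuous
  refine (hc.pow 2).integral_pos_of_hasCompactSupport_nonneg_nonzero
    (hasCompactSupport_ringProfile.comp_left (g := fun s => s ^ 2) (by simp))
    (fun x => sq_nonneg _) (x := !₂[1, 1, 0]) ?_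
  have h1 : rsq !₂[1, 1, 0] = 2 := by
    simp [rsq]
    norm_num
  have h2 : (!₂[1, 1, 0] : Space) 2 = 0 := rfl
  have h3 : ringProfile !₂[1, 1, 0] = 1 := by
    rw [ringProfile, h1, h2]
    exact Real.smoothTransition.one_of_one_le (by norm_num)
  rw [h3]
  norm_num

/-- The ring of amplitude `a` and radius of order `L`. -/
def ring (a L : ℝ) (x : Space) : ℝ := a * ringProfile (L⁻¹ • x)

theorem rsq_smul (c : ℝ) (x : Space) : rsq (c • x) = c ^ 2 * rsq x := by
  simp only [rsq, PiLp.smul_apply, smul_eq_mul]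
  ring

section Ring

variable {a L : ℝ}

theorem mem_tsupport_of_mem_tsupport_ring {x : Space} (hx : x ∈ tsupport (ring a L)) :
    L⁻¹ • x ∈ tsupport ringProfile := by
  have h1 : tsupport (ring a L) ⊆ (fun x => L⁻¹ • x) ⁻¹' tsupport ringProfile := by
    refine closure_minimal (fun y hy => ?_) ((isClosed_tsupport _).preimage (continuous_const_smul _))
    exact subset_tsupport _ fun h0 => hy (by simp [ring, h0])
  exact h1 hx

theorem sq_le_rsq_of_mem_tsupport_ring (hL : L ≠ 0) {x : Space} (hx : x ∈ tsupport (ring a L)) :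
    L ^ 2 ≤ rsq x := by
  have h1 := one_le_rsq_of_mem_tsupport (mem_tsupport_of_mem_tsupport_ring hx)
  rw [rsq_smul, inv_pow, ← div_eq_inv_mul, le_div_iff₀ (by positivity)] at h1
  linarith

theorem isCylTest_ring (a : ℝ) (hL : L ≠ 0) : IsCylTest (ring a L) := by
  refine ⟨contDiff_const.mul (contDiff_ringProfile.comp (contDiff_const_smul _)), ?_, ?_, ?_⟩
  · exact (hasCompactSupport_ringProfile.comp_homeomorph
      (Homeomorph.smulOfNeZero L⁻¹ (inv_ne_zero hL))).mul_left
  · intro x hx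
    have := sq_le_rsq_of_mem_tsupport_ring hL hx
    exact (lt_of_lt_of_le (by positivity) this).ne'
  · intro x x' h1 h2
    simp only [ring, ringProfile, rsq_smul, PiLp.smul_apply, h1, h2]

theorem grad_ring (a L : ℝ) (x : Space) : grad (ring a L) x = (a * L⁻¹) • grad ringProfile (L⁻¹ • x) := by
  have h1 : fderiv ℝ (ring a L) x = a • L⁻¹ • fderiv ℝ ringProfile (L⁻¹ • x) := by
    have h2 : ring a L = a • fun x => ringProfile (L⁻¹ • x) := by ext; rfl
    rw [h2, fderiv_const_smul, fderiv_comp_smul]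
    exact ((contDiff_ringProfile (n := 1)).comp (contDiff_const_smul _)).differentiable
      one_ne_zero |>.differentiableAt
  ext i
  simp [grad, h1, mul_assoc]

theorem integral_comp_inv_smul_space (f : Space → ℝ) (hL : 0 < L) :
    ∫ x, f (L⁻¹ • x) = L ^ 3 * ∫ x, f x := by
  rw [Measure.integral_comp_inv_smul]
  simp [abs_of_pos hL]

theorem integral_ring_sq (a : ℝ) (hL : 0 < L) :
    ∫ x, ring a L x ^ 2 = a ^ 2 * (L ^ 3 * ∫ x, ringProfile x ^ 2) := by
  rw [← integral_comp_inv_smul_space _ hL, ← integral_const_mul]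
  simp only [ring, mul_pow]

/-- The energy of a ring whose angular momentum number is comparable to its radius is at most
proportional to its mass. -/
theorem staticEnergy_ring_le {F : ℝ → ℝ} {C k : ℝ} (hC0 : 0 ≤ C)
    (hC : ∀ s ∈ Set.Icc 0 k, F s ≤ C * s ^ 2) (ha : a ∈ Set.Icc 0 k) (hL : 1 ≤ L)
    {ω : ℝ} (hω : ω ^ 2 = 1) {ℓ : ℤ} (hℓ : (ℓ : ℝ) ^ 2 = L ^ 2) :
    staticEnergy F (ring a L) ω ℓ ≤ ENNReal.ofReal (a ^ 2 * (L ^ 3 *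
      ∫ x, (1 / 2 * ‖grad ringProfile x‖ ^ 2 + (1 + C) * ringProfile x ^ 2))) := by
  have hL0 : 0 < L := by linarith
  set D : Space → ℝ := fun x => 1 / 2 * ‖grad ringProfile x‖ ^ 2 + (1 + C) * ringProfile x ^ 2 with hD
  have hDi : Integrable D volume := by
    have hs : ContDiff ℝ 1 ringProfile := contDiff_ringProfile (n := 1)
    refine Continuous.integrable_of_hasCompactSupport ?_ ?_
    · exact ((continuous_grad hs).norm.pow 2 |>.const_mul _).add ((hs.continuous.pow 2).const_mul _)
    · refine HasCompactSupport.intro hasCompactSupport_ringProfile fun x hx => ?_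
      simp [hD, grad_eq_zero hx, image_eq_zero_of_notMem_tsupport hx]
  have hD0 : ∀ x, 0 ≤ D x := fun x => by positivity
  rw [← integral_comp_inv_smul_space D hL0, ← integral_const_mul,
    ofReal_integral_eq_lintegral_ofReal
      ((hDi.comp_smul (inv_ne_zero hL0.ne')).const_mul _)
      (Eventually.of_forall fun x => mul_nonneg (sq_nonneg _) (hD0 _)), staticEnergy]
  refine lintegral_mono_ae ?_
  filter_upwards [weakGrad_isCylTest (isCylTest_ring a hL0.ne')] with x hx
  refine ENNReal.ofReal_le_ofReal ?_
  have hP0 := ringProfile_nonneg (L⁻¹ • x)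
  have hP1 := ringProfile_le_one (L⁻¹ • x)
  have h1 : F (ring a L x) ≤ C * ring a L x ^ 2 :=
    hC _ ⟨mul_nonneg ha.1 hP0, (mul_le_of_le_one_right ha.1 hP1).trans ha.2⟩
  -- The ring stays at distance at least `L = |ℓ|` from the axis, so the centrifugal coefficient is
  -- at most one there.
  have h2 : (ℓ : ℝ) ^ 2 / rsq x * ring a L x ^ 2 ≤ ring a L x ^ 2 := by
    by_cases hx : x ∈ tsupport (ring a L)
    · refine mul_le_of_le_one_left (sq_nonneg _) ?_
      rw [hℓ]
      exact div_le_one_of_le₀ (sq_le_rsq_of_mem_tsupport_ring hL0.ne' hx) (rsq_nonneg x)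
    · simp [image_eq_zero_of_notMem_tsupport hx]
  have h3 : ‖weakGrad (ring a L) x‖ ^ 2 ≤ a ^ 2 * ‖grad ringProfile (L⁻¹ • x)‖ ^ 2 := by
    rw [hx, grad_ring, norm_smul, mul_pow, Real.norm_eq_abs, sq_abs, mul_pow]
    refine mul_le_mul_of_nonneg_right (mul_le_of_le_one_right (sq_nonneg _) ?_) (sq_nonneg _)
    exact pow_le_one₀ (by positivity) (inv_le_one_of_one_le₀ hL)
  have h4 : ring a L x ^ 2 = a ^ 2 * ringProfile (L⁻¹ • x) ^ 2 := by rw [ring, mul_pow]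
  rw [hω, hD]
  have h5 : a ^ 2 * (1 / 2 * ‖grad ringProfile (L⁻¹ • x)‖ ^ 2 +
      (1 + C) * ringProfile (L⁻¹ • x) ^ 2) = 1 / 2 * (a ^ 2 * ‖grad ringProfile (L⁻¹ • x)‖ ^ 2) +
      ring a L x ^ 2 + C * ring a L x ^ 2 := by
    rw [h4]
    ring
  dsimp only
  rw [h5]
  linarith

end Ring

/-- Rings carrying a prescribed angular momentum have arbitrarily small charge and energy. -/
theorem exists_ring {F : ℝ → ℝ} (hF : Tame F) {c : ℝ} (hc : 0 ≤ c) {ω : ℝ} (hω : ω ^ 2 = 1)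
    {ε : ℝ} (hε : 0 < ε) : ∀ᶠ n : ℕ in atTop, ∃ w : Space → ℝ, IsCylTest w ∧ (∀ x, 0 ≤ w x) ∧
      (∀ x ∈ tsupport w, (n : ℝ) ^ 2 ≤ rsq x) ∧ ∫ x, w x ^ 2 = c / n ∧
      staticEnergy F w ω n ≤ ENNReal.ofReal ε := by
  set I := ∫ x, ringProfile x ^ 2 with hI
  have hI0 : 0 < I := integral_ringProfile_sq_pos
  -- This bounds the amplitudes of all the rings used below, so a single constant `C` serves for
  -- every `n ≥ 1`.
  obtain ⟨C, hC0, hC⟩ := hF.le_sq (√(c / I))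
  set J := ∫ x, (1 / 2 * ‖grad ringProfile x‖ ^ 2 + (1 + C) * ringProfile x ^ 2) with hJ
  have hlim : Tendsto (fun n : ℕ => c / I * J / n) atTop (𝓝 0) :=
    tendsto_const_div_atTop_nhds_zero_nat _
  filter_upwards [hlim.eventually (gt_mem_nhds hε), eventually_ge_atTop 1] with n hn hn1
  have hn1' : (1 : ℝ) ≤ n := by exact_mod_cast hn1
  have hn0 : (0 : ℝ) < n := by linarith
  -- The volume of the ring scales like `n³`, so this amplitude gives mass `a² n³ I = c / n` and an
  -- energy bound `c J / (I n)`.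
  set a := √(c / I / n ^ 4) with ha
  have ha2 : a ^ 2 = c / I / n ^ 4 := Real.sq_sqrt (by positivity)
  have hak : a ≤ √(c / I) := Real.sqrt_le_sqrt
    (div_le_self (by positivity) (one_le_pow₀ hn1'))
  have ha0 : 0 ≤ a := Real.sqrt_nonneg _
  refine ⟨ring a n, isCylTest_ring a hn0.ne', fun x => mul_nonneg ha0 (ringProfile_nonneg _),
    fun x hx => sq_le_rsq_of_mem_tsupport_ring hn0.ne' hx, ?_, ?_⟩
  · rw [integral_ring_sq a hn0, ha2, ← hI]
    field_simp
  · refine (staticEnergy_ring_le hC0 hC ⟨ha0, hak⟩ hn1' hω (by simp)).trans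
      (ENNReal.ofReal_le_ofReal (le_trans (le_of_eq ?_) hn.le))
    rw [ha2, ← hJ]
    field_simp

/-! ### Comparison of the infima -/

theorem lintegral_half_norm_sq_add {E : Type*} [NormedAddCommGroup E] {g : Space → E} {r : Space → ℝ}
    (hr : Integrable r volume) (h0 : ∀ x, 0 ≤ r x) :
    ∫⁻ x, ENNReal.ofReal (1 / 2 * ‖g x‖ ^ 2 + r x) =
      ENNReal.ofReal (1 / 2) * (∫⁻ x, ‖g x‖ₑ ^ 2) + ENNReal.ofReal (∫ x, r x) := by
  rw [ofReal_integral_eq_lintegral_ofReal hr (Eventually.of_forall h0),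
    ← lintegral_const_mul' _ _ ENNReal.ofReal_ne_top,
    ← lintegral_add_right' _ hr.aemeasurable.ennreal_ofReal]
  refine lintegral_congr fun x => ?_
  rw [ENNReal.ofReal_add (by positivity) (h0 x), ENNReal.ofReal_mul (by norm_num), ofReal_norm_sq]

theorem IsCylTest.integrable_sq {V : Space → ℝ} (hV : IsCylTest V) :
    Integrable (fun x => V x ^ 2) volume :=
  (hV.1.continuous.memLp_of_hasCompactSupport (p := 2) hV.2.1).integrable_sq

theorem staticEnergy_zero {F : ℝ → ℝ} (hF : Tame F) {V : Space → ℝ} (hV : IsCylTest V)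
    (h0 : ∀ x, 0 ≤ V x) (ω : ℝ) :
    staticEnergy F V ω 0 = ENNReal.ofReal (1 / 2) * (∫⁻ x, ‖grad V x‖ₑ ^ 2) +
      ENNReal.ofReal (1 / 2 * ω ^ 2 * (∫ x, V x ^ 2) + ∫ x, F (V x)) := by
  have hFi : Integrable (fun x => F (V x)) volume := by
    rw [Tame.comp_eq F h0]
    exact (hF.continuous_abs.comp hV.1.continuous).integrable_of_hasCompactSupport
      (hV.2.1.comp_left (g := fun s => F |s|) (by simp [hF.zero]))
  have h1 := hV.integrable_sq.const_mul (1 / 2 * ω ^ 2)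
  have h2 : Integrable (fun x => 1 / 2 * ω ^ 2 * V x ^ 2 + F (V x)) volume := h1.add hFi
  rw [← integral_const_mul, ← integral_add h1 hFi, ← lintegral_half_norm_sq_add h2
    (fun x => add_nonneg (by positivity) (hF.nonneg _ (h0 x))), staticEnergy]
  refine lintegral_congr_ae ?_
  filter_upwards [weakGrad_isCylTest hV] with x hx
  rw [hx]
  simp only [Int.cast_zero]
  congr 1
  ring

theorem integrable_of_energy_lt_top {F : ℝ → ℝ} (hF : Tame F) {Ψ : State} (hΨ : Ψ ∈ phaseSpace)
    (hfin : energy F Ψ < ⊤) : Integrable (fun x => F ‖Ψ.1 x‖) volume := by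
  refine ⟨hF.aestronglyMeasurable (fun x => norm_nonneg _) hΨ.1.1.1.norm, ?_⟩
  refine lt_of_le_of_lt (lintegral_mono fun x => ?_) hfin
  rw [← ofReal_norm, Real.norm_of_nonneg (hF.nonneg _ (norm_nonneg _))]
  refine ENNReal.ofReal_le_ofReal ?_
  nlinarith [sq_nonneg ‖Ψ.2 x‖, sq_nonneg ‖weakGrad Ψ.1 x‖]

theorem energy_eq {F : ℝ → ℝ} (hF : Tame F) {Ψ : State} (hΨ : Ψ ∈ phaseSpace)
    (hi : Integrable (fun x => F ‖Ψ.1 x‖) volume) :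
    energy F Ψ = ENNReal.ofReal (1 / 2) * (∫⁻ x, ‖weakGrad Ψ.1 x‖ₑ ^ 2) +
      ENNReal.ofReal (1 / 2 * (∫ x, ‖Ψ.2 x‖ ^ 2) + ∫ x, F ‖Ψ.1 x‖) := by
  have h1 := (hΨ.2.norm.integrable_sq).const_mul (1 / 2)
  have h2 : Integrable (fun x => 1 / 2 * ‖Ψ.2 x‖ ^ 2 + F ‖Ψ.1 x‖) volume := h1.add hi
  rw [← integral_const_mul, ← integral_add h1 hi, ← lintegral_half_norm_sq_add h2
    (fun x => add_nonneg (by positivity) (hF.nonneg _ (norm_nonneg _))), energy]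
  refine lintegral_congr fun x => ?_
  congr 1
  ring

/-- Cauchy–Schwarz, through the discriminant of a nonnegative quadratic polynomial. It bounds the
kinetic energy below by that of a standing wave with the same charge and the same mass. -/
theorem charge_sq_le {Ψ : State} (hΨ : Ψ ∈ phaseSpace) :
    charge Ψ ^ 2 ≤ (∫ x, ‖Ψ.2 x‖ ^ 2) * ∫ x, ‖Ψ.1 x‖ ^ 2 := by
  have hA := hΨ.2.norm.integrable_sq
  have hB := hΨ.1.1.norm.integrable_sq
  have hM : Integrable (fun x => ‖Ψ.2 x‖ * ‖Ψ.1 x‖) volume :=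
    memLp_one_iff_integrable.1 (hΨ.1.1.norm.smul hΨ.2.norm)
  set A := ∫ x, ‖Ψ.2 x‖ ^ 2
  set B := ∫ x, ‖Ψ.1 x‖ ^ 2
  set M := ∫ x, ‖Ψ.2 x‖ * ‖Ψ.1 x‖
  have h1 : ∀ s : ℝ, 0 ≤ B * (s * s) + -2 * M * s + A := by
    intro s
    have h2 : ∫ x, (‖Ψ.2 x‖ - s * ‖Ψ.1 x‖) ^ 2 = B * (s * s) + -2 * M * s + A := by
      have h3 : ∀ x, (‖Ψ.2 x‖ - s * ‖Ψ.1 x‖) ^ 2 =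
          (s * s) * ‖Ψ.1 x‖ ^ 2 + (-2 * s) * (‖Ψ.2 x‖ * ‖Ψ.1 x‖) + ‖Ψ.2 x‖ ^ 2 := fun x => by ring
      simp_rw [h3]
      have h4 := hB.const_mul (s * s)
      have h5 := hM.const_mul (-2 * s)
      have h6 : Integrable (fun x => s * s * ‖Ψ.1 x‖ ^ 2 + -2 * s * (‖Ψ.2 x‖ * ‖Ψ.1 x‖)) volume :=
        h4.add h5
      rw [integral_add h6 hA, integral_add h4 h5, integral_const_mul, integral_const_mul]
      ring
    rw [← h2]
    exact integral_nonneg fun x => sq_nonneg _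
  have h2 : M ^ 2 ≤ A * B := by
    have := discrim_le_zero h1
    rw [discrim] at this
    nlinarith
  have h3 : |charge Ψ| ≤ M := by
    refine (Complex.abs_im_le_norm _).trans ((norm_integral_le_integral_norm _).trans (le_of_eq ?_))
    refine integral_congr_ae (Eventually.of_forall fun x => ?_)
    simp
  rw [← sq_abs]
  exact (pow_le_pow_left₀ (abs_nonneg _) h3 2).trans h2

theorem ofReal_half_mul_add {δ : ℝ} (hδ : 0 ≤ δ) (G : ℝ≥0∞) {r : ℝ} (hr : 0 ≤ r) :
    ENNReal.ofReal (1 / 2) * (G + ENNReal.ofReal δ) + ENNReal.ofReal r =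
      ENNReal.ofReal (1 / 2) * G + ENNReal.ofReal (1 / 2 * δ + r) := by
  rw [mul_add, ← ENNReal.ofReal_mul (by norm_num), add_assoc,
    ← ENNReal.ofReal_add (by positivity) hr]

/-- The energy of a field is approached by cylindrical test functions of the same charge. -/
theorem exists_isCylTest_staticEnergy_le {F : ℝ → ℝ} (hF : Tame F) {h : ℝ} (hh : h ≠ 0) {Ψ : State}
    (hΨ : Ψ ∈ chargeSet h) (hfin : energy F Ψ < ⊤) {ε : ℝ} (hε : 0 < ε) :
    ∃ V, IsCylTest V ∧ (∀ x, 0 ≤ V x) ∧ 0 < ∫ x, V x ^ 2 ∧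
      staticEnergy F V (-(h / ∫ x, V x ^ 2)) 0 ≤ energy F Ψ + ENNReal.ofReal ε := by
  have hi := integrable_of_energy_lt_top hF hΨ.1 hfin
  have hcs := charge_sq_le hΨ.1
  rw [hΨ.2] at hcs
  rw [energy_eq hF hΨ.1 hi]
  set A := ∫ x, ‖Ψ.2 x‖ ^ 2
  set B := ∫ x, ‖Ψ.1 x‖ ^ 2
  have hA0 : 0 ≤ A := integral_nonneg fun x => sq_nonneg _
  have hh2 : 0 < h ^ 2 := by positivity
  have hB0 : 0 < B := by
    by_contra hc
    nlinarith
  have hAB : h ^ 2 / B ≤ A := (div_le_iff₀ hB0).2 hcs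
  have hφ0 : 0 ≤ ∫ x, F ‖Ψ.1 x‖ := integral_nonneg fun x => hF.nonneg _ (norm_nonneg _)
  -- Smoothing and removal of the axis each cost `δ` of mass and `δ` of potential, and the second
  -- also adds `δ` to the Dirichlet integral: in all `2 δ` of mass and `2 δ + δ / 2` of energy.
  have hlim : Tendsto (fun δ : ℝ => 1 / 2 * (h ^ 2 / (B - 2 * δ)) + 5 / 2 * δ) (𝓝[>] 0)
      (𝓝 (1 / 2 * (h ^ 2 / B))) := by
    have hc : ContinuousAt (fun δ : ℝ => 1 / 2 * (h ^ 2 / (B - 2 * δ)) + 5 / 2 * δ) 0 := by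
      have : B - 2 * 0 ≠ 0 := by simpa using hB0.ne'
      fun_prop (disch := assumption)
    have := hc.tendsto
    simp only [mul_zero, sub_zero, add_zero] at this
    exact this.mono_left nhdsWithin_le_nhds
  obtain ⟨δ, ⟨hδ1, hδ2⟩, hδ0⟩ := ((hlim.eventually (gt_mem_nhds (lt_add_of_pos_right _ hε))).and
    ((nhdsWithin_le_nhds (gt_mem_nhds (half_pos hB0))))).and self_mem_nhdsWithin |>.exists
  change δ < B / 2 at hδ2
  obtain ⟨V, hVs, hVc, ⟨k, hk⟩, hVr, hV1, hV2, hV3⟩ := exists_smooth_radial hF hΨ.1.1 hi hδ0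
  obtain ⟨U, hU, hU0, hU1, hU2, hU3⟩ := exists_isCylTest hF hVs hVc hk hVr hδ0
  have hb : B - 2 * δ ≤ ∫ x, U x ^ 2 := by linarith
  have hb0 : 0 < B - 2 * δ := by linarith
  refine ⟨U, hU, hU0, by linarith, ?_⟩
  rw [staticEnergy_zero hF hU hU0]
  set b := ∫ x, U x ^ 2
  have hbp : 0 < b := hb0.trans_le hb
  have e1 : 1 / 2 * (-(h / b)) ^ 2 * b = 1 / 2 * (h ^ 2 / b) := by field_simp
  have e2 : h ^ 2 / b ≤ h ^ 2 / (B - 2 * δ) := div_le_div_of_nonneg_left hh2.le hb0 hb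
  have e3 : 0 ≤ ∫ x, F (U x) := integral_nonneg fun x => hF.nonneg _ (hU0 x)
  rw [e1]
  calc ENNReal.ofReal (1 / 2) * (∫⁻ x, ‖grad U x‖ₑ ^ 2) +
        ENNReal.ofReal (1 / 2 * (h ^ 2 / b) + ∫ x, F (U x))
      ≤ ENNReal.ofReal (1 / 2) * ((∫⁻ x, ‖weakGrad Ψ.1 x‖ₑ ^ 2) + ENNReal.ofReal δ) +
        ENNReal.ofReal (1 / 2 * (h ^ 2 / b) + ∫ x, F (U x)) := by
        gcongr
        exact hU1.trans (by gcongr)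
    _ = ENNReal.ofReal (1 / 2) * (∫⁻ x, ‖weakGrad Ψ.1 x‖ₑ ^ 2) +
        ENNReal.ofReal (1 / 2 * δ + (1 / 2 * (h ^ 2 / b) + ∫ x, F (U x))) :=
        ofReal_half_mul_add hδ0.le _ (by positivity)
    _ ≤ ENNReal.ofReal (1 / 2) * (∫⁻ x, ‖weakGrad Ψ.1 x‖ₑ ^ 2) +
        ENNReal.ofReal (1 / 2 * A + (∫ x, F ‖Ψ.1 x‖) + ε) := by
        exact add_le_add le_rfl (ENNReal.ofReal_le_ofReal (by linarith))
    _ = _ := by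
        rw [ENNReal.ofReal_add (by positivity) hε.le, add_assoc]

/-- Adding a distant ring prescribes the angular momentum at an arbitrarily small cost in energy. -/
theorem exists_mem_chargeMomentumSet {F : ℝ → ℝ} (hF : Tame F) {h : ℝ} {V : Space → ℝ}
    (hV : IsCylTest V) (h0 : ∀ x, 0 ≤ V x) (hb : 0 < ∫ x, V x ^ 2) (M : ℝ) {ε : ℝ} (hε : 0 < ε) :
    ∃ Φ ∈ chargeMomentumSet h ![0, 0, M],
      energy F Φ ≤ staticEnergy F V (-(h / ∫ x, V x ^ 2)) 0 + ENNReal.ofReal ε := by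
  -- The frequency of the ring. Its sign is opposite to that of `M`, since the charge is minus
  -- frequency times mass and the winding number `n` is positive.
  obtain ⟨s, hs, hsM⟩ : ∃ s : ℝ, s ^ 2 = 1 ∧ -(s * |M|) = M := by
    rcases le_total 0 M with hM | hM
    · exact ⟨-1, by norm_num, by rw [abs_of_nonneg hM]; ring⟩
    · exact ⟨1, by norm_num, by rw [abs_of_nonpos hM]; ring⟩
  rw [staticEnergy_zero hF hV h0]
  set b := ∫ x, V x ^ 2 with hbdef
  have hlim : Tendsto (fun n : ℕ => 1 / 2 * (-((h - M / n) / b)) ^ 2 * b) atTop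
      (𝓝 (1 / 2 * (-(h / b)) ^ 2 * b)) := by
    have h1 : Tendsto (fun n : ℕ => M / n) atTop (𝓝 0) := tendsto_const_div_atTop_nhds_zero_nat _
    have h2 := ((((h1.const_sub h).div_const b).neg.pow 2).const_mul (1 / 2)).mul_const b
    rwa [sub_zero] at h2
  -- The support of `V` lies in the ball of radius `R`; for `n > R` it is disjoint from a ring at
  -- distance at least `n` from the axis.
  obtain ⟨R, hR⟩ := hV.2.1.isCompact.isBounded.exists_norm_le
  obtain ⟨n, ⟨⟨w, hw, hw0, hwR, hw2, hwE⟩, hn1⟩, hnR, hn0⟩ :=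
    ((exists_ring hF (abs_nonneg M) hs (half_pos hε)).and
      (hlim.eventually (gt_mem_nhds (lt_add_of_pos_right _ (half_pos hε))))).and
      ((tendsto_natCast_atTop_atTop.eventually (eventually_gt_atTop R)).and
        (eventually_ge_atTop 1)) |>.exists
  have hn0' : (n : ℝ) ≠ 0 := by positivity
  -- The frequency leaves the charge `M / n` to the ring. This wave has no winding and hence no
  -- angular momentum.
  set A := stateAt (vortex V (-((h - M / n) / b)) 0) 0
  set W := stateAt (vortex w s n) 0
  have hA : RegularState A := hV.regularState _ _ _
  have hW : RegularState W := hw.regularState _ _ _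
  have hd : ∀ x, VanishesAt A x ∨ VanishesAt W x := by
    intro x
    by_cases hx : x ∈ tsupport V
    · refine Or.inr (vanishesAt_vortex (fun hx' => ?_) hw _ _ _)
      have h1 := hwR x hx'
      have h2 := hR x hx
      have h3 := norm_sq_eq_rsq x
      nlinarith [norm_nonneg x, sq_nonneg (x 2)]
    · exact Or.inl (vanishesAt_vortex hx hV _ _ _)
  refine ⟨A + W, ⟨(hA.add hW).mem_phaseSpace, ?_, (hA.add hW).integrable_angularDensity, ?_⟩, ?_⟩
  · rw [hA.charge_add hW hd, charge_vortex, charge_vortex, staticCharge_eq, staticCharge_eq, hw2,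
      ← hbdef]
    have h1 : -(s * (|M| / n)) = M / n := by
      rw [← mul_div_assoc, ← neg_div, hsM]
    rw [h1]
    field_simp
    ring
  · rw [hA.angularMomentum_add hW hd, hV.cylClosure.angularMomentum_vortex,
      hw.cylClosure.angularMomentum_vortex, staticCharge_eq w, hw2]
    have h1 : (n : ℝ) * -(s * (|M| / n)) = M := by
      rw [← mul_div_assoc, ← neg_div, hsM]
      field_simp
    ext i
    fin_cases i <;> simp
    simpa using h1
  · rw [hA.energy_add hF hW hd, hV.cylClosure.energy_vortex F (Eventually.of_forall h0),
      hw.cylClosure.energy_vortex F (Eventually.of_forall hw0), staticEnergy_zero hF hV h0, ← hbdef]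
    have hF0 : 0 ≤ ∫ x, F (V x) := integral_nonneg fun x => hF.nonneg _ (h0 x)
    have hε2 : ENNReal.ofReal ε = ENNReal.ofReal (ε / 2) + ENNReal.ofReal (ε / 2) := by
      rw [← ENNReal.ofReal_add (by positivity) (by positivity), add_halves]
    rw [hε2, ← add_assoc]
    refine add_le_add ?_ hwE
    rw [add_assoc, ← ENNReal.ofReal_add (by positivity) (by positivity)]
    exact add_le_add le_rfl (ENNReal.ofReal_le_ofReal (by linarith))

/-! ### Assembling the comparison -/

theorem mem_C_of_isCylTest {h : ℝ} (hh : 0 < h) {V : Space → ℝ} (hV : IsCylTest V)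
    (h0 : ∀ x, 0 ≤ V x) (hb : 0 < ∫ x, V x ^ 2) : (V, -(h / ∫ x, V x ^ 2)) ∈ C h := by
  refine ⟨hV.mem_cylCone h0, neg_lt_zero.2 (div_pos hh hb), ?_⟩
  rw [staticCharge_eq]
  dsimp only
  field_simp

theorem pos_of_mem_C {h : ℝ} (hh : h ≠ 0) {u : Space → ℝ} {ω : ℝ} (hu : (u, ω) ∈ C h) : 0 < h := by
  refine lt_of_le_of_ne ?_ hh.symm
  have h1 : staticCharge u ω = h := hu.2.2
  have h2 : ω < 0 := hu.2.1
  have h3 : 0 ≤ ∫ x, u x ^ 2 := integral_nonneg fun x => sq_nonneg _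
  rw [← h1, staticCharge_eq]
  nlinarith

theorem iInf_C_le {F : ℝ → ℝ} (hF : Tame F) {h : ℝ} (hh : 0 < h) {Ψ : State} (hΨ : Ψ ∈ chargeSet h) :
    (⨅ p ∈ C h, staticEnergy F p.1 p.2 0) ≤ energy F Ψ := by
  rcases eq_top_or_lt_top (energy F Ψ) with htop | hfin
  · rw [htop]
    exact le_top
  refine ENNReal.le_of_forall_pos_le_add fun ε hε _ => ?_
  obtain ⟨V, hV, h0, hb, hE⟩ := exists_isCylTest_staticEnergy_le hF hh.ne' hΨ hfin
    (NNReal.coe_pos.2 hε)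
  rw [ENNReal.ofReal_coe_nnreal] at hE
  exact (iInf₂_le _ (mem_C_of_isCylTest hh hV h0 hb)).trans hE

theorem iInf_chargeMomentumSet_le {F : ℝ → ℝ} (hF : Tame F) {h : ℝ} (hh : h ≠ 0) {Ψ : State}
    (hΨ : Ψ ∈ chargeSet h) (M : ℝ) :
    (⨅ Φ ∈ chargeMomentumSet h ![0, 0, M], energy F Φ) ≤ energy F Ψ := by
  rcases eq_top_or_lt_top (energy F Ψ) with htop | hfin
  · rw [htop]
    exact le_top
  refine ENNReal.le_of_forall_pos_le_add fun ε hε _ => ?_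
  have hε2 : (0 : ℝ) < ε / 2 := half_pos (NNReal.coe_pos.2 hε)
  obtain ⟨V, hV, h0, hb, hE⟩ := exists_isCylTest_staticEnergy_le hF hh hΨ hfin hε2
  obtain ⟨Φ, hΦ, hΦE⟩ := exists_mem_chargeMomentumSet hF (h := h) hV h0 hb M hε2
  refine (iInf₂_le _ hΦ).trans (hΦE.trans ((add_le_add_left hE _).trans (le_of_eq ?_)))
  rw [add_assoc, ← ENNReal.ofReal_add hε2.le hε2.le, add_halves, ENNReal.ofReal_coe_nnreal]

theorem stateAt_vortex_mem_chargeSet {h : ℝ} {u : Space → ℝ} {ω : ℝ} (hu : (u, ω) ∈ C h) (ℓ : ℤ)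
    (t : ℝ) : stateAt (vortex u ω ℓ) t ∈ chargeSet h :=
  ⟨(cylClosure_of_mem_cylCone hu.1).stateAt_vortex_mem_phaseSpace ω ℓ t,
    (charge_vortex u ω ℓ t).trans hu.2.2⟩

theorem energy_vortex_of_mem_C (F : ℝ → ℝ) {h : ℝ} {u : Space → ℝ} {ω : ℝ} (hu : (u, ω) ∈ C h)
    (ℓ : ℤ) (t : ℝ) : energy F (stateAt (vortex u ω ℓ) t) = staticEnergy F u ω ℓ :=
  (cylClosure_of_mem_cylCone hu.1).energy_vortex F hu.1.2.2 ω ℓ t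

theorem RegularState.energy_lt_top {F : ℝ → ℝ} (hF : Tame F) {A : State} (hA : RegularState A) :
    energy F A < ⊤ := by
  have h1 : (fun x => F ‖A.1 x‖) = fun x => F |‖A.1 x‖| := by simp
  have h2 : Integrable (fun x => F ‖A.1 x‖) volume := by
    rw [h1]
    exact (hF.continuous_abs.comp hA.contDiff.continuous.norm).integrable_of_hasCompactSupport
      (hA.hasCompactSupport.norm.comp_left (g := fun s => F |s|) (by simp [hF.zero]))
  rw [energy_eq hF hA.mem_phaseSpace h2]
  exact ENNReal.add_lt_top.2 ⟨ENNReal.mul_lt_top ENNReal.ofReal_lt_top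
    (lintegral_enorm_sq_lt_top hA.mem_phaseSpace.1.memLp_weakGrad), ENNReal.ofReal_lt_top⟩

/-- A ring away from the axis has a finite centrifugal term. By minimality the given vortex then has
finite energy, which the strict inequality requires. -/
theorem exists_mem_C_staticEnergy_lt_top {F : ℝ → ℝ} (hF : Tame F) {h : ℝ} (hh : 0 < h) (ℓ : ℤ) :
    ∃ p ∈ C h, staticEnergy F p.1 p.2 ℓ < ⊤ := by
  have hV : IsCylTest (ring 1 1) := isCylTest_ring 1 one_ne_zero
  have h0 : ∀ x, 0 ≤ ring 1 1 x := fun x => mul_nonneg zero_le_one (ringProfile_nonneg _)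
  have hb : 0 < ∫ x, ring 1 1 x ^ 2 := by
    rw [integral_ring_sq 1 one_pos]
    simpa using integral_ringProfile_sq_pos
  refine ⟨_, mem_C_of_isCylTest hh hV h0 hb, ?_⟩
  have h1 := (hV.regularState (-(h / ∫ x, ring 1 1 x ^ 2)) ℓ 0).energy_lt_top hF
  rwa [hV.cylClosure.energy_vortex F (Eventually.of_forall h0)] at h1

/-- The centrifugal term makes the energy of a nonzero profile strictly larger. -/
theorem staticEnergy_zero_lt {F : ℝ → ℝ} (hF : Tame F) {h : ℝ} (hh : h ≠ 0) {u : Space → ℝ} {ω : ℝ}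
    (hu : (u, ω) ∈ C h) {ℓ : ℤ} (hℓ : ℓ ≠ 0) (hfin : staticEnergy F u ω ℓ < ⊤) :
    staticEnergy F u ω 0 < staticEnergy F u ω ℓ := by
  have hℓ2 : (0 : ℝ) < (ℓ : ℝ) ^ 2 := by positivity
  have hm : AEMeasurable (fun x => ENNReal.ofReal (1 / 2 * ((ℓ : ℝ) ^ 2 / rsq x) * u x ^ 2)) volume := by
    have h1 : Measurable rsq := (contDiff_rsq (n := 0)).continuous.measurable
    have h2 : AEMeasurable u volume := hu.1.1.1.1.aemeasurable
    exact ((((measurable_const.div h1).const_mul _).aemeasurable.mul (h2.pow_const 2))).ennreal_ofReal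
  have heq : staticEnergy F u ω ℓ = staticEnergy F u ω 0 +
      ∫⁻ x, ENNReal.ofReal (1 / 2 * ((ℓ : ℝ) ^ 2 / rsq x) * u x ^ 2) := by
    rw [staticEnergy, staticEnergy, ← lintegral_add_right' _ hm]
    refine lintegral_congr_ae ?_
    filter_upwards [hu.1.2.2] with x hx
    have h1 := rsq_nonneg x
    have h2 := hF.nonneg _ hx
    rw [← ENNReal.ofReal_add (by positivity) (by positivity)]
    congr 1
    simp only [Int.cast_zero]
    ring
  -- If it vanished, `u` would be zero off the axis almost everywhere, and the charge `h` would be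
  -- zero.
  have hpos : ∫⁻ x, ENNReal.ofReal (1 / 2 * ((ℓ : ℝ) ^ 2 / rsq x) * u x ^ 2) ≠ 0 := by
    intro h0
    refine hh ?_
    have h1 : staticCharge u ω = h := hu.2.2
    rw [← h1, staticCharge_eq]
    have h2 : ∫ x, u x ^ 2 = 0 := by
      refine integral_eq_zero_of_ae ?_
      filter_upwards [(lintegral_eq_zero_iff' hm).1 h0, ae_rsq_ne_zero] with x hx hx0
      have h3 : 0 < rsq x := lt_of_le_of_ne (rsq_nonneg x) hx0.symm
      have h4 : 0 < 1 / 2 * ((ℓ : ℝ) ^ 2 / rsq x) := by positivity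
      have h5 := ENNReal.ofReal_eq_zero.1 hx
      have h6 := nonpos_of_mul_nonpos_right h5 h4
      exact le_antisymm h6 (sq_nonneg _)
    rw [h2]
    simp
  rw [heq] at hfin ⊢
  exact ENNReal.lt_add_right (ENNReal.add_lt_top.1 hfin).1.ne hpos

end KleinGordon
end

theorem theorem5 (F : ℝ → ℝ) (m : ℝ) (hF : KleinGordon.Admissible F m)
    (ℓ : ℤ) (hℓ : ℓ ≠ 0) (h : ℝ) (hh : h ≠ 0) (u : KleinGordon.Space → ℝ) (ω : ℝ)
    (hu : (u, ω) ∈ KleinGordon.C h)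
    (hmin : IsMinOn (fun p : (KleinGordon.Space → ℝ) × ℝ =>
      KleinGordon.staticEnergy F p.1 p.2 ℓ) (KleinGordon.C h) (u, ω))
    (t : ℝ) (Ψ : KleinGordon.State)
    (hΨ : Ψ = KleinGordon.stateAt (KleinGordon.vortex u ω ℓ) t)
    (μ : Fin 3 → ℝ) (hμ : μ = KleinGordon.angularMomentum Ψ) :
    -- the vortex is a field of charge `h`, angular momentum `(0, 0, ℓ h)` and finite energy
    Ψ ∈ KleinGordon.chargeSet h ∧
    μ = ![0, 0, (ℓ : ℝ) * h] ∧
    KleinGordon.energy F Ψ < ⊤ ∧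
    -- the three infima coincide and lie strictly below its energy
    (⨅ Φ ∈ KleinGordon.chargeMomentumSet h μ, KleinGordon.energy F Φ) =
      (⨅ Φ ∈ KleinGordon.chargeSet h, KleinGordon.energy F Φ) ∧
    (⨅ Φ ∈ KleinGordon.chargeSet h, KleinGordon.energy F Φ) =
      (⨅ p ∈ KleinGordon.C h, KleinGordon.staticEnergy F p.1 p.2 0) ∧
    (⨅ p ∈ KleinGordon.C h, KleinGordon.staticEnergy F p.1 p.2 0) < KleinGordon.energy F Ψ ∧
    -- the vortex does not minimize the energy at fixed charge and angular momentum
    (∃ Φ ∈ KleinGordon.chargeMomentumSet h μ, KleinGordon.energy F Φ < KleinGordon.energy F Ψ) := by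
  have hT := hF.tame
  have hh0 := KleinGordon.pos_of_mem_C hh hu
  have hmom : μ = ![0, 0, (ℓ : ℝ) * h] := by
    rw [hμ, hΨ, (KleinGordon.cylClosure_of_mem_cylCone hu.1).angularMomentum_vortex]
    have h1 : KleinGordon.staticCharge u ω = h := hu.2.2
    rw [h1]
  have hE : KleinGordon.energy F Ψ = KleinGordon.staticEnergy F u ω ℓ := by
    rw [hΨ, KleinGordon.energy_vortex_of_mem_C F hu]
  have hmem : Ψ ∈ KleinGordon.chargeSet h := hΨ ▸ KleinGordon.stateAt_vortex_mem_chargeSet hu ℓ t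
  have hfin : KleinGordon.energy F Ψ < ⊤ := by
    obtain ⟨p, hp, hlt⟩ := KleinGordon.exists_mem_C_staticEnergy_lt_top hT hh0 ℓ
    exact hE ▸ lt_of_le_of_lt (isMinOn_iff.1 hmin p hp) hlt
  have h1 : (⨅ Φ ∈ KleinGordon.chargeMomentumSet h μ, KleinGordon.energy F Φ) =
      (⨅ Φ ∈ KleinGordon.chargeSet h, KleinGordon.energy F Φ) := by
    refine le_antisymm (le_iInf₂ fun Φ hΦ => ?_)
      (le_iInf₂ fun Φ hΦ => iInf₂_le Φ ⟨hΦ.1, hΦ.2.1⟩)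
    rw [hmom]
    exact KleinGordon.iInf_chargeMomentumSet_le hT hh hΦ _
  have h2 : (⨅ Φ ∈ KleinGordon.chargeSet h, KleinGordon.energy F Φ) =
      (⨅ p ∈ KleinGordon.C h, KleinGordon.staticEnergy F p.1 p.2 0) := by
    refine le_antisymm (le_iInf₂ fun p hp => ?_)
      (le_iInf₂ fun Φ hΦ => KleinGordon.iInf_C_le hT hh0 hΦ)
    -- With `ℓ = 0` the pair is realized by an actual field of charge `h`, so it competes in the
    -- larger class.
    rw [← KleinGordon.energy_vortex_of_mem_C F (u := p.1) (ω := p.2) hp 0 0]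
    exact iInf₂_le _ (KleinGordon.stateAt_vortex_mem_chargeSet (u := p.1) (ω := p.2) hp 0 0)
  have h3 : (⨅ p ∈ KleinGordon.C h, KleinGordon.staticEnergy F p.1 p.2 0) <
      KleinGordon.energy F Ψ := by
    rw [hE] at hfin ⊢
    exact lt_of_le_of_lt (iInf₂_le (u, ω) hu) (KleinGordon.staticEnergy_zero_lt hT hh hu hℓ hfin)
  refine ⟨hmem, hmom, hfin, h1, h2, h3, ?_⟩
  have h4 := h3
  rw [← h2, ← h1] at h4
  simp only [iInf_lt_iff] at h4
  obtain ⟨Φ, hΦ, hlt⟩ := h4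
  exact ⟨Φ, hΦ, hlt⟩
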